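/- **Setting.** Let $N,M\in\mathbb N$, $N\ge 1$, $N\ge M$, $h>0$, $T:=Nh$; let $\mathcal K\subseteq\mathbb R^m$ be a closed cone, $\check x_0\in\mathbb R^n$, $\xi_0\in C([-Mh,0],\mathbb R^n)$, and let $f,g_1,\dots,g_m:\mathbb R\times(\mathbb R^n)^{M+1}\to\mathbb R^n$ be bounded and of class $C^1$. Write $\{x(t-kh)\}_k:=(x(t),x(t-h),\dots,x(t-Mh))$ and $\|w\|:=\sum_{j=1}^m|w^j|$ for $w\in\mathbb R^m$. The delay impulse control system is $$\text{(DIS)}\quad \frac{dx}{dt}=f(t,\{x(t-kh)\}_k)+\sum_{j=1}^m g_j(t,\{x(t-kh)\}_k)\frac{du^j}{dt},\quad \frac{dv}{dt}=\sum_{j=1}^m\Big|\frac{du^j}{dt}\Big|,\quad \frac{du}{dt}\in\mathcal K,$$ with $(x,v)(0)=(\check x_0,0)$ and $x=\xi_0$ on $[-Mh,0[$. For a finite signed Borel measure $\mu$ on $[0,T]$ with values in $\mathbb R^m$, $\mu^c$ is its continuous (atomless) component and $|\mu|=\sum_j(\mu^j_++\mu^j_-)$ (Jordan decompositions of the components).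 $C^*_{\mathcal K}([0,T])$ is the set of such measures with range in $\mathcal K$. For $\mu\in C^*_{\mathcal K}([0,T])$, $\mathcal V_c(\mu)$ is the set of finite nonnegative Borel measures $\nu$ on $[0,T]$ such that $\nu^c=|\mu^c|$ and, for some sequence $(\mu_i)\subset C^*_{\mathcal K}([0,T])$, $(\mu_i,|\mu_i|)$ converges weakly-$*$ to $(\mu,\nu)$ (that is, when integrated against each $\psi\in C([0,T],\mathbb R)$). **Impulse controls.** An impulse control $(\mu,\nu,\{\omega^r\}_{r\in[0,h]})$ consists of $\mu\in C^*_{\mathcal K}([0,T])$, $\nu\in\mathcal V_c(\mu)$ and essentially bounded measurable functions $\omega^r=(\omega^r_1,\dots,\omega^r_N):[0,1]\to\mathcal K^N$, $r\in[0,h]$, such that (with $\omega^h_0\equiv0$, $\omega^0_{N+1}\equiv 0$): (i) for each $r\in[0,h]$, $\sum_{l=1}^N\|\omega^r_l(s)\|=\sum_{l=1}^N\int_0^1\|\omega^r_l(s')\|\,ds'$ for a.e. $s\in[0,1]$; (ii) $\int_0^1\|\omega^r_l(s)\|\,ds=\nu(\{r+(l-1)h\})$ and $\int_0^1\omega^r_l(s)\,ds=\mu(\{r+(l-1)h\})$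 for $r\in\,]0,h[$, $l=1,\dots,N$; (iii) $\int_0^1[\|\omega^h_l(s)\|+\|\omega^0_{l+1}(s)\|]\,ds=\nu(\{lh\})$ and $\int_0^1[\omega^h_l(s)+\omega^0_{l+1}(s)]\,ds=\mu(\{lh\})$ for $l=0,\dots,N$. **Impulse solutions.** A pair of functions $x:[-Mh,T]\to\mathbb R^n$, $v:[0,T]\to\mathbb R$, both of bounded variation on $[0,T]$, is an impulse solution of (DIS) associated with $(\mu,\nu,\{\omega^r\})$ if $x=\xi_0$ on $[-Mh,0[$, $(x,v)(0)=(\check x_0,0)$, and there are functions $\zeta^r_l:[0,1]\to\mathbb R^n$, $\theta^r_l:[0,1]\to[0,\infty)$ such that the following hold ($z^-$ denotes the left limit). (a) $\theta^r_0\equiv0$; $\zeta^r_0(s)=\xi_0(r-h)$ if $s\in[0,1[$ or $r\in[0,h[$; $\zeta^h_0(1)=\check x_0$; and $\zeta^r_{-a}\equiv\xi_0(r-(a+1)h)$ for $a=1,\dots,M-1$. (b) For $l=1,\dots,N$ and $r\in[0,h]$, and also for $(l,r)=(N+1,0)$, $\zeta^r_l$ is the Carathéodory solution on $[0,1]$ of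 $$\frac{d\zeta^r_l}{ds}(s)=\sum_{j=1}^m g_j\big(r+(l-1)h,\{\zeta^r_{l-k}(s)\}_k\big)(\omega^r_l)^j(s),\qquad \theta^r_l(s)=\theta^r_l(0)+\int_0^s\|\omega^r_l(s')\|\,ds',$$ where $(\zeta^r_l,\theta^r_l)(0)=(x^-,v^-)(r+(l-1)h)$ if $r>0$, and $(\zeta^0_l,\theta^0_l)(0)=(\zeta^h_{l-1},\theta^h_{l-1})(1)$. (c) $(x,v)((l-1)h)=(\zeta^0_l,\theta^0_l)(1)$ for $l=2,\dots,N+1$. (d) For $l=1,\dots,N$ and $t\in\,](l-1)h,lh[$, with convergent sums, $$x(t)=\zeta^0_l(1)+\int_{(l-1)h}^t f(t',\{x(t'-kh)\}_k)\,dt'+\sum_{j=1}^m\int_{[(l-1)h,t]}g_j(t',\{x(t'-kh)\}_k)\,d(\mu^c)^j(t')+\sum_{r\in]0,t-(l-1)h]}\big(\zeta^r_l(1)-x^-(r+(l-1)h)\big),$$ $$v(t)=\theta^0_l(1)+\nu^c([(l-1)h,t])+\sum_{r\in]0,t-(l-1)h]}\big(\theta^r_l(1)-v^-(r+(l-1)h)\big).$$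 **Proposition.** For every impulse control $(\mu,\nu,\{\omega^r\}_{r\in[0,h]})$ there exists an associated impulse solution $(x,v)$ of (DIS), and it is unique. Moreover, if $\xi_0$ has bounded variation on $[-Mh,0]$, then $x$ has bounded variation on $[-Mh,T]$. -/

import Mathlib

open MeasureTheory Set Filter Topology

noncomputable section

/-! ### Vector measures on the line -/

/-- The norm `‖w‖ = ∑ j, |w j|` on `ℝᵐ`. -/
def l1Norm {m : ℕ} (w : Fin m → ℝ) : ℝ := ∑ j, |w j|

/-- The `j`-th component of an `ℝᵐ`-valued measure. -/
def coordMeasure {m : ℕ} (μ : VectorMeasure ℝ (Fin m → ℝ)) (j : Fin m) : SignedMeasure ℝ :=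
  μ.mapRange (Pi.evalAddMonoidHom (fun _ : Fin m => ℝ) j) (continuous_apply j)

/-- The total variation measure `|μ| = ∑ j, (μʲ₊ + μʲ₋)`, where `μʲ₊`, `μʲ₋` form the Jordan
decomposition of the `j`-th component. -/
def totalVar {m : ℕ} (μ : VectorMeasure ℝ (Fin m → ℝ)) : Measure ℝ :=
  ∑ j, (coordMeasure μ j).totalVariation

/-- The continuous component `μᶜ` of an `ℝᵐ`-valued measure: `μ` with its atoms removed. (The set
of atoms is countable, so the set below is measurable; see `measurableSet_not_atom`.) -/
def contPart {m : ℕ} (μ : VectorMeasure ℝ (Fin m → ℝ)) : VectorMeasure ℝ (Fin m → ℝ) :=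
  μ.restrict {t | μ {t} = 0}

/-- The continuous component `νᶜ` of a nonnegative measure: `ν` with its atoms removed. -/
def measureContPart (ν : Measure ℝ) : Measure ℝ := ν.restrict {t | ν {t} = 0}

/-- The atoms of a signed measure on `ℝ` are countably many. -/
theorem countable_signed_atoms (s : SignedMeasure ℝ) : {t : ℝ | s {t} ≠ 0}.Countable := by
  have hc : {t : ℝ | 0 < s.totalVariation {t}}.Countable := by
    have : IsFiniteMeasure s.totalVariation := by
      unfold SignedMeasure.totalVariation
      infer_instance
    refine Measure.countable_meas_pos_of_disjoint_iUnion (μ := s.totalVariation)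
      (As := fun t : ℝ => ({t} : Set ℝ)) (fun t => measurableSet_singleton t) ?_
    intro a b hab
    simpa [Function.onFun] using hab
  refine hc.mono ?_
  intro t ht
  by_contra hn
  exact ht (s.null_of_totalVariation_zero (by simpa using hn))

/-- The set of non-atoms of an `ℝᵐ`-valued measure is measurable. -/
theorem measurableSet_not_atom {m : ℕ} (μ : VectorMeasure ℝ (Fin m → ℝ)) :
    MeasurableSet {t : ℝ | μ {t} = 0} := by
  have hc : {t : ℝ | μ {t} ≠ 0}.Countable := by
    refine (countable_iUnion fun j => countable_signed_atoms (coordMeasure μ j)).mono ?_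
    intro t ht
    obtain ⟨j, hj⟩ := Function.ne_iff.mp ht
    exact mem_iUnion.mpr ⟨j, hj⟩
  have := hc.measurableSet.compl
  convert this using 1
  ext t
  simp

/-- The set of non-atoms of a finite measure on `ℝ` is measurable. -/
theorem measurableSet_not_atom_measure (ν : Measure ℝ) [IsFiniteMeasure ν] :
    MeasurableSet {t : ℝ | ν {t} = 0} := by
  have hc : {t : ℝ | 0 < ν {t}}.Countable := by
    refine Measure.countable_meas_pos_of_disjoint_iUnion (μ := ν)
      (As := fun t : ℝ => ({t} : Set ℝ)) (fun t => measurableSet_singleton t) ?_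
    intro a b hab
    simpa [Function.onFun] using hab
  have := hc.measurableSet.compl
  convert this using 1
  ext t
  simp

/-- `μ ∈ C*_K([0,T])`: a (finite, signed) `ℝᵐ`-valued Borel measure on `[0,T]`, viewed as a measure
on `ℝ` concentrated on `[0,T]`, with range contained in `K`. -/
structure IsConeMeasure {m : ℕ} (K : Set (Fin m → ℝ)) (T : ℝ)
    (μ : VectorMeasure ℝ (Fin m → ℝ)) : Prop where
  range_subset : ∀ A : Set ℝ, MeasurableSet A → μ A ∈ K
  concentrated : ∀ A : Set ℝ, MeasurableSet A → Disjoint A (Icc 0 T) → μ A = 0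

/-- `ν ∈ 𝒱_c(μ)`: `ν` is a finite nonnegative Borel measure on `[0,T]` with `νᶜ = |μᶜ|`, and
`(μ_i, |μ_i|)` converges weakly-* to `(μ, ν)` for some sequence `μ_i ∈ C*_K([0,T])`. -/
structure MemVc {m : ℕ} (K : Set (Fin m → ℝ)) (T : ℝ)
    (μ : VectorMeasure ℝ (Fin m → ℝ)) (ν : Measure ℝ) : Prop where
  finite : IsFiniteMeasure ν
  concentrated : ν (Icc 0 T)ᶜ = 0
  contPart_eq : measureContPart ν = totalVar (contPart μ)
  approx : ∃ μi : ℕ → VectorMeasure ℝ (Fin m → ℝ), (∀ i, IsConeMeasure K T (μi i)) ∧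
    ∀ ψ : ℝ → ℝ, ContinuousOn ψ (Icc 0 T) →
      (∀ j, Tendsto (fun i => ∫ᵛ t in Icc 0 T, ψ t ∂<•(coordMeasure (μi i) j)) atTop
        (𝓝 (∫ᵛ t in Icc 0 T, ψ t ∂<•(coordMeasure μ j)))) ∧
      Tendsto (fun i => ∫ t in Icc 0 T, ψ t ∂(totalVar (μi i))) atTop
        (𝓝 (∫ t in Icc 0 T, ψ t ∂ν))

/-! ### The delay impulse control system -/

/-- The data of the delay impulse control system
`dx/dt = f(t, {x(t-kh)}_{k=0}^M) + ∑ j, g_j(t, {x(t-kh)}_{k=0}^M) du^j/dt`, `du/dt ∈ K`,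
`x(0) = x₀`, `x = ξ₀` on `[-Mh, 0[`, on the time interval `[0, Nh]`, with the standing
hypotheses. -/
structure DelayImpulseSystem (n m : ℕ) where
  /-- number of steps of length `h` in the time interval -/
  N : ℕ
  /-- number of delays -/
  M : ℕ
  /-- the basic delay -/
  h : ℝ
  /-- the control set -/
  K : Set (Fin m → ℝ)
  /-- the initial point -/
  x₀ : EuclideanSpace ℝ (Fin n)
  /-- the initial datum; only its values on `[-Mh, 0]` matter -/
  ξ₀ : ℝ → EuclideanSpace ℝ (Fin n)
  /-- the drift -/
  f : ℝ × (Fin (M + 1) → EuclideanSpace ℝ (Fin n)) → EuclideanSpace ℝ (Fin n)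
  /-- the vector fields multiplying the control -/
  g : Fin m → ℝ × (Fin (M + 1) → EuclideanSpace ℝ (Fin n)) → EuclideanSpace ℝ (Fin n)
  one_le_N : 1 ≤ N
  M_le_N : M ≤ N
  h_pos : 0 < h
  isClosed_K : IsClosed K
  cone_K : ∀ a : ℝ, 0 ≤ a → ∀ w ∈ K, a • w ∈ K
  f_contDiff : ContDiff ℝ 1 f
  f_bounded : ∃ C : ℝ, ∀ p, ‖f p‖ ≤ C
  g_contDiff : ∀ j, ContDiff ℝ 1 (g j)
  g_bounded : ∀ j, ∃ C : ℝ, ∀ p, ‖g j p‖ ≤ C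
  ξ₀_continuousOn : ContinuousOn ξ₀ (Icc (-(M * h)) 0)

namespace DelayImpulseSystem

variable {n m : ℕ} (S : DelayImpulseSystem n m)

/-- The final time `T = N h`. -/
def T : ℝ := S.N * S.h

/-- The instant `r + (l - 1) h`. -/
def time (l : ℤ) (r : ℝ) : ℝ := r + ((l : ℝ) - 1) * S.h

/-- The attached controls `ω r l = ω^r_l`, `1 ≤ l ≤ N`, with the convention `ω^r_l ≡ 0` for any
other index (used only for `ω^h_0` and `ω^0_{N+1}`). -/
def attached (ω : ℝ → ℤ → ℝ → (Fin m → ℝ)) (r : ℝ) (l : ℤ) (s : ℝ) : Fin m → ℝ :=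
  if 1 ≤ l ∧ l ≤ S.N then ω r l s else 0

/-- `(μ, ν, {ω^r}_{r ∈ [0,h]})` is an impulse control. Here `ω r l s` is `ω^r_l(s)`; only
`r ∈ [0,h]`, `1 ≤ l ≤ N` and `s ∈ [0,1]` matter. -/
structure IsImpulseControl (μ : VectorMeasure ℝ (Fin m → ℝ)) (ν : Measure ℝ)
    (ω : ℝ → ℤ → ℝ → (Fin m → ℝ)) : Prop where
  coneMeasure : IsConeMeasure S.K S.T μ
  memVc : MemVc S.K S.T μ ν
  /-- the attached controls are measurable and essentially bounded -/
  memLp : ∀ r ∈ Icc 0 S.h, ∀ l : ℤ, 1 ≤ l → l ≤ S.N →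
    MemLp (ω r l) ⊤ (volume.restrict (Icc 0 1))
  mem_K : ∀ r ∈ Icc 0 S.h, ∀ l : ℤ, 1 ≤ l → l ≤ S.N → ∀ s ∈ Icc (0 : ℝ) 1, ω r l s ∈ S.K
  /-- for each `r`, `∑ l, ‖ω^r_l(s)‖` is a.e. constant in `s` -/
  sum_norm : ∀ r ∈ Icc 0 S.h, ∀ᵐ s ∂(volume.restrict (Icc (0 : ℝ) 1)),
    ∑ l ∈ Finset.Icc (1 : ℤ) S.N, l1Norm (ω r l s) =
      ∑ l ∈ Finset.Icc (1 : ℤ) S.N, ∫ s' in (0 : ℝ)..1, l1Norm (ω r l s')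
  /-- `∫ ‖ω^r_l‖ = ν({r + (l-1)h})` for `0 < r < h` -/
  norm_interior : ∀ r ∈ Ioo 0 S.h, ∀ l : ℤ, 1 ≤ l → l ≤ S.N →
    ∫ s in (0 : ℝ)..1, l1Norm (ω r l s) = ν.real {S.time l r}
  /-- `∫ (‖ω^h_l‖ + ‖ω^0_{l+1}‖) = ν({lh})` for `0 ≤ l ≤ N` -/
  norm_endpoint : ∀ l : ℤ, 0 ≤ l → l ≤ S.N →
    ∫ s in (0 : ℝ)..1, (l1Norm (S.attached ω S.h l s) + l1Norm (S.attached ω 0 (l + 1) s)) =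
      ν.real {(l : ℝ) * S.h}
  /-- `∫ (ω^r_l)ʲ = μʲ({r + (l-1)h})` for `0 < r < h` -/
  integral_interior : ∀ r ∈ Ioo 0 S.h, ∀ l : ℤ, 1 ≤ l → l ≤ S.N → ∀ j,
    ∫ s in (0 : ℝ)..1, ω r l s j = μ {S.time l r} j
  /-- `∫ ((ω^h_l)ʲ + (ω^0_{l+1})ʲ) = μʲ({lh})` for `0 ≤ l ≤ N` -/
  integral_endpoint : ∀ l : ℤ, 0 ≤ l → l ≤ S.N → ∀ j,
    ∫ s in (0 : ℝ)..1, (S.attached ω S.h l s j + S.attached ω 0 (l + 1) s j) =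
      μ {(l : ℝ) * S.h} j

/-- The pairs `(l, r)` for which the jump functions `ζ^r_l`, `θ^r_l` solve their Cauchy problems:
`1 ≤ l ≤ N` and `r ∈ [0,h]`, together with `(N + 1, 0)`. -/
def IsJumpIndex (l : ℤ) (r : ℝ) : Prop :=
  (1 ≤ l ∧ l ≤ S.N ∧ r ∈ Icc 0 S.h) ∨ (l = S.N + 1 ∧ r = 0)

/-- The right-hand side `∑ j, g_j(r + (l-1)h, {ζ^r_{l-k}(s)}_k) (ω^r_l)^j(s)` of the jump equation;
`ζ l r s` is `ζ^r_l(s)`. -/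
def jumpField (ω : ℝ → ℤ → ℝ → (Fin m → ℝ)) (ζ : ℤ → ℝ → ℝ → EuclideanSpace ℝ (Fin n))
    (l : ℤ) (r s : ℝ) : EuclideanSpace ℝ (Fin n) :=
  ∑ j, S.attached ω r l s j • S.g j (S.time l r, fun k => ζ (l - (k : ℕ)) r s)

/-- The family `ζ l r s = ζ^r_l(s)` of jump functions of `x`. A solution of the Cauchy problem is
meant in the sense of Carathéodory, i.e. it satisfies the integral equation. -/
structure IsStateJump (ω : ℝ → ℤ → ℝ → (Fin m → ℝ)) (x : ℝ → EuclideanSpace ℝ (Fin n))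
    (ζ : ℤ → ℝ → ℝ → EuclideanSpace ℝ (Fin n)) : Prop where
  past_zero : ∀ r ∈ Icc 0 S.h, ∀ s ∈ Icc (0 : ℝ) 1, (s < 1 ∨ r < S.h) →
    ζ 0 r s = S.ξ₀ (r - S.h)
  past_zero_end : ζ 0 S.h 1 = S.x₀
  past_neg : ∀ a : ℕ, 1 ≤ a → a < S.M → ∀ r ∈ Icc 0 S.h, ∀ s ∈ Icc (0 : ℝ) 1,
    ζ (-a) r s = S.ξ₀ (r - (a + 1) * S.h)
  initial_pos : ∀ l r, S.IsJumpIndex l r → 0 < r → ζ l r 0 = Function.leftLim x (S.time l r)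
  initial_zero : ∀ l, S.IsJumpIndex l 0 → ζ l 0 0 = ζ (l - 1) S.h 1
  integrable : ∀ l r, S.IsJumpIndex l r → IntervalIntegrable (S.jumpField ω ζ l r) volume 0 1
  equation : ∀ l r, S.IsJumpIndex l r → ∀ s ∈ Icc (0 : ℝ) 1,
    ζ l r s = ζ l r 0 + ∫ s' in (0 : ℝ)..s, S.jumpField ω ζ l r s'

/-- The family `θ l r s = θ^r_l(s)` of jump functions of `v`. -/
structure IsVariationJump (ω : ℝ → ℤ → ℝ → (Fin m → ℝ)) (v : ℝ → ℝ)
    (θ : ℤ → ℝ → ℝ → ℝ) : Prop where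
  nonneg : ∀ l r, S.IsJumpIndex l r → ∀ s ∈ Icc (0 : ℝ) 1, 0 ≤ θ l r s
  past : ∀ r ∈ Icc 0 S.h, ∀ s ∈ Icc (0 : ℝ) 1, θ 0 r s = 0
  initial_pos : ∀ l r, S.IsJumpIndex l r → 0 < r → θ l r 0 = Function.leftLim v (S.time l r)
  initial_zero : ∀ l, S.IsJumpIndex l 0 → θ l 0 0 = θ (l - 1) S.h 1
  equation : ∀ l r, S.IsJumpIndex l r → ∀ s ∈ Icc (0 : ℝ) 1,
    θ l r s = θ l r 0 + ∫ s' in (0 : ℝ)..s, l1Norm (S.attached ω r l s')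

/-- The delayed states `{x(t - kh)}_{k=0}^M`, preceded by `t`. -/
def delayed (x : ℝ → EuclideanSpace ℝ (Fin n)) (t : ℝ) :
    ℝ × (Fin (S.M + 1) → EuclideanSpace ℝ (Fin n)) :=
  (t, fun k => x (t - (k : ℕ) * S.h))

/-- `(x, v)` is an impulse solution associated with `(μ, ν, {ω^r})`; only the values of `x` on
`[-Mh, T]` and of `v` on `[0, T]` matter. Bounded variation of `x` is required on `[0, T]`: on
`[-Mh, 0[` the function `x` is the prescribed continuous datum `ξ₀`. -/
structure IsImpulseSolution (μ : VectorMeasure ℝ (Fin m → ℝ)) (ν : Measure ℝ)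
    (ω : ℝ → ℤ → ℝ → (Fin m → ℝ)) (x : ℝ → EuclideanSpace ℝ (Fin n)) (v : ℝ → ℝ) : Prop where
  boundedVariation_x : BoundedVariationOn x (Icc 0 S.T)
  boundedVariation_v : BoundedVariationOn v (Icc 0 S.T)
  past : ∀ t ∈ Ico (-(S.M * S.h)) 0, x t = S.ξ₀ t
  initial_x : x 0 = S.x₀
  initial_v : v 0 = 0
  dynamics : ∃ (ζ : ℤ → ℝ → ℝ → EuclideanSpace ℝ (Fin n)) (θ : ℤ → ℝ → ℝ → ℝ),
    S.IsStateJump ω x ζ ∧ S.IsVariationJump ω v θ ∧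
    (∀ l : ℤ, 2 ≤ l → l ≤ S.N + 1 →
      x (((l : ℝ) - 1) * S.h) = ζ l 0 1 ∧ v (((l : ℝ) - 1) * S.h) = θ l 0 1) ∧
    ∀ l : ℤ, 1 ≤ l → l ≤ S.N → ∀ t ∈ Ioo (((l : ℝ) - 1) * S.h) (l * S.h),
      (Summable fun r : Ioc 0 (t - ((l : ℝ) - 1) * S.h) =>
        ζ l r 1 - Function.leftLim x (S.time l r)) ∧
      x t = ζ l 0 1
        + (∫ t' in (((l : ℝ) - 1) * S.h)..t, S.f (S.delayed x t'))
        + (∑ j, ∫ᵛ t' in Icc (((l : ℝ) - 1) * S.h) t,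
            S.g j (S.delayed x t') ∂<•(coordMeasure (contPart μ) j))
        + (∑' r : Ioc 0 (t - ((l : ℝ) - 1) * S.h),
            (ζ l r 1 - Function.leftLim x (S.time l r))) ∧
      (Summable fun r : Ioc 0 (t - ((l : ℝ) - 1) * S.h) =>
        θ l r 1 - Function.leftLim v (S.time l r)) ∧
      v t = θ l 0 1
        + (measureContPart ν).real (Icc (((l : ℝ) - 1) * S.h) t)
        + (∑' r : Ioc 0 (t - ((l : ℝ) - 1) * S.h),
            (θ l r 1 - Function.leftLim v (S.time l r)))

end DelayImpulseSystem

end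

open scoped ENNReal NNReal

open scoped ENNReal

/-! ### Gronwall's inequality and fixed points for integral operators of Volterra type -/

/-! The natural unknown is not x but the family of jump functions: ζ^r_l(0) is the left limit of x
at r + (l-1)h and ζ^r_l(1) is its value there. On the l-th interval of length h the delayed
arguments have indices l-1, …, l-M, so they are already known, and the method of steps leaves one
undelayed equation per interval. Let X_t(y) be the end value of the jump equation at time t started
from y. The left limits y(t) must satisfy y(t) = ζ^0_l(1) + ∫_{](l-1)h, t[} (f ds + ∑ g_j d(μ^c)^j)
+ ∑_{s<t} (X_s(y(s)) - y(s)), with the fields evaluated at the state X_s(y(s)) after the jump.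

Bounded fields keep every candidate in a fixed ball, where C¹ fields are Lipschitz. The attached
control at time t has mass at most ν({t}), so X_t - id is Lipschitz with a constant proportional to
ν({t}) (`exists_jump_lipschitz`). The right-hand side is therefore a Volterra operator, Lipschitz
with respect to a multiple ρ of ds + ∑ |(μ^c)^j| + ν and integrated over s < t only
(`IsStep.edist_stepDrive_le`).

The measure ρ has atoms, so the classical Gronwall lemma is replaced by the weight w(t) =
exp(2ρ(]-∞,t[)), for which ∫_{s<t} w dρ ≤ w(t)/2 (`lintegral_expWeight_le`). Volterra operators thus
contract by 1/2 in the weighted sup norm. This yields existence (`exists_volterra_fixedPoint`) and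
uniqueness (`measure_gronwall`), both for the jump equations on [0,1] and for the steps in time.
Working with left limits is what makes the integration interval open: an atom at t never acts on
y(t) itself.

Induction on l produces a family of jump functions solving all steps (`IsFlow`), unique by
`IsFlow.unique`. Such a family gives an impulse solution (`IsFlow.isImpulseSolution`); conversely
the jump functions of any impulse solution form such a family and encode x
(`isFlow_of_isStateJump`). The component v needs no fixed point: its jumps are the atoms of ν, so
v(t) = ν([0,t]) for t > 0. -/

theorem measure_Iio_inter_lt_le (ρ : Measure ℝ) [IsFiniteMeasure ρ] (t u : ℝ) :
    ρ (Iio t ∩ {s | u < ρ.real (Iio s)}) ≤ ENNReal.ofReal (ρ.real (Iio t) - u) := by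
  have hmono : Monotone fun s => ρ.real (Iio s) := fun a b hab =>
    measureReal_mono (Iio_subset_Iio hab)
  have hm : MeasurableSet (Iio t ∩ {s | u < ρ.real (Iio s)}) :=
    measurableSet_Iio.inter (measurableSet_lt measurable_const hmono.measurable)
  -- Inner regularity passes to compact subsets, which contain their least point s: the subset lies
  -- in [s,t[ and u < ρ(]-∞,s[) can be used at s. The infimum of the original set need not belong to
  -- it.
  rw [hm.measure_eq_iSup_isCompact]
  refine iSup₂_le fun K hK => iSup_le fun hc => ?_
  rcases K.eq_empty_or_nonempty with rfl | hne
  · simp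
  · obtain ⟨s, hs, hmin⟩ := hc.exists_isLeast hne
    have hsub : K ⊆ Ico s t := fun z hz => ⟨hmin hz, (hK hz).1⟩
    have h1 : ρ.real (Ico s t) = ρ.real (Iio t) - ρ.real (Iio s) := by
      rw [← measureReal_sdiff (Iio_subset_Iio (hK hs).1.le) measurableSet_Iio]
      congr 1
      ext z
      simp
    calc ρ K ≤ ρ (Ico s t) := measure_mono hsub
      _ = ENNReal.ofReal (ρ.real (Ico s t)) := by simp
      _ ≤ _ := by
        rw [h1]
        exact ENNReal.ofReal_le_ofReal (sub_le_sub_left (le_of_lt (hK hs).2) _)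

/-- The weight `exp (2 ρ(]-∞, t[))`. -/
noncomputable def expWeight (ρ : Measure ℝ) (t : ℝ) : ℝ≥0∞ :=
  ENNReal.ofReal (Real.exp (2 * ρ.real (Iio t)))

theorem measurable_measureReal_Iio (ρ : Measure ℝ) [IsFiniteMeasure ρ] :
    Measurable fun s => ρ.real (Iio s) :=
  Monotone.measurable fun _ _ hab => measureReal_mono (Iio_subset_Iio hab)

theorem measurable_expWeight (ρ : Measure ℝ) [IsFiniteMeasure ρ] : Measurable (expWeight ρ) :=
  ((measurable_measureReal_Iio ρ).const_mul 2).exp.ennreal_ofReal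

theorem one_le_expWeight (ρ : Measure ℝ) (t : ℝ) : 1 ≤ expWeight ρ t := by
  rw [expWeight, ← ENNReal.ofReal_one]
  exact ENNReal.ofReal_le_ofReal (Real.one_le_exp (by positivity))

theorem expWeight_ne_top (ρ : Measure ℝ) (t : ℝ) : expWeight ρ t ≠ ∞ := ENNReal.ofReal_ne_top

theorem expWeight_le (ρ : Measure ℝ) [IsFiniteMeasure ρ] (t : ℝ) :
    expWeight ρ t ≤ ENNReal.ofReal (Real.exp (2 * ρ.real univ)) :=
  ENNReal.ofReal_le_ofReal (Real.exp_le_exp.mpr (by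
    have := measureReal_mono (μ := ρ) (subset_univ (Iio t))
    linarith))

/-- The layer-cake integral of `lintegral_expWeight_le`: the tail bound a - u against the derivative
of exp(2u) - 1. -/
theorem integral_sub_mul_exp (a : ℝ) :
    ∫ u in (0 : ℝ)..a, (a - u) * (2 * Real.exp (2 * u)) = (Real.exp (2 * a) - 1) / 2 - a := by
  have hd : ∀ u ∈ uIcc 0 a, HasDerivAt
      (fun u => (a - u) * Real.exp (2 * u) + Real.exp (2 * u) / 2)
      ((a - u) * (2 * Real.exp (2 * u))) u := by
    intro u _
    have h1 : HasDerivAt (fun u : ℝ => Real.exp (2 * u)) (Real.exp (2 * u) * (2 * 1)) u :=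
      ((hasDerivAt_id' u).const_mul 2).exp
    convert! (((hasDerivAt_id' u).const_sub a).mul h1).add (h1.div_const 2) using 1
    ring
  rw [intervalIntegral.integral_eq_sub_of_hasDerivAt hd
    (Continuous.intervalIntegrable (by fun_prop) _ _)]
  simp
  ring

theorem integral_two_mul_exp (a : ℝ) :
    ∫ u in (0 : ℝ)..a, 2 * Real.exp (2 * u) = Real.exp (2 * a) - 1 := by
  have hd : ∀ u ∈ uIcc 0 a, HasDerivAt (fun u => Real.exp (2 * u)) (2 * Real.exp (2 * u)) u := by
    intro u _
    convert! ((hasDerivAt_id' u).const_mul 2).exp using 1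
    ring
  rw [intervalIntegral.integral_eq_sub_of_hasDerivAt hd
    (Continuous.intervalIntegrable (by fun_prop) _ _)]
  simp

/-- For atomless ρ the substitution u = ρ(]-∞,s[) would give ∫_0^a exp(2u) du ≤ exp(2a)/2. With
atoms, the layer-cake formula and the tail bound of `measure_Iio_inter_lt_le` replace the
substitution. The open half-line is essential: an atom of mass above 1/2 at t would break the
estimate if it were included. -/
theorem lintegral_expWeight_le (ρ : Measure ℝ) [IsFiniteMeasure ρ] (t : ℝ) :
    ∫⁻ s in Iio t, expWeight ρ s ∂ρ ≤ expWeight ρ t / 2 := by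
  set a : ℝ := ρ.real (Iio t) with ha
  have ha0 : 0 ≤ a := by positivity
  have key : ∫⁻ s in Iio t, ENNReal.ofReal (Real.exp (2 * ρ.real (Iio s)) - 1) ∂ρ ≤
      ENNReal.ofReal ((Real.exp (2 * a) - 1) / 2 - a) := by
    have h := lintegral_comp_eq_lintegral_meas_lt_mul (ρ.restrict (Iio t))
      (f := fun s => ρ.real (Iio s)) (g := fun u => 2 * Real.exp (2 * u))
      (Eventually.of_forall fun s => by simp)
      (measurable_measureReal_Iio ρ).aemeasurable
      (fun u _ => Continuous.intervalIntegrable (by fun_prop) _ _)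
      (Eventually.of_forall fun s => by positivity)
    simp only [integral_two_mul_exp] at h
    rw [h]
    calc ∫⁻ u in Ioi 0, (ρ.restrict (Iio t)) {s | u < ρ.real (Iio s)} *
          ENNReal.ofReal (2 * Real.exp (2 * u))
        ≤ ∫⁻ u in Ioi 0, (Ioc 0 a).indicator
            (fun u => ENNReal.ofReal ((a - u) * (2 * Real.exp (2 * u)))) u := by
          refine setLIntegral_mono' measurableSet_Ioi fun u hu => ?_
          have h1 : (ρ.restrict (Iio t)) {s | u < ρ.real (Iio s)} ≤ ENNReal.ofReal (a - u) := by
            rw [Measure.restrict_apply (measurableSet_lt measurable_const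
              (measurable_measureReal_Iio ρ)), inter_comm]
            exact measure_Iio_inter_lt_le ρ t u
          by_cases hua : u ≤ a
          · rw [indicator_of_mem (show u ∈ Ioc 0 a from ⟨hu, hua⟩), ENNReal.ofReal_mul (sub_nonneg.2 hua)]
            exact mul_le_mul' h1 le_rfl
          · rw [ENNReal.ofReal_of_nonpos (by linarith), nonpos_iff_eq_zero] at h1
            simp [h1]
      _ = ∫⁻ u in Ioc 0 a, ENNReal.ofReal ((a - u) * (2 * Real.exp (2 * u))) := by
          rw [lintegral_indicator measurableSet_Ioc, Measure.restrict_restrict measurableSet_Ioc,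
            inter_eq_self_of_subset_left Ioc_subset_Ioi_self]
      _ = ENNReal.ofReal (∫ u in Ioc 0 a, (a - u) * (2 * Real.exp (2 * u))) := by
          rw [ofReal_integral_eq_lintegral_ofReal]
          · exact (Continuous.integrableOn_Ioc (by fun_prop))
          · filter_upwards [ae_restrict_mem measurableSet_Ioc] with u hu
            have := hu.2
            have : 0 ≤ a - u := by linarith
            positivity
      _ = _ := by rw [← intervalIntegral.integral_of_le ha0, integral_sub_mul_exp]
  calc ∫⁻ s in Iio t, expWeight ρ s ∂ρ
      = ∫⁻ s in Iio t, (ENNReal.ofReal (Real.exp (2 * ρ.real (Iio s)) - 1) + 1) ∂ρ := by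
        refine lintegral_congr fun s => ?_
        rw [← ENNReal.ofReal_one, ← ENNReal.ofReal_add _ zero_le_one, expWeight]
        · simp
        · have := Real.one_le_exp (show 0 ≤ 2 * ρ.real (Iio s) by positivity)
          linarith
    _ = (∫⁻ s in Iio t, ENNReal.ofReal (Real.exp (2 * ρ.real (Iio s)) - 1) ∂ρ) + ρ (Iio t) := by
        rw [lintegral_add_right _ measurable_const]
        simp
    _ ≤ ENNReal.ofReal ((Real.exp (2 * a) - 1) / 2 - a) + ENNReal.ofReal a := by
        gcongr
        simp [ha]
    _ = ENNReal.ofReal ((Real.exp (2 * a) - 1) / 2) := by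
        rw [← ENNReal.ofReal_add _ ha0]
        · simp
        -- Nonnegativity of (exp(2a) - 1)/2 - a, needed to add the two `ENNReal.ofReal` terms.
        · have := Real.quadratic_le_exp_of_nonneg (show 0 ≤ 2 * a by positivity)
          nlinarith
    _ ≤ ENNReal.ofReal (Real.exp (2 * a) / 2) := ENNReal.ofReal_le_ofReal (by linarith)
    _ = expWeight ρ t / 2 := by
        rw [ENNReal.ofReal_div_of_pos two_pos, expWeight, ← ha]
        simp

/-- Gronwall's inequality for a measure. -/
theorem measure_gronwall (ρ : Measure ℝ) [IsFiniteMeasure ρ] {φ : ℝ → ℝ≥0∞} {c B : ℝ≥0∞}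
    (hB : B ≠ ∞) (hφB : ∀ t, φ t ≤ B) (h : ∀ t, φ t ≤ c + ∫⁻ s in Iio t, φ s ∂ρ) (t : ℝ) :
    φ t ≤ 2 * c * expWeight ρ t := by
  -- The weighted supremum satisfies q ≤ c + q/2. The bound B serves only to make q finite, so that
  -- q/2 can be cancelled. Only the weight has to be measurable, not φ.
  set q : ℝ≥0∞ := ⨆ s, φ s / expWeight ρ s with hq
  have hw0 : ∀ s, expWeight ρ s ≠ 0 := fun s =>
    (zero_lt_one.trans_le (one_le_expWeight ρ s)).ne'
  have hle : ∀ s, φ s ≤ q * expWeight ρ s := fun s => by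
    rw [← ENNReal.div_le_iff (hw0 s) (expWeight_ne_top ρ s)]
    exact le_iSup (fun s => φ s / expWeight ρ s) s
  have hqtop : q ≠ ∞ := by
    refine ne_top_of_le_ne_top hB (iSup_le fun s => ?_)
    rw [ENNReal.div_le_iff (hw0 s) (expWeight_ne_top ρ s)]
    calc φ s ≤ B * 1 := by simpa using hφB s
      _ ≤ _ := by gcongr; exact one_le_expWeight ρ s
  have hstep : q ≤ c + q / 2 := by
    refine iSup_le fun s => ?_
    rw [ENNReal.div_le_iff (hw0 s) (expWeight_ne_top ρ s)]
    calc φ s ≤ c + ∫⁻ z in Iio s, φ z ∂ρ := h s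
      _ ≤ c + ∫⁻ z in Iio s, q * expWeight ρ z ∂ρ := by gcongr with z; exact hle z
      _ = c + q * ∫⁻ z in Iio s, expWeight ρ z ∂ρ := by
        rw [lintegral_const_mul _ (measurable_expWeight ρ)]
      _ ≤ c * expWeight ρ s + q * (expWeight ρ s / 2) := by
        gcongr
        · exact le_mul_of_one_le_right' (one_le_expWeight ρ s)
        · exact lintegral_expWeight_le ρ s
      _ = (c + q / 2) * expWeight ρ s := by
        rw [add_mul]
        simp only [div_eq_mul_inv]
        ring
  have hq2 : q ≤ 2 * c := by
    have h2 : q / 2 + q / 2 ≤ c + q / 2 := by rwa [ENNReal.add_halves]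
    have h3 : q / 2 ≤ c := by
      refine ENNReal.le_of_add_le_add_right ?_ h2
      exact ENNReal.div_ne_top hqtop (by simp)
    rw [mul_comm]
    exact (ENNReal.div_le_iff (by simp) (by simp)).mp h3
  exact (hle t).trans (by gcongr)

/-- A bounded operator satisfying a Lipschitz estimate of Volterra type has a fixed point. -/
theorem exists_volterra_fixedPoint {E : Type*} [NormedAddCommGroup E] [MeasurableSpace E]
    [BorelSpace E] [CompleteSpace E] (ρ : Measure ℝ) [IsFiniteMeasure ρ]
    (Φ : (ℝ → E) → ℝ → E) {R : ℝ} (hR : 0 ≤ R)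
    (hmeas : ∀ y, Measurable y → (∀ t, ‖y t‖ ≤ R) → Measurable (Φ y))
    (hbdd : ∀ y, Measurable y → (∀ t, ‖y t‖ ≤ R) → ∀ t, ‖Φ y t‖ ≤ R)
    (hlip : ∀ y z, Measurable y → (∀ t, ‖y t‖ ≤ R) → Measurable z → (∀ t, ‖z t‖ ≤ R) →
      ∀ t, edist (Φ y t) (Φ z t) ≤ ∫⁻ s in Iio t, edist (y s) (z s) ∂ρ) :
    ∃ y, Measurable y ∧ (∀ t, ‖y t‖ ≤ R) ∧ ∀ t, Φ y t = y t := by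
  set u : ℕ → ℝ → E := fun k => Φ^[k] 0 with hu
  have hsucc : ∀ k, u (k + 1) = Φ (u k) := fun k => Function.iterate_succ_apply' Φ k 0
  have hinv : ∀ k, Measurable (u k) ∧ ∀ t, ‖u k t‖ ≤ R := by
    intro k
    induction k with
    | zero => exact ⟨measurable_zero, fun t => by simpa [hu] using hR⟩
    | succ k ih =>
      rw [hsucc]
      exact ⟨hmeas _ ih.1 ih.2, hbdd _ ih.1 ih.2⟩
  set B : ℝ≥0∞ := ENNReal.ofReal R with hB
  -- The weighted distance between successive Picard iterates halves each time; in the first one, B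
  -- bounds the distance from 0.
  have hd : ∀ k t, edist (u k t) (u (k + 1) t) ≤ B * expWeight ρ t / 2 ^ k := by
    intro k
    induction k with
    | zero =>
      intro t
      calc edist (u 0 t) (u 1 t) = ‖u 1 t‖ₑ := by
            rw [edist_comm, edist_eq_enorm_sub]
            simp [hu]
        _ ≤ B := by
          rw [← ofReal_norm]
          exact ENNReal.ofReal_le_ofReal ((hinv 1).2 t)
        _ ≤ B * expWeight ρ t := le_mul_of_one_le_right' (one_le_expWeight ρ t)
        _ = _ := by simp
    | succ k ih =>
      intro t
      rw [hsucc k, hsucc (k + 1)]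
      calc edist (Φ (u k) t) (Φ (u (k + 1)) t)
          ≤ ∫⁻ s in Iio t, edist (u k s) (u (k + 1) s) ∂ρ :=
            hlip _ _ (hinv k).1 (hinv k).2 (hinv (k + 1)).1 (hinv (k + 1)).2 t
        _ ≤ ∫⁻ s in Iio t, B / 2 ^ k * expWeight ρ s ∂ρ := by
            gcongr with s
            refine (ih s).trans (le_of_eq ?_)
            simp only [div_eq_mul_inv]
            ring
        _ = B / 2 ^ k * ∫⁻ s in Iio t, expWeight ρ s ∂ρ := by
            rw [lintegral_const_mul _ (measurable_expWeight ρ)]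
        _ ≤ B / 2 ^ k * (expWeight ρ t / 2) := by
            gcongr
            exact lintegral_expWeight_le ρ t
        _ = _ := by
            rw [pow_succ]
            simp only [div_eq_mul_inv]
            rw [ENNReal.mul_inv (by simp) (by simp)]
            ring
  have hCtop : ∀ t, B * expWeight ρ t ≠ ∞ := fun t =>
    ENNReal.mul_ne_top ENNReal.ofReal_ne_top (expWeight_ne_top ρ t)
  have hex : ∀ t, ∃ l, Tendsto (fun k => u k t) atTop (𝓝 l) := fun t =>
    cauchySeq_tendsto_of_complete
      (cauchySeq_of_edist_le_geometric_two _ (hCtop t) fun k => hd k t)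
  choose y hy using hex
  have hlim : ∀ k t, edist (u k t) (y t) ≤ 2 * (B * expWeight ρ t) / 2 ^ k := fun k t =>
    edist_le_of_edist_le_geometric_two_of_tendsto _ (fun k => hd k t) (hy t) k
  have hym : Measurable y :=
    measurable_of_tendsto_metrizable (fun k => (hinv k).1) (tendsto_pi_nhds.mpr hy)
  have hyR : ∀ t, ‖y t‖ ≤ R := fun t =>
    le_of_tendsto (hy t).norm (Eventually.of_forall fun k => (hinv k).2 t)
  refine ⟨y, hym, hyR, fun t => ?_⟩
  -- The estimate of u k - y, made uniform by the total mass of ρ, passes through the Lipschitz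
  -- bound, so the iterates tend to Φ y as well as to y.
  have hconv : Tendsto (fun k => u (k + 1) t) atTop (𝓝 (Φ y t)) := by
    rw [tendsto_iff_edist_tendsto_0]
    have hbound : ∀ k, edist (u (k + 1) t) (Φ y t) ≤
        (2 * B * ENNReal.ofReal (Real.exp (2 * ρ.real univ)) * ρ univ) * (2 ^ k)⁻¹ := by
      intro k
      rw [hsucc]
      calc edist (Φ (u k) t) (Φ y t) ≤ ∫⁻ s in Iio t, edist (u k s) (y s) ∂ρ :=
            hlip _ _ (hinv k).1 (hinv k).2 hym hyR t
        _ ≤ ∫⁻ s, edist (u k s) (y s) ∂ρ := setLIntegral_le_lintegral _ _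
        _ ≤ ∫⁻ s, 2 * (B * ENNReal.ofReal (Real.exp (2 * ρ.real univ))) / 2 ^ k ∂ρ := by
            refine lintegral_mono fun s => (hlim k s).trans ?_
            gcongr
            exact expWeight_le ρ s
        _ = _ := by
            rw [lintegral_const]
            simp only [div_eq_mul_inv]
            ring
    refine tendsto_of_tendsto_of_tendsto_of_le_of_le tendsto_const_nhds ?_
      (fun k => zero_le) hbound
    have h0 : Tendsto (fun k : ℕ => ((2 : ℝ≥0∞) ^ k)⁻¹) atTop (𝓝 0) := by
      simpa only [ENNReal.inv_pow] using
        ENNReal.tendsto_pow_atTop_nhds_zero_of_lt_one (r := (2 : ℝ≥0∞)⁻¹) (by simp)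
    have hfin : 2 * B * ENNReal.ofReal (Real.exp (2 * ρ.real univ)) * ρ univ ≠ ∞ := by
      finiteness
    simpa using ENNReal.Tendsto.const_mul h0 (Or.inr hfin)
  exact tendsto_nhds_unique hconv ((tendsto_add_atTop_iff_nat 1).mpr (hy t))

/-! ### Functions whose increments are dominated by those of a monotone function -/

/-- Each coordinate of F becomes monotone after adding W, hence is a difference of two monotone
functions. -/
theorem measurable_of_norm_sub_le {n : ℕ} {F : ℝ → EuclideanSpace ℝ (Fin n)} {W : ℝ → ℝ}
    (h : ∀ s t, s ≤ t → ‖F t - F s‖ ≤ W t - W s) : Measurable F := by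
  have hW : Monotone W := fun s t hst => by
    have := (norm_nonneg _).trans (h s t hst)
    linarith
  have hc : ∀ i, Measurable fun t => F t i := by
    intro i
    have hm : Monotone fun t => F t i + W t := by
      intro s t hst
      have h1 : |F t i - F s i| ≤ ‖F t - F s‖ := by
        simpa using PiLp.norm_apply_le (F t - F s) i
      have h2 := (abs_le.mp (h1.trans (h s t hst))).1
      simp only
      linarith
    convert! hm.measurable.sub hW.measurable using 2
    simp
  have : Measurable fun t => (WithLp.toLp 2 (fun i => F t i) : EuclideanSpace ℝ (Fin n)) :=
    (PiLp.continuous_toLp 2 _).measurable.comp (measurable_pi_lambda _ hc)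
  exact this

theorem boundedVariationOn_of_norm_sub_le {E : Type*} [NormedAddCommGroup E] {F : ℝ → E}
    {W : ℝ → ℝ} {a b : ℝ}
    (h : ∀ s ∈ Icc a b, ∀ t ∈ Icc a b, s ≤ t → ‖F t - F s‖ ≤ W t - W s) :
    BoundedVariationOn F (Icc a b) := by
  have hW : MonotoneOn W (Icc a b) := fun s hs t ht hst => by
    have := (norm_nonneg _).trans (h s hs t ht hst)
    linarith
  refine ne_top_of_le_ne_top (b := eVariationOn W (Icc a b)) ?_ ?_
  · rcases le_or_gt a b with hab | hab
    · have := hW.eVariationOn_eq (left_mem_Icc.2 hab) (right_mem_Icc.2 hab)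
      rw [inter_self] at this
      rw [this]
      exact ENNReal.ofReal_ne_top
    · simp [Icc_eq_empty hab.not_ge, eVariationOn.subsingleton]
  · refine iSup_le fun p => ?_
    refine le_trans (Finset.sum_le_sum fun i _ => ?_)
      (eVariationOn.sum_le (f := W) p.2.2.1 (fun i => p.2.2.2 i))
    rw [edist_dist, edist_dist, dist_eq_norm, Real.dist_eq]
    refine ENNReal.ofReal_le_ofReal (le_trans (h _ (p.2.2.2 _) _ (p.2.2.2 _)
      (p.2.2.1 (Nat.le_succ i))) (le_abs_self _))

/-- The intervals ]s,t[ shrink to the empty set as s increases to t; an atom at t itself does no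
harm. All left limits below rest on this. -/
theorem tendsto_measureReal_Ioo_left (ρ : Measure ℝ) [IsFiniteMeasure ρ] (t : ℝ) :
    Tendsto (fun s => ρ.real (Ioo s t)) (𝓝[<] t) (𝓝 0) := by
  have h : Tendsto (fun s => ∫⁻ x, (Ioo s t).indicator (fun _ => (1 : ℝ≥0∞)) x ∂ρ) (𝓝[<] t)
      (𝓝 (∫⁻ _, 0 ∂ρ)) := by
    refine tendsto_lintegral_filter_of_dominated_convergence (fun _ => 1)
      (Eventually.of_forall fun s => measurable_const.indicator measurableSet_Ioo)
      (Eventually.of_forall fun s => Eventually.of_forall fun x =>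
        indicator_le_self' (fun _ _ => zero_le) x) (by simp) (Eventually.of_forall fun x => ?_)
    refine tendsto_const_nhds.congr' ?_
    by_cases hx : x < t
    · filter_upwards [mem_nhdsWithin_of_mem_nhds (Ioi_mem_nhds hx)] with s hs
      exact (indicator_of_notMem (fun h => lt_asymm hs h.1) _).symm
    · exact Eventually.of_forall fun s => (indicator_of_notMem (fun h => hx h.2) _).symm
  simp only [lintegral_indicator measurableSet_Ioo, lintegral_const, zero_mul, one_mul,
    Measure.restrict_apply_univ] at h
  exact (ENNReal.tendsto_toReal ENNReal.zero_ne_top).comp h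

theorem leftLim_eq_of_norm_sub_le {E : Type*} [NormedAddCommGroup E] {F : ℝ → E} {y : E}
    (ρ : Measure ℝ) [IsFiniteMeasure ρ] {a t : ℝ} (hat : a < t)
    (h : ∀ s ∈ Ioo a t, ‖F s - y‖ ≤ ρ.real (Ioo s t)) : Function.leftLim F t = y := by
  refine leftLim_eq_of_tendsto ?_
  rw [tendsto_iff_norm_sub_tendsto_zero]
  refine squeeze_zero' (Eventually.of_forall fun _ => norm_nonneg _) ?_
    (tendsto_measureReal_Ioo_left ρ t)
  filter_upwards [Ioo_mem_nhdsLT hat] with s hs using h s hs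

/-- A function of class `C¹` on a finite-dimensional space is Lipschitz on balls. -/
theorem exists_lipschitz_on_ball {V W : Type*} [NormedAddCommGroup V] [NormedSpace ℝ V]
    [ProperSpace V] [NormedAddCommGroup W] [NormedSpace ℝ W] {g : V → W} (hg : ContDiff ℝ 1 g)
    (R : ℝ) : ∃ L : ℝ≥0, ∀ p q, ‖p‖ ≤ R → ‖q‖ ≤ R → ‖g p - g q‖ ≤ L * ‖p - q‖ := by
  obtain ⟨L, hL⟩ := (hg.locallyLipschitz.locallyLipschitzOn
    (s := Metric.closedBall 0 R)).exists_lipschitzOnWith_of_compact (isCompact_closedBall _ _)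
  refine ⟨L, fun p q hp hq => ?_⟩
  exact hL.norm_sub_le (by simpa using hp) (by simpa using hq)

/-! ### Carathéodory equations with an integrable control -/

section Caratheodory

variable {m : ℕ} {E : Type*} [NormedAddCommGroup E] [NormedSpace ℝ E]

theorem l1Norm_nonneg (w : Fin m → ℝ) : 0 ≤ l1Norm w := Finset.sum_nonneg fun _ _ => abs_nonneg _

/-- The vector field `∑ j, wʲ(s) G_j(s, y(s))` along a curve `y`. -/
def controlField (w : ℝ → Fin m → ℝ) (G : Fin m → ℝ → E → E) (y : ℝ → E) (s : ℝ) : E :=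
  ∑ j, w s j • G j s (y s)

theorem norm_sum_smul_le (w : Fin m → ℝ) {v : Fin m → E} {C : ℝ} (h : ∀ j, ‖v j‖ ≤ C) :
    ‖∑ j, w j • v j‖ ≤ l1Norm w * C := by
  rw [l1Norm, Finset.sum_mul]
  refine (norm_sum_le _ _).trans (Finset.sum_le_sum fun j _ => ?_)
  rw [norm_smul, Real.norm_eq_abs]
  exact mul_le_mul_of_nonneg_left (h j) (abs_nonneg _)

theorem integrableOn_l1Norm {w : ℝ → Fin m → ℝ} {A : Set ℝ}
    (hw : ∀ j, IntegrableOn (fun s => w s j) A) : IntegrableOn (fun s => l1Norm (w s)) A :=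
  integrable_finsetSum _ fun j _ => (hw j).abs

theorem integrableOn_controlField {w : ℝ → Fin m → ℝ} {A : Set ℝ} {G : Fin m → ℝ → E → E}
    {y : ℝ → E} {C : ℝ} (hw : ∀ j, IntegrableOn (fun s => w s j) A)
    (hm : ∀ j, AEStronglyMeasurable (fun s => G j s (y s)) (volume.restrict A))
    (hC : ∀ j s z, ‖G j s z‖ ≤ C) : IntegrableOn (controlField w G y) A :=
  integrable_finsetSum _ fun j _ =>
    (hw j).smul_of_top_left (memLp_top_of_bound (hm j) C (Eventually.of_forall fun s => hC j s _))

/-- The measure `L ‖w(s)‖ ds` on `[0,1]`. -/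
noncomputable def controlMeasure (w : ℝ → Fin m → ℝ) (L : ℝ≥0) : Measure ℝ :=
  (volume.restrict (Ioc 0 1)).withDensity fun s => ENNReal.ofReal (L * l1Norm (w s))

theorem controlMeasure_univ {w : ℝ → Fin m → ℝ}
    (hw : ∀ j, IntegrableOn (fun s => w s j) (Ioc 0 1)) (L : ℝ≥0) :
    controlMeasure w L univ = ENNReal.ofReal (L * ∫ s in (0 : ℝ)..1, l1Norm (w s)) := by
  rw [controlMeasure, withDensity_apply _ MeasurableSet.univ, Measure.restrict_univ,
    ← ofReal_integral_eq_lintegral_ofReal, intervalIntegral.integral_of_le zero_le_one,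
    integral_const_mul]
  · exact (integrableOn_l1Norm hw).const_mul _
  · exact Eventually.of_forall fun s => mul_nonneg L.2 (l1Norm_nonneg _)

theorem isFiniteMeasure_controlMeasure {w : ℝ → Fin m → ℝ}
    (hw : ∀ j, IntegrableOn (fun s => w s j) (Ioc 0 1)) (L : ℝ≥0) :
    IsFiniteMeasure (controlMeasure w L) :=
  ⟨by rw [controlMeasure_univ hw]; exact ENNReal.ofReal_lt_top⟩

/-- The pointwise Lipschitz bound turns L‖w(s)‖ ds into the measure of a Volterra estimate. Since φ
is only a majorant of the distance, the same bound serves Picard iteration, Gronwall's inequality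
and, with φ constant, the Lipschitz estimate for jumps. Replacing ]0,s] by ]0,s[ is free for
Lebesgue measure. -/
theorem enorm_integral_controlField_sub_le {w : ℝ → Fin m → ℝ}
    (hw : ∀ j, IntegrableOn (fun s => w s j) (Ioc 0 1)) {G : Fin m → ℝ → E → E} {L : ℝ≥0}
    {y z : ℝ → E} {φ : ℝ → ℝ≥0∞}
    (hL : ∀ j, ∀ s ∈ Ioc (0 : ℝ) 1, ‖G j s (y s) - G j s (z s)‖ ≤ L * ‖y s - z s‖)
    (hφ : ∀ s ∈ Ioc (0 : ℝ) 1, edist (y s) (z s) ≤ φ s)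
    {s : ℝ} (hs : s ∈ Icc (0 : ℝ) 1) :
    ‖∫ s' in (0 : ℝ)..s, (controlField w G y s' - controlField w G z s')‖ₑ ≤
      ∫⁻ s' in Iio s, φ s' ∂(controlMeasure w L) := by
  rw [intervalIntegral.integral_of_le hs.1]
  refine (enorm_integral_le_lintegral_enorm _).trans ?_
  have hm : AEMeasurable (fun s => ENNReal.ofReal (L * l1Norm (w s)))
      (volume.restrict (Ioc 0 1)) :=
    ((integrableOn_l1Norm hw).const_mul _).aestronglyMeasurable.aemeasurable.ennreal_ofReal
  rw [controlMeasure, restrict_withDensity measurableSet_Iio,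
    lintegral_withDensity_eq_lintegral_mul_non_measurable₀ _ hm.restrict
      (Eventually.of_forall fun _ => ENNReal.ofReal_lt_top),
    Measure.restrict_restrict measurableSet_Iio]
  have hset : (Iio s ∩ Ioc 0 1 : Set ℝ) = Ioo 0 s := by
    ext x
    simp only [mem_inter_iff, mem_Iio, mem_Ioc, mem_Ioo]
    exact ⟨fun h => ⟨h.2.1, h.1⟩, fun h => ⟨h.2, h.1, (h.2.trans_le hs.2).le⟩⟩
  rw [hset, ← Measure.restrict_congr_set (Ioo_ae_eq_Ioc (μ := volume) (a := 0) (b := s))]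
  refine setLIntegral_mono' measurableSet_Ioo fun x hx => ?_
  have hx' : x ∈ Ioc (0 : ℝ) 1 := ⟨hx.1, hx.2.le.trans hs.2⟩
  calc ‖controlField w G y x - controlField w G z x‖ₑ
      ≤ ENNReal.ofReal (L * l1Norm (w x)) * edist (y x) (z x) := by
        rw [edist_dist, dist_eq_norm, ← ENNReal.ofReal_mul (mul_nonneg L.coe_nonneg (l1Norm_nonneg _)),
          ← ofReal_norm]
        refine ENNReal.ofReal_le_ofReal ?_
        have := norm_sum_smul_le (w x) (fun j => hL j x hx')
        rw [controlField, controlField, ← Finset.sum_sub_distrib]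
        simp only [← smul_sub]
        calc _ ≤ _ := this
          _ = _ := by ring
    _ ≤ _ := by
        simp only [Pi.mul_apply]
        gcongr
        exact hφ x hx'

/-- Continuous dependence on the initial value. -/
theorem edist_controlField_solution_le {w : ℝ → Fin m → ℝ}
    (hw : ∀ j, IntegrableOn (fun s => w s j) (Ioc 0 1)) {G : Fin m → ℝ → E → E} {L : ℝ≥0}
    {R : ℝ} {y z : ℝ → E}
    (hL : ∀ j, ∀ s ∈ Icc (0 : ℝ) 1, ∀ a b, ‖a‖ ≤ R → ‖b‖ ≤ R → ‖G j s a - G j s b‖ ≤ L * ‖a - b‖)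
    (hy : ∀ s ∈ Icc (0 : ℝ) 1, ‖y s‖ ≤ R) (hz : ∀ s ∈ Icc (0 : ℝ) 1, ‖z s‖ ≤ R)
    (hyi : IntervalIntegrable (controlField w G y) volume 0 1)
    (hzi : IntervalIntegrable (controlField w G z) volume 0 1)
    (hye : ∀ s ∈ Icc (0 : ℝ) 1, y s = y 0 + ∫ s' in (0 : ℝ)..s, controlField w G y s')
    (hze : ∀ s ∈ Icc (0 : ℝ) 1, z s = z 0 + ∫ s' in (0 : ℝ)..s, controlField w G z s')
    {s : ℝ} (hs : s ∈ Icc (0 : ℝ) 1) :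
    edist (y s) (z s) ≤ 2 * edist (y 0) (z 0) *
      ENNReal.ofReal (Real.exp (2 * (L * ∫ s in (0 : ℝ)..1, l1Norm (w s)))) := by
  have := isFiniteMeasure_controlMeasure hw L
  -- Extension by zero outside [0,1] makes the inequality valid on the whole line, as
  -- `measure_gronwall` requires.
  set φ : ℝ → ℝ≥0∞ := (Icc (0 : ℝ) 1).indicator fun s => edist (y s) (z s) with hφ
  have hφe : ∀ s ∈ Icc (0 : ℝ) 1, φ s = edist (y s) (z s) := fun s hs => indicator_of_mem hs _
  have hstep : ∀ s, φ s ≤ edist (y 0) (z 0) + ∫⁻ s' in Iio s, φ s' ∂(controlMeasure w L) := by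
    intro s
    by_cases hs : s ∈ Icc (0 : ℝ) 1
    · have hsub : uIcc 0 s ⊆ uIcc (0 : ℝ) 1 := by
        rw [uIcc_of_le hs.1, uIcc_of_le zero_le_one]
        exact Icc_subset_Icc_right hs.2
      have heq : y s - z s = (y 0 - z 0) +
          ∫ s' in (0 : ℝ)..s, (controlField w G y s' - controlField w G z s') := by
        rw [intervalIntegral.integral_sub (hyi.mono_set hsub) (hzi.mono_set hsub), hye s hs,
          hze s hs]
        abel
      rw [hφe s hs, edist_eq_enorm_sub, heq, edist_eq_enorm_sub]
      refine (enorm_add_le _ _).trans (add_le_add_right ?_ _)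
      refine enorm_integral_controlField_sub_le hw (fun j x hx => ?_) (fun x hx => ?_) hs
      · have hx' : x ∈ Icc (0 : ℝ) 1 := Ioc_subset_Icc_self hx
        exact hL j x hx' _ _ (hy x hx') (hz x hx')
      · rw [hφe x (Ioc_subset_Icc_self hx)]
    · rw [hφ, indicator_of_notMem hs]
      exact zero_le
  have hb : ∀ s, φ s ≤ ENNReal.ofReal (R + R) := by
    intro s
    by_cases hs : s ∈ Icc (0 : ℝ) 1
    · rw [hφe s hs, edist_dist]
      refine ENNReal.ofReal_le_ofReal ?_
      rw [dist_eq_norm]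
      exact (norm_sub_le _ _).trans (add_le_add (hy s hs) (hz s hs))
    · rw [hφ, indicator_of_notMem hs]
      exact zero_le
  rw [← hφe s hs]
  refine (measure_gronwall (controlMeasure w L) ENNReal.ofReal_ne_top hb hstep s).trans ?_
  gcongr
  refine (expWeight_le _ _).trans (le_of_eq ?_)
  rw [measureReal_def, controlMeasure_univ hw, ENNReal.toReal_ofReal]
  exact mul_nonneg L.2 (intervalIntegral.integral_nonneg zero_le_one fun _ _ => l1Norm_nonneg _)

theorem norm_integral_controlField_le {w : ℝ → Fin m → ℝ}
    (hw : ∀ j, IntegrableOn (fun s => w s j) (Ioc 0 1)) {G : Fin m → ℝ → E → E} {C : ℝ}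
    (hC0 : 0 ≤ C) (hC : ∀ j s z, ‖G j s z‖ ≤ C) (y : ℝ → E) {s : ℝ} (hs : s ∈ Icc (0 : ℝ) 1) :
    ‖∫ s' in (0 : ℝ)..s, controlField w G y s'‖ ≤ C * ∫ s' in (0 : ℝ)..1, l1Norm (w s') := by
  have hi : IntervalIntegrable (fun s => l1Norm (w s) * C) volume 0 1 :=
    ((intervalIntegrable_iff_integrableOn_Ioc_of_le zero_le_one).mpr
      (integrableOn_l1Norm hw)).mul_const C
  have hsub : uIcc 0 s ⊆ uIcc (0 : ℝ) 1 := by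
    rw [uIcc_of_le hs.1, uIcc_of_le zero_le_one]
    exact Icc_subset_Icc_right hs.2
  calc ‖∫ s' in (0 : ℝ)..s, controlField w G y s'‖
      ≤ ∫ s' in (0 : ℝ)..s, l1Norm (w s') * C :=
        intervalIntegral.norm_integral_le_of_norm_le hs.1
          (Eventually.of_forall fun x _ => norm_sum_smul_le (w x) fun j => hC j x _)
          (hi.mono_set hsub)
    _ ≤ ∫ s' in (0 : ℝ)..1, l1Norm (w s') * C :=
        intervalIntegral.integral_mono_interval le_rfl hs.1 hs.2
          (Eventually.of_forall fun x => mul_nonneg (l1Norm_nonneg _) hC0) hi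
    _ = _ := by rw [intervalIntegral.integral_mul_const, mul_comm]

/-- Existence of solutions of a Carathéodory equation with bounded, locally Lipschitz fields. -/
theorem exists_controlField_solution [MeasurableSpace E] [BorelSpace E] [CompleteSpace E]
    {w : ℝ → Fin m → ℝ}
    (hw : ∀ j, IntegrableOn (fun s => w s j) (Ioc 0 1)) {G : Fin m → ℝ → E → E} {C : ℝ}
    (hC0 : 0 ≤ C) (hC : ∀ j s z, ‖G j s z‖ ≤ C)
    (hm : ∀ j y, Measurable y →
      AEStronglyMeasurable (fun s => G j s (y s)) (volume.restrict (Ioc 0 1)))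
    (hL : ∀ R, ∃ L : ℝ≥0, ∀ j, ∀ s ∈ Icc (0 : ℝ) 1, ∀ a b, ‖a‖ ≤ R → ‖b‖ ≤ R →
      ‖G j s a - G j s b‖ ≤ L * ‖a - b‖) (z₀ : E) :
    ∃ z : ℝ → E, Measurable z ∧ z 0 = z₀ ∧
      IntervalIntegrable (controlField w G z) volume 0 1 ∧
      ∀ s ∈ Icc (0 : ℝ) 1, z s = z₀ + ∫ s' in (0 : ℝ)..s, controlField w G z s' := by
  -- An a priori bound: every iterate stays in the ball of radius R because the fields are bounded
  -- by C, so a Lipschitz constant on that ball is enough.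
  set R : ℝ := ‖z₀‖ + C * ∫ s' in (0 : ℝ)..1, l1Norm (w s') with hR
  have hR0 : 0 ≤ R := add_nonneg (norm_nonneg _) (mul_nonneg hC0
    (intervalIntegral.integral_nonneg zero_le_one fun _ _ => l1Norm_nonneg _))
  obtain ⟨L, hL⟩ := hL R
  have := isFiniteMeasure_controlMeasure hw L
  -- Clamping s to [0,1] defines the operator for curves on the whole line.
  set Φ : (ℝ → E) → ℝ → E := fun y s =>
    z₀ + ∫ s' in (0 : ℝ)..(projIcc 0 1 zero_le_one s : ℝ), controlField w G y s' with hΦ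
  have hint : ∀ y, Measurable y → IntervalIntegrable (controlField w G y) volume 0 1 := fun y hy =>
    (intervalIntegrable_iff_integrableOn_Ioc_of_le zero_le_one).mpr
      (integrableOn_controlField hw (fun j => hm j y hy) hC)
  have hproj : ∀ s : ℝ, (projIcc 0 1 zero_le_one s : ℝ) ∈ Icc (0 : ℝ) 1 := fun s => Subtype.coe_prop _
  obtain ⟨z, hzm, -, hz⟩ := exists_volterra_fixedPoint (controlMeasure w L) Φ hR0
    (fun y hy _ => by
      have hc : ContinuousOn (fun s => ∫ s' in (0 : ℝ)..s, controlField w G y s')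
          (Icc (0 : ℝ) 1) := by
        have := intervalIntegral.continuousOn_primitive_interval (μ := volume)
          (f := controlField w G y) (a := 0) (b := 1)
          ((intervalIntegrable_iff').mp (hint y hy))
        rwa [uIcc_of_le zero_le_one] at this
      have : Continuous fun s : ℝ => ∫ s' in (0 : ℝ)..(projIcc 0 1 zero_le_one s : ℝ),
          controlField w G y s' :=
        hc.comp_continuous (continuous_subtype_val.comp continuous_projIcc) hproj
      exact (continuous_const.add this).measurable)
    (fun y _ _ s => (norm_add_le _ _).trans (add_le_add_right
      (norm_integral_controlField_le hw hC0 hC y (hproj s)) _))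
    (fun y z hy hyR hz hzR s => by
      have hsub : uIcc 0 (projIcc 0 1 zero_le_one s : ℝ) ⊆ uIcc (0 : ℝ) 1 := by
        rw [uIcc_of_le (hproj s).1, uIcc_of_le zero_le_one]
        exact Icc_subset_Icc_right (hproj s).2
      rw [edist_eq_enorm_sub, add_sub_add_left_eq_sub, ← intervalIntegral.integral_sub
        ((hint y hy).mono_set hsub) ((hint z hz).mono_set hsub)]
      rcases le_or_gt s 0 with hs | hs
      · rw [projIcc_of_le_left _ hs]
        simp
      · refine (enorm_integral_controlField_sub_le hw (L := L)
          (φ := fun x => edist (y x) (z x)) (fun j x hx => ?_) (fun _ _ => le_rfl)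
          (hproj s)).trans ?_
        · exact hL j x (Ioc_subset_Icc_self hx) _ _ (hyR x) (hzR x)
        · refine lintegral_mono_set (Iio_subset_Iio ?_)
          rw [coe_projIcc]
          exact max_le hs.le (min_le_right _ _))
  refine ⟨z, hzm, ?_, hint z hzm, fun s hs => ?_⟩
  · rw [← hz 0]
    simp [hΦ]
  · rw [← hz s]
    simp only [hΦ, projIcc_of_mem zero_le_one hs]

end Caratheodory

/-! ### Atoms of measures on the line -/

theorem summable_measureReal_singleton (ν : Measure ℝ) [IsFiniteMeasure ν] :
    Summable fun t : ℝ => ν.real {t} := by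
  refine ENNReal.summable_toReal (ne_top_of_le_ne_top (measure_ne_top ν univ) ?_)
  refine (tsum_meas_le_meas_iUnion_of_disjoint ν (fun t : ℝ => measurableSet_singleton t)
    fun a b hab => ?_).trans (measure_mono (subset_univ _))
  simpa [Function.onFun] using hab

/-- A finite partial sum is the integral over a finite set. Through this bound a sum of jumps of
size φ(t)ν({t}) is absorbed into an integral against ν. -/
theorem tsum_indicator_mul_measure_singleton_le (ν : Measure ℝ) (φ : ℝ → ℝ≥0∞) {A : Set ℝ}
    (hA : MeasurableSet A) : ∑' t, A.indicator φ t * ν {t} ≤ ∫⁻ t in A, φ t ∂ν := by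
  rw [← lintegral_indicator hA, ENNReal.tsum_eq_iSup_sum]
  refine iSup_le fun s => ?_
  rw [← lintegral_finset]
  exact setLIntegral_le_lintegral _ _

theorem isFiniteMeasure_variation (s : SignedMeasure ℝ) : IsFiniteMeasure s.variation := by
  rw [← SignedMeasure.totalVariation_eq_variation]
  unfold SignedMeasure.totalVariation
  infer_instance

theorem variation_singleton_eq_zero {s : SignedMeasure ℝ} {t : ℝ} (h : s {t} = 0) :
    s.variation {t} = 0 := by
  rw [VectorMeasure.variation_apply_eq_zero (measurableSet_singleton t)]
  intro u hu _
  rcases subset_singleton_iff_eq.mp hu with rfl | rfl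
  · simp
  · exact h

theorem contPart_singleton {m : ℕ} (μ : VectorMeasure ℝ (Fin m → ℝ)) (t : ℝ) :
    contPart μ {t} = 0 := by
  rw [contPart, VectorMeasure.restrict_apply _ (measurableSet_not_atom μ)
    (measurableSet_singleton t)]
  by_cases h : μ {t} = 0
  · rw [inter_eq_self_of_subset_left (by simpa using h), h]
  · rw [singleton_inter_eq_empty.mpr (by simpa using h)]
    simp

theorem coordMeasure_contPart_singleton {m : ℕ} (μ : VectorMeasure ℝ (Fin m → ℝ)) (j : Fin m)
    (t : ℝ) : coordMeasure (contPart μ) j {t} = 0 := by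
  exact congrFun (contPart_singleton μ t) j

/-! ### Integrals driven by time, an atomless vector measure and a family of jumps -/

section Drive

set_option linter.unusedSectionVars false

variable {m : ℕ} {E : Type*} [NormedAddCommGroup E] [NormedSpace ℝ E] [CompleteSpace E]

/-- `∫_A F dt + ∑ j, ∫_A G_j dσ_j + ∑_{t ∈ A} J(t)`. -/
noncomputable def drive (σ : Fin m → SignedMeasure ℝ) (F : ℝ → E) (G : Fin m → ℝ → E) (J : ℝ → E)
    (A : Set ℝ) : E :=
  (∫ t in A, F t) + (∑ j, ∫ᵛ t in A, G j t ∂<•(σ j)) + ∑' t, A.indicator J t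

/-- Integrability of the data of `drive` over `I`. -/
structure IsDriver (σ : Fin m → SignedMeasure ℝ) (I : Set ℝ) (F : ℝ → E) (G : Fin m → ℝ → E)
    (J : ℝ → E) : Prop where
  left : IntegrableOn F I
  middle : ∀ j, IntegrableOn (G j) I (σ j).variation
  right : Summable (I.indicator J)

/-- The measure controlling `drive` on subsets of `[0,T]`. -/
noncomputable def driveMeasure (σ : Fin m → SignedMeasure ℝ) (ν : Measure ℝ) (T : ℝ) : Measure ℝ :=
  volume.restrict (Icc 0 T) + ∑ j, (σ j).variation + ν

instance isFiniteMeasure_driveMeasure (σ : Fin m → SignedMeasure ℝ) (ν : Measure ℝ)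
    [IsFiniteMeasure ν] (T : ℝ) : IsFiniteMeasure (driveMeasure σ ν T) := by
  have := fun j => isFiniteMeasure_variation (σ j)
  unfold driveMeasure
  infer_instance

variable {σ : Fin m → SignedMeasure ℝ} {I A B : Set ℝ} {F F' : ℝ → E} {G G' : Fin m → ℝ → E}
  {J J' : ℝ → E}

theorem IsDriver.mono (h : IsDriver σ I F G J) (hA : A ⊆ I) : IsDriver σ A F G J where
  left := h.left.mono_set hA
  middle j := (h.middle j).mono_set hA
  right := by
    have := h.right.indicator A
    rwa [indicator_indicator, inter_eq_self_of_subset_left hA] at this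

theorem vectorIntegrableOn {s : SignedMeasure ℝ} {g : ℝ → E} (hA : MeasurableSet A)
    (h : IntegrableOn g A s.variation) : s.IntegrableOn g A := by
  rw [VectorMeasure.IntegrableOn, VectorMeasure.Integrable, VectorMeasure.variation_restrict hA]
  exact h

theorem drive_union (h : IsDriver σ I F G J) (hA : MeasurableSet A) (hB : MeasurableSet B)
    (hAI : A ⊆ I) (hBI : B ⊆ I) (hAB : Disjoint A B) :
    drive σ F G J (A ∪ B) = drive σ F G J A + drive σ F G J B := by
  have h1 := h.mono hAI
  have h2 := h.mono hBI
  have hs : ∑' t, (A ∪ B).indicator J t = ∑' t, A.indicator J t + ∑' t, B.indicator J t := by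
    rw [← h1.right.tsum_add h2.right]
    exact tsum_congr fun t => congrFun (indicator_union_of_disjoint hAB J) t
  rw [drive, drive, drive, setIntegral_union hAB hB h1.left h2.left, hs,
    Finset.sum_congr rfl fun j _ => VectorMeasure.setIntegral_union hAB hA hB
      (vectorIntegrableOn hA (h1.middle j)) (vectorIntegrableOn hB (h2.middle j)),
    Finset.sum_add_distrib]
  abel

theorem drive_sub (hA : MeasurableSet A) (h : IsDriver σ A F G J) (h' : IsDriver σ A F' G' J') :
    drive σ F G J A - drive σ F' G' J' A =
      drive σ (F - F') (fun j => G j - G' j) (J - J') A := by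
  have hs : ∑' t, A.indicator (J - J') t = ∑' t, A.indicator J t - ∑' t, A.indicator J' t := by
    rw [← h.right.tsum_sub h'.right]
    exact tsum_congr fun t => congrFun (indicator_sub' A J J') t
  rw [drive, drive, drive, hs]
  simp only [Pi.sub_apply]
  rw [integral_sub h.left h'.left, Finset.sum_congr rfl fun j _ => VectorMeasure.integral_fun_sub
      (vectorIntegrableOn hA (h.middle j)) (vectorIntegrableOn hA (h'.middle j)),
    Finset.sum_sub_distrib]
  abel

/-- Neither Lebesgue measure nor the atomless σ charges the countable set D, so the fields may
differ there; the jumps must agree everywhere on A. -/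
theorem drive_congr (hσ : ∀ j t, σ j {t} = 0) (hA : MeasurableSet A) {D : Set ℝ}
    (hD : D.Countable) (hF : ∀ t ∈ A, t ∉ D → F t = F' t)
    (hG : ∀ j, ∀ t ∈ A, t ∉ D → G j t = G' j t) (hJ : EqOn J J' A) :
    drive σ F G J A = drive σ F' G' J' A := by
  have hae : ∀ j, ∀ᵐ t ∂(σ j).variation, t ∉ D := fun j =>
    measure_eq_zero_iff_ae_notMem.mp ((measure_null_iff_singleton hD).mpr
      fun t _ => variation_singleton_eq_zero (hσ j t))
  rw [drive, drive, indicator_congr hJ]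
  congr 2
  · refine setIntegral_congr_ae hA ?_
    filter_upwards [hD.ae_notMem volume] with t ht htA using hF t htA ht
  · refine Finset.sum_congr rfl fun j _ => VectorMeasure.setIntegral_congr_ae ?_
    filter_upwards [hae j] with t ht htA using hG j t htA ht

/-- The three terms of `drive` are bounded by the three summands of `driveMeasure`, the jumps being
read as an integral against the atoms of ν. -/
theorem enorm_drive_le {ν : Measure ℝ} {T : ℝ} (hA : MeasurableSet A) (hAT : A ⊆ Icc 0 T)
    {φ : ℝ → ℝ≥0∞} (hF : ∀ t ∈ A, ‖F t‖ₑ ≤ φ t) (hG : ∀ j, ∀ t ∈ A, ‖G j t‖ₑ ≤ φ t)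
    (hJ : ∀ t ∈ A, ‖J t‖ₑ ≤ φ t * ν {t}) :
    ‖drive σ F G J A‖ₑ ≤ ∫⁻ t in A, φ t ∂(driveMeasure σ ν T) := by
  -- The norm estimate for vector-measure integrals carries the norm of the underlying bilinear
  -- pairing, here at most 1.
  have hB : ‖((ContinuousLinearMap.lsmul ℝ ℝ).flip : E →L[ℝ] ℝ →L[ℝ] E)‖ₑ ≤ 1 := by
    rw [← ofReal_norm, ContinuousLinearMap.opNorm_flip, ← ENNReal.ofReal_one]
    exact ENNReal.ofReal_le_ofReal (ContinuousLinearMap.opNorm_lsmul_le)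
  have h1 : ‖∫ t in A, F t‖ₑ ≤ ∫⁻ t in A, φ t ∂(volume.restrict (Icc 0 T)) := by
    rw [Measure.restrict_restrict hA, inter_eq_self_of_subset_left hAT]
    exact (enorm_integral_le_lintegral_enorm _).trans (setLIntegral_mono' hA hF)
  have h2 : ∀ j, ‖∫ᵛ t in A, G j t ∂<•(σ j)‖ₑ ≤ ∫⁻ t in A, φ t ∂(σ j).variation := by
    intro j
    refine VectorMeasure.enorm_integral_le_lintegral_enorm.trans ?_
    rw [VectorMeasure.variation_restrict hA]
    exact (mul_le_of_le_one_left' hB).trans (setLIntegral_mono' hA (hG j))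
  have h3 : ‖∑' t, A.indicator J t‖ₑ ≤ ∫⁻ t in A, φ t ∂ν := by
    refine enorm_tsum_le_tsum_enorm.trans (le_trans ?_
      (tsum_indicator_mul_measure_singleton_le ν φ hA))
    refine ENNReal.tsum_le_tsum fun t => ?_
    by_cases ht : t ∈ A
    · simpa [ht] using hJ t ht
    · simp [ht]
  rw [← lintegral_indicator hA, driveMeasure, lintegral_add_measure, lintegral_add_measure,
    lintegral_finsetSum_measure]
  simp only [lintegral_indicator hA]
  refine (enorm_add_le _ _).trans (add_le_add ((enorm_add_le _ _).trans (add_le_add h1 ?_)) h3)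
  exact (enorm_sum_le _ _).trans (Finset.sum_le_sum fun j _ => h2 j)

theorem norm_drive_le {ν : Measure ℝ} [IsFiniteMeasure ν] {T C : ℝ} (hC0 : 0 ≤ C)
    (hA : MeasurableSet A) (hAT : A ⊆ Icc 0 T)
    (hF : ∀ t ∈ A, ‖F t‖ ≤ C) (hG : ∀ j, ∀ t ∈ A, ‖G j t‖ ≤ C)
    (hJ : ∀ t ∈ A, ‖J t‖ ≤ C * ν.real {t}) :
    ‖drive σ F G J A‖ ≤ C * (driveMeasure σ ν T).real A := by
  have h := enorm_drive_le (σ := σ) (F := F) (G := G) (J := J) (ν := ν) hA hAT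
    (φ := fun _ => ENNReal.ofReal C)
    (fun t ht => by rw [← ofReal_norm]; exact ENNReal.ofReal_le_ofReal (hF t ht))
    (fun j t ht => by rw [← ofReal_norm]; exact ENNReal.ofReal_le_ofReal (hG j t ht))
    (fun t ht => by
      rw [← ofReal_norm, ← ofReal_measureReal (measure_ne_top ν _), ← ENNReal.ofReal_mul hC0]
      exact ENNReal.ofReal_le_ofReal (hJ t ht))
  rw [setLIntegral_const, ← ofReal_measureReal (measure_ne_top _ _), ← ENNReal.ofReal_mul hC0,
    ← ofReal_norm] at h
  exact (ENNReal.ofReal_le_ofReal_iff (mul_nonneg hC0 measureReal_nonneg)).mp h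

theorem summable_indicator_of_norm_le {ν : Measure ℝ} [IsFiniteMeasure ν] {C : ℝ}
    (hJ : ∀ t ∈ A, ‖J t‖ ≤ C * ν.real {t}) : Summable (A.indicator J) := by
  refine Summable.of_norm_bounded ((summable_measureReal_singleton ν).mul_left |C|) fun t => ?_
  by_cases ht : t ∈ A
  · rw [indicator_of_mem ht]
    exact (hJ t ht).trans (mul_le_mul_of_nonneg_right (le_abs_self C) measureReal_nonneg)
  · rw [indicator_of_notMem ht, norm_zero]
    positivity

end Drive

/-! ### Equations with absolutely continuous part, atomless part and state-dependent jumps -/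

section Step

variable {m n : ℕ} {σ : Fin m → SignedMeasure ℝ} {ν : Measure ℝ} {T a b C : ℝ}

theorem norm_drive_sub_le {E : Type*} [NormedAddCommGroup E] [NormedSpace ℝ E] [CompleteSpace E]
    [IsFiniteMeasure ν] {I A B : Set ℝ} {F : ℝ → E}
    {G : Fin m → ℝ → E} {J : ℝ → E} (h : IsDriver σ I F G J) (hC0 : 0 ≤ C)
    (hI : I ⊆ Icc 0 T) (hF : ∀ t ∈ I, ‖F t‖ ≤ C) (hG : ∀ j, ∀ t ∈ I, ‖G j t‖ ≤ C)
    (hJ : ∀ t ∈ I, ‖J t‖ ≤ C * ν.real {t}) (hA : MeasurableSet A) (hB : MeasurableSet B)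
    (hAB : A ⊆ B) (hBI : B ⊆ I) :
    ‖drive σ F G J B - drive σ F G J A‖ ≤ C * (driveMeasure σ ν T).real (B \ A) := by
  have hsub : B \ A ⊆ I := sdiff_subset.trans hBI
  have := drive_union h hA (hB.diff hA) (hAB.trans hBI) hsub disjoint_sdiff_right
  rw [union_sdiff_cancel hAB] at this
  rw [this, add_sub_cancel_left]
  exact norm_drive_le hC0 (hB.diff hA) (hsub.trans hI) (fun t ht => hF t (hsub ht))
    (fun j t ht => hG j t (hsub ht)) (fun t ht => hJ t (hsub ht))

/-- The data of one step: fields `F`, `G` and the map `X` sending the state before a jump to the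
state after it. -/
structure IsStep (σ : Fin m → SignedMeasure ℝ) (ν : Measure ℝ) (T a b C : ℝ)
    (F : ℝ → EuclideanSpace ℝ (Fin n) → EuclideanSpace ℝ (Fin n))
    (G : Fin m → ℝ → EuclideanSpace ℝ (Fin n) → EuclideanSpace ℝ (Fin n))
    (X : ℝ → EuclideanSpace ℝ (Fin n) → EuclideanSpace ℝ (Fin n)) : Prop where
  subset : Ioo a b ⊆ Icc 0 T
  nonneg : 0 ≤ C
  F_bdd : ∀ t x, ‖F t x‖ ≤ C
  G_bdd : ∀ j t x, ‖G j t x‖ ≤ C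
  F_meas : ∀ x, Measurable x → Measurable ((Ioo a b).indicator fun t => F t (x t))
  G_meas : ∀ j x, Measurable x → Measurable ((Ioo a b).indicator fun t => G j t (x t))
  lip : ∀ R, ∃ L : ℝ≥0, ∀ t ∈ Ioo a b, ∀ x x', ‖x‖ ≤ R → ‖x'‖ ≤ R →
    ‖F t x - F t x'‖ ≤ L * ‖x - x'‖ ∧ ∀ j, ‖G j t x - G j t x'‖ ≤ L * ‖x - x'‖
  X_bdd : ∀ t ∈ Ioo a b, ∀ y, ‖X t y - y‖ ≤ C * ν.real {t}
  X_lip : ∀ R, ∃ K : ℝ≥0, ∀ t ∈ Ioo a b, ∀ y y', ‖y‖ ≤ R → ‖y'‖ ≤ R →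
    edist (X t y) (X t y') ≤ K * edist y y' ∧
    edist (X t y - y) (X t y' - y') ≤ K * edist y y' * ν {t}

variable {F : ℝ → EuclideanSpace ℝ (Fin n) → EuclideanSpace ℝ (Fin n)}
  {G : Fin m → ℝ → EuclideanSpace ℝ (Fin n) → EuclideanSpace ℝ (Fin n)}
  {X : ℝ → EuclideanSpace ℝ (Fin n) → EuclideanSpace ℝ (Fin n)}

/-- The integral over `A` along the curve `y` of states before jumps. -/
noncomputable def stepDrive (σ : Fin m → SignedMeasure ℝ)
    (F : ℝ → EuclideanSpace ℝ (Fin n) → EuclideanSpace ℝ (Fin n))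
    (G : Fin m → ℝ → EuclideanSpace ℝ (Fin n) → EuclideanSpace ℝ (Fin n))
    (X : ℝ → EuclideanSpace ℝ (Fin n) → EuclideanSpace ℝ (Fin n))
    (y : ℝ → EuclideanSpace ℝ (Fin n)) (A : Set ℝ) : EuclideanSpace ℝ (Fin n) :=
  drive σ (fun t => F t (X t (y t))) (fun j t => G j t (X t (y t))) (fun t => X t (y t) - y t) A

theorem integrableOn_of_measurable_indicator {E : Type*} [NormedAddCommGroup E]
    [MeasurableSpace E] [BorelSpace E] [SecondCountableTopology E] {ρ : Measure ℝ}
    [IsFiniteMeasure ρ] {I : Set ℝ} (hI : MeasurableSet I) {u : ℝ → E}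
    (hu : Measurable (I.indicator u)) (hC : ∀ t ∈ I, ‖u t‖ ≤ C) : IntegrableOn u I ρ := by
  have : IntegrableOn (I.indicator u) I ρ :=
    Measure.integrableOn_of_bounded (measure_ne_top ρ I) hu.aestronglyMeasurable
      ((ae_restrict_iff' hI).mpr (Eventually.of_forall fun t ht => by
        rw [indicator_of_mem ht]; exact hC t ht))
  exact this.congr_fun (fun t ht => indicator_of_mem ht u) hI

theorem isDriver_of_bdd [IsFiniteMeasure ν] {I : Set ℝ} (hI : MeasurableSet I) (hIT : I ⊆ Icc 0 T)
    {u : ℝ → EuclideanSpace ℝ (Fin n)} {v : Fin m → ℝ → EuclideanSpace ℝ (Fin n)}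
    {J : ℝ → EuclideanSpace ℝ (Fin n)}
    (hu : Measurable (I.indicator u)) (hv : ∀ j, Measurable (I.indicator (v j)))
    (huC : ∀ t ∈ I, ‖u t‖ ≤ C) (hvC : ∀ j, ∀ t ∈ I, ‖v j t‖ ≤ C)
    (hJ : ∀ t ∈ I, ‖J t‖ ≤ C * ν.real {t}) : IsDriver σ I u v J where
  left := by
    have := integrableOn_of_measurable_indicator (ρ := volume.restrict (Icc 0 T)) hI hu huC
    rwa [IntegrableOn, Measure.restrict_restrict hI, inter_eq_self_of_subset_left hIT] at this
  middle j := by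
    have := isFiniteMeasure_variation (σ j)
    exact integrableOn_of_measurable_indicator hI (hv j) (hvC j)
  right := summable_indicator_of_norm_le hJ

/-- By `X_bdd` a state moves only at an atom of ν, and these are countably many. Hence no
measurability of X in t is needed, and X may come from a choice of solutions at each time. -/
theorem IsStep.measurable_jump [IsFiniteMeasure ν] (h : IsStep σ ν T a b C F G X)
    {y : ℝ → EuclideanSpace ℝ (Fin n)} (hy : Measurable ((Ioo a b).indicator y)) :
    Measurable ((Ioo a b).indicator fun t => X t (y t)) := by
  refine hy.measurable_of_countable_ne
    ((summable_measureReal_singleton ν).countable_support.mono fun t ht => ?_)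
  simp only [mem_ofPred_eq, ne_eq] at ht
  by_cases hI : t ∈ Ioo a b
  · rw [indicator_of_mem hI, indicator_of_mem hI] at ht
    intro h0
    simp only at h0
    have := h.X_bdd t hI (y t)
    rw [h0, mul_zero] at this
    exact ht (sub_eq_zero.mp (norm_le_zero_iff.mp this)).symm
  · simp [hI] at ht

theorem IsStep.isDriver [IsFiniteMeasure ν] (h : IsStep σ ν T a b C F G X)
    {y : ℝ → EuclideanSpace ℝ (Fin n)} (hy : Measurable ((Ioo a b).indicator y)) :
    IsDriver σ (Ioo a b) (fun t => F t (X t (y t))) (fun j t => G j t (X t (y t)))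
      (fun t => X t (y t) - y t) := by
  have hx := h.measurable_jump hy
  have key : ∀ H : ℝ → EuclideanSpace ℝ (Fin n) → EuclideanSpace ℝ (Fin n),
      (∀ x, Measurable x → Measurable ((Ioo a b).indicator fun t => H t (x t))) →
      Measurable ((Ioo a b).indicator fun t => H t (X t (y t))) := by
    intro H hH
    convert hH _ hx using 1
    refine indicator_congr fun t ht => ?_
    simp only [indicator_of_mem ht]
  exact isDriver_of_bdd measurableSet_Ioo h.subset (key F h.F_meas) (fun j => key _ (h.G_meas j))
    (fun t _ => h.F_bdd t _) (fun j t _ => h.G_bdd j t _) (fun t ht => h.X_bdd t ht _)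

/-- The fields see the state after the jump, which costs the product L * K of the two Lipschitz
constants; the increments of the jumps cost K and carry the factor ν({t}) required by
`enorm_drive_le`. -/
theorem IsStep.edist_stepDrive_le [IsFiniteMeasure ν] (h : IsStep σ ν T a b C F G X) (R : ℝ) :
    ∃ K : ℝ≥0, ∀ (y z : ℝ → EuclideanSpace ℝ (Fin n)) (A : Set ℝ),
      Measurable ((Ioo a b).indicator y) → Measurable ((Ioo a b).indicator z) →
      (∀ t ∈ Ioo a b, ‖y t‖ ≤ R) → (∀ t ∈ Ioo a b, ‖z t‖ ≤ R) → MeasurableSet A → A ⊆ Ioo a b →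
      edist (stepDrive σ F G X y A) (stepDrive σ F G X z A) ≤
        ∫⁻ t in A, edist (y t) (z t) ∂(K • driveMeasure σ ν T) := by
  obtain ⟨K, hK⟩ := h.X_lip R
  -- A jump can leave the ball of radius R by at most C ν(ℝ), so the fields need a Lipschitz
  -- constant on the larger ball.
  obtain ⟨L, hL⟩ := h.lip (R + C * ν.real univ)
  refine ⟨L * K + K, fun y z A hy hz hyR hzR hA hAI => ?_⟩
  have hXR : ∀ t ∈ Ioo a b, ∀ v, ‖v‖ ≤ R → ‖X t v‖ ≤ R + C * ν.real univ := by
    intro t ht v hv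
    calc ‖X t v‖ = ‖v + (X t v - v)‖ := by rw [add_sub_cancel]
      _ ≤ ‖v‖ + ‖X t v - v‖ := norm_add_le _ _
      _ ≤ R + C * ν.real univ := add_le_add hv ((h.X_bdd t ht v).trans
        (mul_le_mul_of_nonneg_left (measureReal_mono (subset_univ _)) h.nonneg))
  have hfield : ∀ t ∈ Ioo a b, ∀ p q : EuclideanSpace ℝ (Fin n),
      ‖p - q‖ ≤ L * ‖X t (y t) - X t (z t)‖ → ‖p - q‖ₑ ≤ (L * K + K : ℝ≥0) * edist (y t) (z t) := by
    intro t ht p q hpq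
    calc ‖p - q‖ₑ ≤ ENNReal.ofReal (L * ‖X t (y t) - X t (z t)‖) := by
          rw [← ofReal_norm]
          exact ENNReal.ofReal_le_ofReal hpq
      _ = L * edist (X t (y t)) (X t (z t)) := by
          rw [ENNReal.ofReal_mul L.coe_nonneg, ENNReal.ofReal_coe_nnreal, edist_dist,
            dist_eq_norm]
      _ ≤ L * (K * edist (y t) (z t)) := by
          gcongr
          exact (hK t ht _ _ (hyR t ht) (hzR t ht)).1
      _ ≤ (L * K + K : ℝ≥0) * edist (y t) (z t) := by
          rw [← mul_assoc]
          gcongr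
          push_cast
          exact le_self_add
  rw [edist_eq_enorm_sub, stepDrive, stepDrive,
    drive_sub hA ((h.isDriver hy).mono hAI) ((h.isDriver hz).mono hAI), Measure.restrict_smul,
    lintegral_smul_measure, ENNReal.smul_def, smul_eq_mul, ← lintegral_const_mul' _ _ ENNReal.coe_ne_top]
  refine enorm_drive_le hA (hAI.trans h.subset) (fun t ht => ?_) (fun j t ht => ?_)
    (fun t ht => ?_)
  · exact hfield t (hAI ht) _ _ (hL t (hAI ht) _ _ (hXR t (hAI ht) _ (hyR t (hAI ht)))
      (hXR t (hAI ht) _ (hzR t (hAI ht)))).1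
  · exact hfield t (hAI ht) _ _ ((hL t (hAI ht) _ _ (hXR t (hAI ht) _ (hyR t (hAI ht)))
      (hXR t (hAI ht) _ (hzR t (hAI ht)))).2 j)
  · rw [Pi.sub_apply, ← edist_eq_enorm_sub]
    refine ((hK t (hAI ht) _ _ (hyR t (hAI ht)) (hzR t (hAI ht))).2).trans ?_
    gcongr
    exact le_add_self

theorem measurable_indicator_Ioo {E : Type*} [MeasurableSpace E] [Zero E] {y : ℝ → E}
    (hy : Measurable y) : Measurable ((Ioo a b).indicator y) := hy.indicator measurableSet_Ioo

/-- The unknown is the curve of states before jumps: y(t) involves only ]a,t[, so the operator is of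
strict Volterra type even at atoms. -/
theorem IsStep.exists_solution [IsFiniteMeasure ν] (h : IsStep σ ν T a b C F G X)
    (x₁ : EuclideanSpace ℝ (Fin n)) :
    ∃ y : ℝ → EuclideanSpace ℝ (Fin n), Measurable y ∧ (∃ R, ∀ t, ‖y t‖ ≤ R) ∧
      ∀ t ∈ Ioc a b, y t = x₁ + stepDrive σ F G X y (Ioo a t) := by
  set ρ := driveMeasure σ ν T with hρ
  set R : ℝ := ‖x₁‖ + C * ρ.real univ with hR
  have hR0 : 0 ≤ R := add_nonneg (norm_nonneg _) (mul_nonneg h.nonneg measureReal_nonneg)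
  obtain ⟨K, hK⟩ := h.edist_stepDrive_le R
  have hsub : ∀ t, Ioo a (min t b) ⊆ Ioo a b := fun t => Ioo_subset_Ioo_right (min_le_right _ _)
  obtain ⟨y, hy, hyR, hfix⟩ := exists_volterra_fixedPoint (K • ρ)
    -- Stopping at b extends the equation to the whole line: the interval is empty for t ≤ a and
    -- constant for t ≥ b.
    (fun y t => x₁ + stepDrive σ F G X y (Ioo a (min t b))) hR0
    (fun y hy _ => by
      refine measurable_of_norm_sub_le (W := fun t => C * ρ.real (Iio (min t b)))
        fun s t hst => ?_
      have hmin : min s b ≤ min t b := min_le_min_right _ hst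
      rw [add_sub_add_left_eq_sub]
      refine (norm_drive_sub_le (h.isDriver (measurable_indicator_Ioo hy)) h.nonneg h.subset
        (fun t _ => h.F_bdd t _) (fun j t _ => h.G_bdd j t _) (fun t ht => h.X_bdd t ht _)
        measurableSet_Ioo measurableSet_Ioo (Ioo_subset_Ioo_right hmin) (hsub t)).trans ?_
      rw [← mul_sub, ← measureReal_sdiff (Iio_subset_Iio hmin) measurableSet_Iio]
      refine mul_le_mul_of_nonneg_left (measureReal_mono ?_) h.nonneg
      exact fun x hx => ⟨hx.1.2, fun hxs => hx.2 ⟨hx.1.1, hxs⟩⟩)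
    (fun y _ _ t => by
      refine (norm_add_le _ _).trans (add_le_add_right ?_ _)
      refine (norm_drive_le h.nonneg measurableSet_Ioo ((hsub t).trans h.subset)
        (fun t _ => h.F_bdd t _) (fun j t _ => h.G_bdd j t _)
        (fun t' ht => h.X_bdd t' (hsub t ht) _)).trans ?_
      exact mul_le_mul_of_nonneg_left (measureReal_mono (subset_univ _)) h.nonneg)
    (fun y z hy hyR hz hzR t => by
      rw [edist_add_left]
      refine (hK y z _ (measurable_indicator_Ioo hy) (measurable_indicator_Ioo hz)
        (fun t _ => hyR t) (fun t _ => hzR t) measurableSet_Ioo (hsub t)).trans ?_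
      exact lintegral_mono_set fun x hx => hx.2.trans_le (min_le_left _ _))
  refine ⟨y, hy, ⟨R, hyR⟩, fun t ht => ?_⟩
  rw [← hfix t]
  simp only [min_eq_left ht.2]

/-- Both curves start from x₁, so Gronwall's inequality applies with c = 0. The point b is included,
since the left limit at the end of a step is the initial value of the jump at r = h. -/
theorem IsStep.unique [IsFiniteMeasure ν] (h : IsStep σ ν T a b C F G X)
    {x₁ : EuclideanSpace ℝ (Fin n)} {y z : ℝ → EuclideanSpace ℝ (Fin n)} {R : ℝ}
    (hy : Measurable ((Ioo a b).indicator y)) (hz : Measurable ((Ioo a b).indicator z))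
    (hyR : ∀ t ∈ Ioc a b, ‖y t‖ ≤ R) (hzR : ∀ t ∈ Ioc a b, ‖z t‖ ≤ R)
    (hye : ∀ t ∈ Ioc a b, y t = x₁ + stepDrive σ F G X y (Ioo a t))
    (hze : ∀ t ∈ Ioc a b, z t = x₁ + stepDrive σ F G X z (Ioo a t)) : EqOn y z (Ioc a b) := by
  obtain ⟨K, hK⟩ := h.edist_stepDrive_le R
  set φ : ℝ → ℝ≥0∞ := (Ioc a b).indicator fun t => edist (y t) (z t) with hφ
  have hφe : ∀ t ∈ Ioc a b, φ t = edist (y t) (z t) := fun t ht => indicator_of_mem ht _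
  have hstep : ∀ t, φ t ≤ 0 + ∫⁻ s in Iio t, φ s ∂(K • driveMeasure σ ν T) := by
    intro t
    by_cases ht : t ∈ Ioc a b
    · rw [hφe t ht, hye t ht, hze t ht, edist_add_left, zero_add]
      refine (hK y z _ hy hz (fun t ht => hyR t (Ioo_subset_Ioc_self ht))
        (fun t ht => hzR t (Ioo_subset_Ioc_self ht)) measurableSet_Ioo
        (Ioo_subset_Ioo_right ht.2)).trans ?_
      refine (setLIntegral_mono' measurableSet_Ioo fun s hs => ?_).trans
        (lintegral_mono_set fun s hs => hs.2)
      rw [hφe s ⟨hs.1, hs.2.le.trans ht.2⟩]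
    · rw [hφ, indicator_of_notMem ht]
      exact zero_le
  have hb : ∀ t, φ t ≤ ENNReal.ofReal (R + R) := by
    intro t
    by_cases ht : t ∈ Ioc a b
    · rw [hφe t ht, edist_dist]
      refine ENNReal.ofReal_le_ofReal ?_
      rw [dist_eq_norm]
      exact (norm_sub_le _ _).trans (add_le_add (hyR t ht) (hzR t ht))
    · rw [hφ, indicator_of_notMem ht]
      exact zero_le
  intro t ht
  have := measure_gronwall (K • driveMeasure σ ν T) ENNReal.ofReal_ne_top hb hstep t
  rw [mul_zero, zero_mul, hφe t ht] at this
  exact edist_le_zero.mp this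

end Step

/-! ### Jump equations of the delay system -/

namespace DelayImpulseSystem

variable {n m : ℕ} (S : DelayImpulseSystem n m)

/-- The argument `(t, z, p_1, …, p_M)` of the fields. -/
def stateArg (t : ℝ) (z : EuclideanSpace ℝ (Fin n)) (p : Fin S.M → EuclideanSpace ℝ (Fin n)) :
    ℝ × (Fin (S.M + 1) → EuclideanSpace ℝ (Fin n)) :=
  (t, Fin.cons z p)

/-- The delayed states `ζ^r_{l-1}(s), …, ζ^r_{l-M}(s)`. -/
def pastStates (ζ : ℤ → ℝ → ℝ → EuclideanSpace ℝ (Fin n)) (l : ℤ) (r s : ℝ) :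
    Fin S.M → EuclideanSpace ℝ (Fin n) :=
  fun k => ζ (l - ((k : ℕ) + 1)) r s

/-- The fields of the jump equation with frozen past. -/
def jumpFields (ζ : ℤ → ℝ → ℝ → EuclideanSpace ℝ (Fin n)) (l : ℤ) (r : ℝ) (j : Fin m) (s : ℝ)
    (z : EuclideanSpace ℝ (Fin n)) : EuclideanSpace ℝ (Fin n) :=
  S.g j (S.stateArg (S.time l r) z (S.pastStates ζ l r s))

theorem stateArg_pastStates (ζ : ℤ → ℝ → ℝ → EuclideanSpace ℝ (Fin n)) (t : ℝ) (l : ℤ) (r s : ℝ) :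
    (t, fun k : Fin (S.M + 1) => ζ (l - (k : ℕ)) r s) =
      S.stateArg t (ζ l r s) (S.pastStates ζ l r s) := by
  rw [stateArg]
  congr 1
  funext k
  refine Fin.cases ?_ (fun k => ?_) k
  · simp
  · simp [pastStates]

theorem jumpField_eq (ω : ℝ → ℤ → ℝ → (Fin m → ℝ))
    (ζ : ℤ → ℝ → ℝ → EuclideanSpace ℝ (Fin n)) (l : ℤ) (r : ℝ) :
    S.jumpField ω ζ l r = controlField (S.attached ω r l) (S.jumpFields ζ l r) (ζ l r) := by
  funext s
  simp only [jumpField, controlField, jumpFields, stateArg_pastStates]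

theorem exists_field_bound : ∃ C, 0 ≤ C ∧ (∀ p, ‖S.f p‖ ≤ C) ∧ ∀ j p, ‖S.g j p‖ ≤ C := by
  obtain ⟨A, hA⟩ := S.f_bounded
  choose B hB using S.g_bounded
  refine ⟨|A| + ∑ j, |B j|, by positivity, fun p => ?_, fun j p => ?_⟩
  · exact (hA p).trans ((le_abs_self A).trans (le_add_of_nonneg_right (by positivity)))
  · refine (hB j p).trans ((le_abs_self _).trans (le_trans ?_ (le_add_of_nonneg_left (abs_nonneg A))))
    exact Finset.single_le_sum (f := fun j => |B j|) (fun i _ => abs_nonneg _) (Finset.mem_univ j)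

theorem norm_stateArg_sub_le (t : ℝ) (z z' : EuclideanSpace ℝ (Fin n))
    (p : Fin S.M → EuclideanSpace ℝ (Fin n)) :
    ‖S.stateArg t z p - S.stateArg t z' p‖ ≤ ‖z - z'‖ := by
  rw [stateArg, stateArg, Prod.mk_sub_mk, Prod.norm_mk, sub_self, norm_zero]
  refine max_le (norm_nonneg _) ((pi_norm_le_iff_of_nonneg (norm_nonneg _)).mpr fun k => ?_)
  refine Fin.cases ?_ (fun k => ?_) k <;> simp

theorem norm_stateArg_le {t R : ℝ} {z : EuclideanSpace ℝ (Fin n)}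
    {p : Fin S.M → EuclideanSpace ℝ (Fin n)} (ht : |t| ≤ R) (hz : ‖z‖ ≤ R)
    (hp : ∀ k, ‖p k‖ ≤ R) : ‖S.stateArg t z p‖ ≤ R := by
  rw [stateArg, Prod.norm_mk]
  refine max_le ht ((pi_norm_le_iff_of_nonneg ((norm_nonneg _).trans hz)).mpr fun k => ?_)
  refine Fin.cases ?_ (fun k => ?_) k
  · simpa using hz
  · simpa using hp k

theorem exists_field_lipschitz (R : ℝ) : ∃ L : ℝ≥0, ∀ t z z',
    ∀ p : Fin S.M → EuclideanSpace ℝ (Fin n), |t| ≤ R → (∀ k, ‖p k‖ ≤ R) → ‖z‖ ≤ R → ‖z'‖ ≤ R →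
      ‖S.f (S.stateArg t z p) - S.f (S.stateArg t z' p)‖ ≤ L * ‖z - z'‖ ∧
      ∀ j, ‖S.g j (S.stateArg t z p) - S.g j (S.stateArg t z' p)‖ ≤ L * ‖z - z'‖ := by
  obtain ⟨A, hA⟩ := exists_lipschitz_on_ball S.f_contDiff R
  choose B hB using fun j => exists_lipschitz_on_ball (S.g_contDiff j) R
  refine ⟨A + ∑ j, B j, fun t z z' p ht hp hz hz' => ?_⟩
  have h := S.norm_stateArg_sub_le t z z' p
  have h1 := S.norm_stateArg_le ht hz hp
  have h2 := S.norm_stateArg_le ht hz' hp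
  refine ⟨(hA _ _ h1 h2).trans ?_, fun j => (hB j _ _ h1 h2).trans ?_⟩
  · gcongr
    exact le_self_add
  · gcongr
    exact (Finset.single_le_sum (f := B) (fun _ _ => zero_le) (Finset.mem_univ j)).trans
      le_add_self

theorem measurable_stateArg {α : Type*} [MeasurableSpace α] {t : α → ℝ}
    {z : α → EuclideanSpace ℝ (Fin n)} {p : α → Fin S.M → EuclideanSpace ℝ (Fin n)}
    {ρ : Measure α} (ht : AEMeasurable t ρ) (hz : AEMeasurable z ρ)
    (hp : ∀ k, AEMeasurable (fun a => p a k) ρ) :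
    AEMeasurable (fun a => S.stateArg (t a) (z a) (p a)) ρ := by
  refine ht.prodMk (aemeasurable_pi_lambda _ fun k => ?_)
  refine Fin.cases ?_ (fun k => ?_) k
  · simpa using hz
  · simpa using hp k

/-- Boundedness and measurability of the jump functions of index `l`. -/
structure IsRegular (ζ : ℤ → ℝ → ℝ → EuclideanSpace ℝ (Fin n)) (l : ℤ) : Prop where
  bdd : ∃ B, ∀ r ∈ Icc 0 S.h, ∀ s ∈ Icc (0 : ℝ) 1, ‖ζ l r s‖ ≤ B
  aemeasurable : ∀ r ∈ Icc 0 S.h, AEMeasurable (ζ l r) (volume.restrict (Ioc 0 1))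
  measurable_end : Measurable ((Ioo 0 S.h).indicator fun r => ζ l r 1)

variable {S}

theorem exists_past_bound {ζ : ℤ → ℝ → ℝ → EuclideanSpace ℝ (Fin n)} {l : ℤ}
    (hpast : ∀ k, l - S.M ≤ k → k < l → S.IsRegular ζ k) :
    ∃ B, ∀ r ∈ Icc 0 S.h, ∀ s ∈ Icc (0 : ℝ) 1, ∀ k, ‖S.pastStates ζ l r s k‖ ≤ B := by
  have h : ∀ k : Fin S.M, S.IsRegular ζ (l - ((k : ℕ) + 1)) := fun k =>
    hpast _ (by have := k.2; omega) (by omega)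
  choose B hB using fun k => (h k).bdd
  refine ⟨∑ k, |B k|, fun r hr s hs k => (hB k r hr s hs).trans ((le_abs_self _).trans ?_)⟩
  exact Finset.single_le_sum (f := fun k => |B k|) (fun i _ => abs_nonneg _) (Finset.mem_univ k)

/-- `z` solves the jump equation of index `(l, r)` with past `ζ`. -/
structure IsJumpSolution (S : DelayImpulseSystem n m) (ω : ℝ → ℤ → ℝ → (Fin m → ℝ))
    (ζ : ℤ → ℝ → ℝ → EuclideanSpace ℝ (Fin n)) (l : ℤ) (r : ℝ)
    (z : ℝ → EuclideanSpace ℝ (Fin n)) : Prop where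
  integrable : IntervalIntegrable (controlField (S.attached ω r l) (S.jumpFields ζ l r) z) volume 0 1
  equation : ∀ s ∈ Icc (0 : ℝ) 1,
    z s = z 0 + ∫ s' in (0 : ℝ)..s, controlField (S.attached ω r l) (S.jumpFields ζ l r) z s'

/-- The total mass of the attached control of index `(l, r)`. -/
noncomputable def attachedMass (S : DelayImpulseSystem n m) (ω : ℝ → ℤ → ℝ → (Fin m → ℝ)) (r : ℝ) (l : ℤ) : ℝ :=
  ∫ s in (0 : ℝ)..1, l1Norm (S.attached ω r l s)

theorem attachedMass_nonneg (ω : ℝ → ℤ → ℝ → (Fin m → ℝ)) (r : ℝ) (l : ℤ) :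
    0 ≤ S.attachedMass ω r l :=
  intervalIntegral.integral_nonneg zero_le_one fun _ _ => l1Norm_nonneg _

theorem attached_of_not {ω : ℝ → ℤ → ℝ → (Fin m → ℝ)} {r : ℝ} {l : ℤ} (h : ¬(1 ≤ l ∧ l ≤ S.N)) :
    S.attached ω r l = 0 := by
  funext s
  simp [attached, h]

theorem attached_of {ω : ℝ → ℤ → ℝ → (Fin m → ℝ)} {r : ℝ} {l : ℤ} (h1 : 1 ≤ l) (h2 : l ≤ S.N) :
    S.attached ω r l = ω r l := by
  funext s
  simp [attached, h1, h2]

/-! ### Masses of the attached controls. -/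

variable {μ : VectorMeasure ℝ (Fin m → ℝ)} {ν : Measure ℝ} {ω : ℝ → ℤ → ℝ → (Fin m → ℝ)}

theorem IsImpulseControl.integrableOn_attached (hc : S.IsImpulseControl μ ν ω) {r : ℝ}
    (hr : r ∈ Icc 0 S.h) (l : ℤ) (j : Fin m) :
    IntegrableOn (fun s => S.attached ω r l s j) (Ioc 0 1) := by
  by_cases h : 1 ≤ l ∧ l ≤ S.N
  · rw [attached_of h.1 h.2]
    have h1 := (hc.memLp r hr l h.1 h.2).integrable le_top
    have h2 : IntegrableOn (fun s => ω r l s j) (Icc 0 1) := by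
      have := (ContinuousLinearMap.proj (R := ℝ) (φ := fun _ : Fin m => ℝ) j).integrable_comp h1
      exact this
    exact h2.mono_set Ioc_subset_Icc_self
  · rw [attached_of_not h]
    exact integrableOn_zero

theorem IsImpulseControl.intervalIntegrable_attached (hc : S.IsImpulseControl μ ν ω) {r : ℝ}
    (hr : r ∈ Icc 0 S.h) (l : ℤ) :
    IntervalIntegrable (fun s => l1Norm (S.attached ω r l s)) volume 0 1 :=
  (intervalIntegrable_iff_integrableOn_Ioc_of_le zero_le_one).mpr
    (integrableOn_l1Norm (hc.integrableOn_attached hr l))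

theorem IsImpulseControl.attachedMass_interior (hc : S.IsImpulseControl μ ν ω) {r : ℝ}
    (hr : r ∈ Ioo 0 S.h) {l : ℤ} (h1 : 1 ≤ l) (h2 : l ≤ S.N) :
    S.attachedMass ω r l = ν.real {S.time l r} := by
  rw [attachedMass, attached_of h1 h2]
  exact hc.norm_interior r hr l h1 h2

theorem IsImpulseControl.attachedMass_endpoint (hc : S.IsImpulseControl μ ν ω) {l : ℤ}
    (h1 : 0 ≤ l) (h2 : l ≤ S.N) :
    S.attachedMass ω S.h l + S.attachedMass ω 0 (l + 1) = ν.real {(l : ℝ) * S.h} := by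
  rw [← hc.norm_endpoint l h1 h2, intervalIntegral.integral_add
    (hc.intervalIntegrable_attached (right_mem_Icc.mpr S.h_pos.le) l)
    (hc.intervalIntegrable_attached (left_mem_Icc.mpr S.h_pos.le) (l + 1))]
  rfl

/-- Inside a step this is an equality. At an instant lh the atom of ν is shared between ω^h_l and
ω^0_{l+1}, and each share is nonnegative. -/
theorem IsImpulseControl.attachedMass_le (hc : S.IsImpulseControl μ ν ω) {r : ℝ}
    (hr : r ∈ Icc 0 S.h) {l : ℤ} (h1 : 1 ≤ l) (h2 : l ≤ S.N) :
    S.attachedMass ω r l ≤ ν.real {S.time l r} := by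
  rcases hr.1.eq_or_lt with rfl | h0
  · have := hc.attachedMass_endpoint (l := l - 1) (by omega) (by omega)
    have h3 := S.attachedMass_nonneg ω S.h (l - 1)
    rw [sub_add_cancel] at this
    push_cast at this
    rw [time, zero_add]
    linarith
  rcases hr.2.eq_or_lt with rfl | hh
  · have := hc.attachedMass_endpoint (l := l) (by omega) (by omega)
    have h3 := S.attachedMass_nonneg ω 0 (l + 1)
    have h4 : S.time l S.h = l * S.h := by rw [time]; ring
    rw [h4]
    linarith
  · exact (hc.attachedMass_interior ⟨h0, hh⟩ h1 h2).le

/-! ### Existence and Lipschitz dependence for one jump equation. -/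

theorem IsJumpSolution.norm_sub_le (hc : S.IsImpulseControl μ ν ω) {C : ℝ} (hC0 : 0 ≤ C)
    (hC : ∀ j p, ‖S.g j p‖ ≤ C) {ζ : ℤ → ℝ → ℝ → EuclideanSpace ℝ (Fin n)} {l : ℤ} {r : ℝ}
    (hr : r ∈ Icc 0 S.h) {z : ℝ → EuclideanSpace ℝ (Fin n)} (hz : S.IsJumpSolution ω ζ l r z)
    {s : ℝ} (hs : s ∈ Icc (0 : ℝ) 1) : ‖z s - z 0‖ ≤ C * S.attachedMass ω r l := by
  rw [hz.equation s hs, add_sub_cancel_left]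
  exact norm_integral_controlField_le (hc.integrableOn_attached hr l) hC0 (fun j s z => hC j _) _ hs

/-- The integrals do not see s = 1, the point where the prescribed ζ^h_0 passes from ξ₀(0) to the
initial point. -/
theorem IsJumpSolution.congr {ζ ζ' : ℤ → ℝ → ℝ → EuclideanSpace ℝ (Fin n)} {l : ℤ} {r : ℝ}
    {z z' : ℝ → EuclideanSpace ℝ (Fin n)} (hz : S.IsJumpSolution ω ζ l r z)
    (hzz : EqOn z z' (Icc 0 1))
    (h : ∀ s ∈ Ico (0 : ℝ) 1, S.pastStates ζ l r s = S.pastStates ζ' l r s) :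
    S.IsJumpSolution ω ζ' l r z' := by
  have heq : ∀ s ∈ Ico (0 : ℝ) 1,
      controlField (S.attached ω r l) (S.jumpFields ζ l r) z s =
      controlField (S.attached ω r l) (S.jumpFields ζ' l r) z' s := by
    intro s hs
    simp only [controlField, jumpFields, h s hs, hzz (Ico_subset_Icc_self hs)]
  have hae : ∀ᵐ s : ℝ, s ≠ 1 := by simp [ae_iff]
  constructor
  · refine hz.integrable.congr_ae ?_
    rw [uIoc_of_le zero_le_one, Filter.EventuallyEq, ae_restrict_iff' measurableSet_Ioc]
    filter_upwards [hae] with s hs1 hs using heq s ⟨hs.1.le, hs.2.lt_of_ne hs1⟩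
  · intro s hs
    rw [← hzz hs, ← hzz (left_mem_Icc.mpr zero_le_one), hz.equation s hs]
    congr 1
    refine intervalIntegral.integral_congr_ae ?_
    rw [uIoc_of_le hs.1]
    filter_upwards [hae] with x hx1 hx using heq x ⟨hx.1.le, (hx.2.trans hs.2).lt_of_ne hx1⟩

theorem abs_time_le {l : ℤ} (h1 : 1 ≤ l) (h2 : l ≤ S.N) {r : ℝ} (hr : r ∈ Icc 0 S.h) :
    |S.time l r| ≤ S.T := by
  have h3 : (1 : ℝ) ≤ l := by exact_mod_cast h1
  have h4 : (l : ℝ) ≤ S.N := by exact_mod_cast h2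
  have hh := S.h_pos
  rw [time, T, abs_of_nonneg (add_nonneg hr.1 (mul_nonneg (by linarith) hh.le))]
  nlinarith [hr.2]

theorem IsImpulseControl.exists_jumpSolution (hc : S.IsImpulseControl μ ν ω)
    {ζ : ℤ → ℝ → ℝ → EuclideanSpace ℝ (Fin n)} {l : ℤ} (h1 : 1 ≤ l) (h2 : l ≤ S.N)
    (hpast : ∀ k, l - S.M ≤ k → k < l → S.IsRegular ζ k) {r : ℝ} (hr : r ∈ Icc 0 S.h)
    (z₀ : EuclideanSpace ℝ (Fin n)) :
    ∃ z, Measurable z ∧ z 0 = z₀ ∧ S.IsJumpSolution ω ζ l r z := by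
  obtain ⟨C, hC0, -, hC⟩ := S.exists_field_bound
  obtain ⟨B, hB⟩ := exists_past_bound hpast
  obtain ⟨z, hz, hz0, hi, he⟩ := exists_controlField_solution (hc.integrableOn_attached hr l)
    (G := S.jumpFields ζ l r) hC0 (fun j s z => hC j _)
    (fun j y hy => by
      refine ((S.g_contDiff j).continuous.comp_aestronglyMeasurable
        (AEMeasurable.aestronglyMeasurable ?_))
      refine S.measurable_stateArg aemeasurable_const hy.aemeasurable fun k => ?_
      exact (hpast _ (by have := k.2; omega) (by omega)).aemeasurable r hr)
    (fun R => by
      obtain ⟨L, hL⟩ := S.exists_field_lipschitz (max R (max B S.T))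
      refine ⟨L, fun j s hs a b ha hb => ?_⟩
      exact (hL (S.time l r) a b (S.pastStates ζ l r s)
        ((abs_time_le h1 h2 hr).trans ((le_max_right _ _).trans (le_max_right _ _)))
        (fun k => (hB r hr s hs k).trans ((le_max_left _ _).trans (le_max_right _ _)))
        (ha.trans (le_max_left _ _)) (hb.trans (le_max_left _ _))).2 j) z₀
  exact ⟨z, hz, hz0, hi, fun s hs => by rw [hz0]; exact he s hs⟩

/-- Gronwall's inequality controls the distance between two solutions; integrating that control once
more against L‖ω‖ ds bounds the difference of the increments by the mass of the control. This extra
factor makes the sum over infinitely many jump times a convergent part of the Volterra estimate. -/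
theorem IsImpulseControl.exists_jump_lipschitz (hc : S.IsImpulseControl μ ν ω)
    {ζ : ℤ → ℝ → ℝ → EuclideanSpace ℝ (Fin n)} {l : ℤ} (h1 : 1 ≤ l) (h2 : l ≤ S.N)
    (hpast : ∀ k, l - S.M ≤ k → k < l → S.IsRegular ζ k) (R : ℝ) :
    ∃ K : ℝ≥0, ∀ r ∈ Icc 0 S.h, ∀ y z, S.IsJumpSolution ω ζ l r y → S.IsJumpSolution ω ζ l r z →
      ‖y 0‖ ≤ R → ‖z 0‖ ≤ R →
      (∀ s ∈ Icc (0 : ℝ) 1, edist (y s) (z s) ≤ K * edist (y 0) (z 0)) ∧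
      edist (y 1 - y 0) (z 1 - z 0) ≤
        K * edist (y 0) (z 0) * ENNReal.ofReal (S.attachedMass ω r l) := by
  have := hc.memVc.finite
  obtain ⟨C, hC0, -, hC⟩ := S.exists_field_bound
  obtain ⟨B, hB⟩ := exists_past_bound hpast
  set Q : ℝ := ν.real univ with hQ
  set R' : ℝ := max (R + C * Q) (max B S.T) with hR'
  obtain ⟨L, hL⟩ := S.exists_field_lipschitz R'
  -- The Gronwall constant with the mass of the control replaced by ν(ℝ), hence independent of r.
  -- The increments then cost K₁ * L.
  set K₁ : ℝ≥0 := 2 * (Real.exp (2 * (L * Q))).toNNReal with hK₁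
  refine ⟨K₁ + K₁ * L, fun r hr y z hy hz hyR hzR => ?_⟩
  have hmass : S.attachedMass ω r l ≤ Q := (hc.attachedMass_le hr h1 h2).trans
    (measureReal_mono (subset_univ _))
  have hbound : ∀ u, S.IsJumpSolution ω ζ l r u → ‖u 0‖ ≤ R → ∀ s ∈ Icc (0 : ℝ) 1, ‖u s‖ ≤ R' := by
    intro u hu huR s hs
    calc ‖u s‖ = ‖u 0 + (u s - u 0)‖ := by rw [add_sub_cancel]
      _ ≤ ‖u 0‖ + ‖u s - u 0‖ := norm_add_le _ _
      _ ≤ R + C * Q := add_le_add huR ((hu.norm_sub_le hc hC0 hC hr hs).trans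
        (mul_le_mul_of_nonneg_left hmass hC0))
      _ ≤ R' := le_max_left _ _
  have hlip : ∀ j, ∀ s ∈ Icc (0 : ℝ) 1, ∀ a b, ‖a‖ ≤ R' → ‖b‖ ≤ R' →
      ‖S.jumpFields ζ l r j s a - S.jumpFields ζ l r j s b‖ ≤ L * ‖a - b‖ := fun j s hs a b ha hb =>
    (hL (S.time l r) a b (S.pastStates ζ l r s)
      ((abs_time_le h1 h2 hr).trans ((le_max_right _ _).trans (le_max_right _ _)))
      (fun k => (hB r hr s hs k).trans ((le_max_left _ _).trans (le_max_right _ _))) ha hb).2 j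
  have hdep : ∀ s ∈ Icc (0 : ℝ) 1, edist (y s) (z s) ≤ K₁ * edist (y 0) (z 0) := by
    intro s hs
    refine (edist_controlField_solution_le (hc.integrableOn_attached hr l) hlip (hbound y hy hyR)
      (hbound z hz hzR) hy.integrable hz.integrable hy.equation hz.equation hs).trans ?_
    rw [hK₁, mul_right_comm]
    push_cast
    rw [← ENNReal.ofReal]
    gcongr
    exact hmass
  refine ⟨fun s hs => (hdep s hs).trans ?_, ?_⟩
  · gcongr
    exact le_self_add
  · have hone : (1 : ℝ) ∈ Icc (0 : ℝ) 1 := right_mem_Icc.mpr zero_le_one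
    have heq : ∀ u, S.IsJumpSolution ω ζ l r u → u 1 - u 0 =
        ∫ s in (0 : ℝ)..1, controlField (S.attached ω r l) (S.jumpFields ζ l r) u s := by
      intro u hu
      rw [hu.equation 1 hone, add_sub_cancel_left]
    rw [heq y hy, heq z hz, edist_eq_enorm_sub,
      ← intervalIntegral.integral_sub hy.integrable hz.integrable]
    refine (enorm_integral_controlField_sub_le (hc.integrableOn_attached hr l) (L := L)
      (φ := fun _ => K₁ * edist (y 0) (z 0)) (fun j s hs => ?_)
      (fun s hs => hdep s (Ioc_subset_Icc_self hs)) hone).trans ?_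
    · have hs' := Ioc_subset_Icc_self hs
      exact hlip j s hs' _ _ (hbound y hy hyR s hs') (hbound z hz hzR s hs')
    · rw [setLIntegral_const]
      calc _ ≤ K₁ * edist (y 0) (z 0) * controlMeasure (S.attached ω r l) L univ := by
            gcongr
            exact subset_univ _
        _ = ((K₁ * L : ℝ≥0) : ℝ≥0∞) * edist (y 0) (z 0) *
              ENNReal.ofReal (S.attachedMass ω r l) := by
            rw [controlMeasure_univ (hc.integrableOn_attached hr l),
              ENNReal.ofReal_mul L.coe_nonneg, ENNReal.ofReal_coe_nnreal, attachedMass]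
            push_cast
            ring
        _ ≤ _ := by
            gcongr
            exact le_add_self

end DelayImpulseSystem

/-! ### One step of the delay system -/

namespace DelayImpulseSystem

variable {n m : ℕ} (S : DelayImpulseSystem n m)

/-- The integral of the dynamics of step `l` over `A`, with jumps `ζ(1) - ζ(0)`. -/
noncomputable def flowDrive (μ : VectorMeasure ℝ (Fin m → ℝ))
    (ζ : ℤ → ℝ → ℝ → EuclideanSpace ℝ (Fin n)) (l : ℤ) (A : Set ℝ) : EuclideanSpace ℝ (Fin n) :=
  drive (fun j => coordMeasure (contPart μ) j)
    (fun t => S.f (S.stateArg t (ζ l (t - (l - 1) * S.h) 1)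
      (S.pastStates ζ l (t - (l - 1) * S.h) 1)))
    (fun j t => S.g j (S.stateArg t (ζ l (t - (l - 1) * S.h) 1)
      (S.pastStates ζ l (t - (l - 1) * S.h) 1)))
    (fun t => ζ l (t - (l - 1) * S.h) 1 - ζ l (t - (l - 1) * S.h) 0) A

/-- The jump functions of index `l` encode the solution on `[(l-1)h, lh[`. -/
structure IsFlowStep (μ : VectorMeasure ℝ (Fin m → ℝ)) (ω : ℝ → ℤ → ℝ → (Fin m → ℝ))
    (ζ : ℤ → ℝ → ℝ → EuclideanSpace ℝ (Fin n)) (l : ℤ) : Prop where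
  init : ζ l 0 0 = ζ (l - 1) S.h 1
  jump : ∀ r ∈ Icc 0 S.h, S.IsJumpSolution ω ζ l r (ζ l r)
  flow : ∀ t ∈ Ioc (((l : ℝ) - 1) * S.h) (l * S.h),
    ζ l (t - (l - 1) * S.h) 0 = ζ l 0 1 + S.flowDrive μ ζ l (Ioo ((l - 1) * S.h) t)

variable {S} {μ : VectorMeasure ℝ (Fin m → ℝ)} {ν : Measure ℝ} {ω : ℝ → ℤ → ℝ → (Fin m → ℝ)}

theorem sub_start_mem_Ioo {l : ℤ} {t : ℝ} :
    t - ((l : ℝ) - 1) * S.h ∈ Ioo 0 S.h ↔ t ∈ Ioo (((l : ℝ) - 1) * S.h) (l * S.h) := by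
  simp only [mem_Ioo]
  constructor <;> rintro ⟨h1, h2⟩ <;> constructor <;> linarith

theorem sub_start_mem_Ioc {l : ℤ} {t : ℝ} :
    t - ((l : ℝ) - 1) * S.h ∈ Ioc 0 S.h ↔ t ∈ Ioc (((l : ℝ) - 1) * S.h) (l * S.h) := by
  simp only [mem_Ioc]
  constructor <;> rintro ⟨h1, h2⟩ <;> constructor <;> linarith

theorem time_sub_start (l : ℤ) (t : ℝ) : S.time l (t - ((l : ℝ) - 1) * S.h) = t := by
  rw [time]
  ring

theorem Ioc_step_subset {l : ℤ} (h1 : 1 ≤ l) (h2 : l ≤ S.N) :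
    Ioc (((l : ℝ) - 1) * S.h) (l * S.h) ⊆ Ioc 0 S.T := by
  have h3 : (1 : ℝ) ≤ l := by exact_mod_cast h1
  have h4 : (l : ℝ) ≤ S.N := by exact_mod_cast h2
  refine Ioc_subset_Ioc (mul_nonneg (by linarith) S.h_pos.le) ?_
  exact mul_le_mul_of_nonneg_right h4 S.h_pos.le

theorem measurable_indicator_comp_stateArg {ζ : ℤ → ℝ → ℝ → EuclideanSpace ℝ (Fin n)} {l : ℤ}
    (hpast : ∀ k, l - S.M ≤ k → k < l → Measurable ((Ioo 0 S.h).indicator fun r => ζ k r 1))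
    {H : ℝ × (Fin (S.M + 1) → EuclideanSpace ℝ (Fin n)) → EuclideanSpace ℝ (Fin n)}
    (hH : Continuous H) {x : ℝ → EuclideanSpace ℝ (Fin n)} (hx : Measurable x) :
    Measurable ((Ioo (((l : ℝ) - 1) * S.h) (l * S.h)).indicator fun t =>
      H (S.stateArg t (x t) (S.pastStates ζ l (t - (l - 1) * S.h) 1))) := by
  have hm : Measurable fun t => H (S.stateArg t (x t) fun k =>
      (Ioo 0 S.h).indicator (fun r => ζ (l - ((k : ℕ) + 1)) r 1) (t - (l - 1) * S.h)) := by
    refine hH.measurable.comp (Measurable.prodMk measurable_id (measurable_pi_lambda _ fun k => ?_))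
    refine Fin.cases ?_ (fun k => ?_) k
    · simpa using hx
    · have := (hpast (l - ((k : ℕ) + 1)) (by have := k.2; omega) (by omega)).comp
        (measurable_id.sub_const (((l : ℝ) - 1) * S.h))
      simp only [Fin.cons_succ]
      exact this
  convert hm.indicator (measurableSet_Ioo (a := ((l : ℝ) - 1) * S.h) (b := l * S.h)) using 1
  refine indicator_congr fun t ht => ?_
  congr 2
  funext k
  exact (indicator_of_mem (sub_start_mem_Ioo.mpr ht)
    (fun r => ζ (l - ((k : ℕ) + 1)) r 1)).symm

/-- `Z r y` is an arbitrary choice of solution of the jump equation from y, with no regularity in r.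
The bounds hold because the mass of the attached control is at most the atom of ν at that time. -/
theorem IsImpulseControl.isStep (hc : S.IsImpulseControl μ ν ω) {C : ℝ} (hC0 : 0 ≤ C)
    (hf : ∀ p, ‖S.f p‖ ≤ C) (hg : ∀ j p, ‖S.g j p‖ ≤ C)
    {ζ : ℤ → ℝ → ℝ → EuclideanSpace ℝ (Fin n)} {l : ℤ} (h1 : 1 ≤ l) (h2 : l ≤ S.N)
    (hpast : ∀ k, l - S.M ≤ k → k < l → S.IsRegular ζ k)
    {Z : ℝ → EuclideanSpace ℝ (Fin n) → ℝ → EuclideanSpace ℝ (Fin n)}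
    (hZ0 : ∀ r ∈ Icc 0 S.h, ∀ y, Z r y 0 = y)
    (hZ : ∀ r ∈ Icc 0 S.h, ∀ y, S.IsJumpSolution ω ζ l r (Z r y)) :
    IsStep (fun j => coordMeasure (contPart μ) j) ν S.T (((l : ℝ) - 1) * S.h) (l * S.h) C
      (fun t x => S.f (S.stateArg t x (S.pastStates ζ l (t - (l - 1) * S.h) 1)))
      (fun j t x => S.g j (S.stateArg t x (S.pastStates ζ l (t - (l - 1) * S.h) 1)))
      (fun t y => Z (t - (l - 1) * S.h) y 1) := by
  have := hc.memVc.finite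
  have hone : (1 : ℝ) ∈ Icc (0 : ℝ) 1 := right_mem_Icc.mpr zero_le_one
  have hmem : ∀ t ∈ Ioo (((l : ℝ) - 1) * S.h) (l * S.h), t - ((l : ℝ) - 1) * S.h ∈ Icc 0 S.h :=
    fun t ht => Ioo_subset_Icc_self (sub_start_mem_Ioo.mpr ht)
  have harg : ∀ H : ℝ × (Fin (S.M + 1) → EuclideanSpace ℝ (Fin n)) → EuclideanSpace ℝ (Fin n),
      Continuous H → ∀ x : ℝ → EuclideanSpace ℝ (Fin n), Measurable x →
      Measurable ((Ioo (((l : ℝ) - 1) * S.h) (l * S.h)).indicator fun t =>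
        H (S.stateArg t (x t) (S.pastStates ζ l (t - (l - 1) * S.h) 1))) := fun H hH x hx =>
    measurable_indicator_comp_stateArg (fun k hk hkl => (hpast k hk hkl).measurable_end) hH hx
  refine ⟨?_, hC0, fun t x => hf _, fun j t x => hg j _, harg _ S.f_contDiff.continuous,
    fun j => harg _ (S.g_contDiff j).continuous, fun R => ?_, fun t ht y => ?_, fun R => ?_⟩
  · exact (Ioo_subset_Ioc_self.trans (Ioc_step_subset h1 h2)).trans Ioc_subset_Icc_self
  · obtain ⟨B, hB⟩ := exists_past_bound hpast
    obtain ⟨L, hL⟩ := S.exists_field_lipschitz (max R (max B S.T))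
    refine ⟨L, fun t ht x x' hx hx' => ?_⟩
    refine hL t x x' _ ?_ (fun k => ?_) (hx.trans (le_max_left _ _)) (hx'.trans (le_max_left _ _))
    · have := abs_time_le h1 h2 (hmem t ht)
      rw [time_sub_start] at this
      exact this.trans ((le_max_right _ _).trans (le_max_right _ _))
    · exact (hB _ (hmem t ht) 1 hone k).trans ((le_max_left _ _).trans (le_max_right _ _))
  · have h := (hZ _ (hmem t ht) y).norm_sub_le hc hC0 hg (hmem t ht) hone
    rw [hZ0 _ (hmem t ht)] at h
    refine h.trans (mul_le_mul_of_nonneg_left ?_ hC0)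
    have := hc.attachedMass_le (hmem t ht) h1 h2
    rwa [time_sub_start] at this
  · obtain ⟨K, hK⟩ := hc.exists_jump_lipschitz h1 h2 hpast R
    refine ⟨K, fun t ht y y' hy hy' => ?_⟩
    have h := hK _ (hmem t ht) _ _ (hZ _ (hmem t ht) y) (hZ _ (hmem t ht) y')
      (by rwa [hZ0 _ (hmem t ht)]) (by rwa [hZ0 _ (hmem t ht)])
    rw [hZ0 _ (hmem t ht), hZ0 _ (hmem t ht)] at h
    refine ⟨h.1 1 hone, h.2.trans ?_⟩
    gcongr
    refine (ENNReal.ofReal_le_ofReal (hc.attachedMass_le (hmem t ht) h1 h2)).trans (le_of_eq ?_)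
    rw [time_sub_start, ofReal_measureReal (measure_ne_top ν _)]

theorem pastStates_update (ζ : ℤ → ℝ → ℝ → EuclideanSpace ℝ (Fin n)) (l : ℤ)
    (d : ℝ → ℝ → EuclideanSpace ℝ (Fin n)) :
    S.pastStates (Function.update ζ l d) l = S.pastStates ζ l := by
  funext r s k
  rw [pastStates, pastStates, Function.update_of_ne (by omega)]

theorem flowDrive_eq_stepDrive {ζ : ℤ → ℝ → ℝ → EuclideanSpace ℝ (Fin n)}
    {p : ℝ → Fin S.M → EuclideanSpace ℝ (Fin n)} {l : ℤ}
    {X : ℝ → EuclideanSpace ℝ (Fin n) → EuclideanSpace ℝ (Fin n)}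
    {y : ℝ → EuclideanSpace ℝ (Fin n)} {A : Set ℝ} (hA : MeasurableSet A)
    (hp : ∀ t ∈ A, S.pastStates ζ l (t - (l - 1) * S.h) 1 = p t)
    (hy : ∀ t ∈ A, ζ l (t - (l - 1) * S.h) 0 = y t)
    (hX : ∀ t ∈ A, ζ l (t - (l - 1) * S.h) 1 = X t (y t)) :
    S.flowDrive μ ζ l A = stepDrive (fun j => coordMeasure (contPart μ) j)
      (fun t x => S.f (S.stateArg t x (p t))) (fun j t x => S.g j (S.stateArg t x (p t))) X y A := by
  refine drive_congr (coordMeasure_contPart_singleton μ) hA countable_empty (fun t ht _ => ?_)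
    (fun j t ht _ => ?_) (fun t ht => ?_)
  · simp only [hp t ht, hX t ht]
  · simp only [hp t ht, hX t ht]
  · simp only [hy t ht, hX t ht]

/-- The step equation is solved for the left limits, and at each time the jump function is started
from the left limit found. Regularity is proved along with it because the next steps use these
functions as their past. -/
theorem IsImpulseControl.exists_flowStep (hc : S.IsImpulseControl μ ν ω)
    {ζ : ℤ → ℝ → ℝ → EuclideanSpace ℝ (Fin n)} {l : ℤ} (h1 : 1 ≤ l) (h2 : l ≤ S.N)
    (hpast : ∀ k, l - S.M ≤ k → k < l → S.IsRegular ζ k) :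
    ∃ d : ℝ → ℝ → EuclideanSpace ℝ (Fin n), S.IsFlowStep μ ω (Function.update ζ l d) l ∧
      S.IsRegular (Function.update ζ l d) l := by
  have := hc.memVc.finite
  have hone : (1 : ℝ) ∈ Icc (0 : ℝ) 1 := right_mem_Icc.mpr zero_le_one
  obtain ⟨C, hC0, hf, hg⟩ := S.exists_field_bound
  have hex : ∀ r y, ∃ z, r ∈ Icc 0 S.h → Measurable z ∧ z 0 = y ∧ S.IsJumpSolution ω ζ l r z := by
    intro r y
    by_cases hr : r ∈ Icc 0 S.h
    · obtain ⟨z, hz⟩ := hc.exists_jumpSolution h1 h2 hpast hr y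
      exact ⟨z, fun _ => hz⟩
    · exact ⟨0, fun h => absurd h hr⟩
  choose Z hZ using hex
  have hstep := hc.isStep hC0 hf hg h1 h2 hpast (fun r hr y => (hZ r y hr).2.1)
    (fun r hr y => (hZ r y hr).2.2)
  obtain ⟨y, hym, ⟨R, hyR⟩, hy⟩ := hstep.exists_solution (Z 0 (ζ (l - 1) S.h 1) 1)
  -- Initial values of the jump functions. At r = 0 the jump continues from ζ^h_{l-1}(1), the first
  -- part of the jump at the same instant; for r > 0 it starts from the left limit y.
  set v : ℝ → EuclideanSpace ℝ (Fin n) := fun r =>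
    if r = 0 then ζ (l - 1) S.h 1 else y (r + (l - 1) * S.h) with hv
  have hv0 : v 0 = ζ (l - 1) S.h 1 := if_pos rfl
  have hvt : ∀ t ∈ Ioc (((l : ℝ) - 1) * S.h) (l * S.h), v (t - (l - 1) * S.h) = y t := by
    intro t ht
    simp only [hv]
    rw [if_neg (by have := ht.1; intro h; linarith), sub_add_cancel]
  have hd : ∀ r, Function.update ζ l (fun r => Z r (v r)) l r = Z r (v r) := fun r => by simp
  have hsol : ∀ r ∈ Icc 0 S.h,
      S.IsJumpSolution ω (Function.update ζ l (fun r => Z r (v r))) l r (Z r (v r)) := fun r hr =>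
    ((hZ r (v r) hr).2.2).congr (eqOn_refl _ _) fun s _ => by rw [pastStates_update]
  have hmem : ∀ t ∈ Ioc (((l : ℝ) - 1) * S.h) (l * S.h), t - ((l : ℝ) - 1) * S.h ∈ Icc 0 S.h :=
    fun t ht => Ioc_subset_Icc_self (sub_start_mem_Ioc.mpr ht)
  refine ⟨fun r => Z r (v r), ⟨?_, fun r hr => ?_, fun t ht => ?_⟩, ⟨?_, fun r hr => ?_, ?_⟩⟩
  · rw [hd, (hZ 0 _ (left_mem_Icc.mpr S.h_pos.le)).2.1, Function.update_of_ne (by omega), hv0]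
  · rw [hd]
    exact hsol r hr
  · rw [hd, hd, (hZ _ _ (hmem t ht)).2.1, hvt t ht, hy t ht, hv0]
    congr 1
    symm
    have hI : ∀ t' ∈ Ioo (((l : ℝ) - 1) * S.h) t, t' ∈ Ioc (((l : ℝ) - 1) * S.h) (l * S.h) :=
      fun t' ht' => ⟨ht'.1, ht'.2.le.trans ht.2⟩
    refine flowDrive_eq_stepDrive measurableSet_Ioo (fun t' _ => by rw [pastStates_update])
      (fun t' ht' => ?_) (fun t' ht' => ?_)
    · rw [hd, (hZ _ _ (hmem t' (hI t' ht'))).2.1, hvt t' (hI t' ht')]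
    · rw [hd, hvt t' (hI t' ht')]
  · refine ⟨max ‖ζ (l - 1) S.h 1‖ R + C * ν.real univ, fun r hr s hs => ?_⟩
    have h3 := (hsol r hr).norm_sub_le hc hC0 hg hr hs
    rw [(hZ r _ hr).2.1] at h3
    have h4 : ‖v r‖ ≤ max ‖ζ (l - 1) S.h 1‖ R := by
      simp only [hv]
      split_ifs
      · exact le_max_left _ _
      · exact (hyR _).trans (le_max_right _ _)
    have h5 : S.attachedMass ω r l ≤ ν.real univ := (hc.attachedMass_le hr h1 h2).trans
      (measureReal_mono (subset_univ _))
    rw [hd]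
    calc ‖Z r (v r) s‖ = ‖v r + (Z r (v r) s - v r)‖ := by rw [add_sub_cancel]
      _ ≤ ‖v r‖ + ‖Z r (v r) s - v r‖ := norm_add_le _ _
      _ ≤ _ := add_le_add h4 (h3.trans (mul_le_mul_of_nonneg_left h5 hC0))
  · rw [hd]
    exact (hZ r _ hr).1.aemeasurable
  · have h3 := (hstep.measurable_jump (measurable_indicator_Ioo hym)).comp
      (measurable_id.add_const (((l : ℝ) - 1) * S.h))
    convert h3 using 1
    funext r
    simp only [Function.comp, id, indicator_apply, hd]
    have hiff : r ∈ Ioo 0 S.h ↔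
        r + ((l : ℝ) - 1) * S.h ∈ Ioo (((l : ℝ) - 1) * S.h) (l * S.h) := by
      rw [← sub_start_mem_Ioo, add_sub_cancel_right]
    by_cases hr : r ∈ Ioo 0 S.h
    · rw [if_pos hr, if_pos (hiff.mp hr), add_sub_cancel_right, ← hvt _
        (Ioo_subset_Ioc_self (hiff.mp hr)), add_sub_cancel_right]
    · rw [if_neg hr, if_neg (fun h => hr (hiff.mpr h))]

/-- With a common past, both families of initial values ζ^r_l(0) solve the same step equation, so
they agree for r > 0; at r = 0 they agree by hypothesis. A jump function is determined by its
initial value. -/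
theorem IsImpulseControl.flowStep_unique (hc : S.IsImpulseControl μ ν ω)
    {ζ ζ' : ℤ → ℝ → ℝ → EuclideanSpace ℝ (Fin n)} {l : ℤ} (h1 : 1 ≤ l) (h2 : l ≤ S.N)
    (hreg : ∀ k, l - S.M ≤ k → k ≤ l → S.IsRegular ζ k) (hreg' : S.IsRegular ζ' l)
    (hζ : S.IsFlowStep μ ω ζ l) (hζ' : S.IsFlowStep μ ω ζ' l)
    (hinit : ζ (l - 1) S.h 1 = ζ' (l - 1) S.h 1)
    (hpast : ∀ k, l - S.M ≤ k → k < l → ∀ r ∈ Icc 0 S.h, EqOn (ζ k r) (ζ' k r) (Icc 0 1)) :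
    ∀ r ∈ Icc 0 S.h, EqOn (ζ l r) (ζ' l r) (Icc 0 1) := by
  have := hc.memVc.finite
  have hone : (1 : ℝ) ∈ Icc (0 : ℝ) 1 := right_mem_Icc.mpr zero_le_one
  have hzero : (0 : ℝ) ∈ Icc (0 : ℝ) 1 := left_mem_Icc.mpr zero_le_one
  have hr0 : (0 : ℝ) ∈ Icc 0 S.h := left_mem_Icc.mpr S.h_pos.le
  obtain ⟨C, hC0, hf, hg⟩ := S.exists_field_bound
  have hregp : ∀ k, l - S.M ≤ k → k < l → S.IsRegular ζ k := fun k hk hkl => hreg k hk hkl.le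
  have hps : ∀ r ∈ Icc 0 S.h, ∀ s ∈ Icc (0 : ℝ) 1, S.pastStates ζ' l r s = S.pastStates ζ l r s :=
    fun r hr s hs => funext fun k =>
      (hpast _ (by have := k.2; omega) (by omega) r hr hs).symm
  have hjump' : ∀ r ∈ Icc 0 S.h, S.IsJumpSolution ω ζ l r (ζ' l r) := fun r hr =>
    (hζ'.jump r hr).congr (eqOn_refl _ _) fun s hs => hps r hr s (Ico_subset_Icc_self hs)
  have huniq : ∀ r ∈ Icc 0 S.h, ∀ u w, S.IsJumpSolution ω ζ l r u → S.IsJumpSolution ω ζ l r w →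
      u 0 = w 0 → EqOn u w (Icc 0 1) := by
    intro r hr u w hu hw huw s hs
    obtain ⟨K, hK⟩ := hc.exists_jump_lipschitz h1 h2 hregp (max ‖u 0‖ ‖w 0‖)
    have h := (hK r hr u w hu hw (le_max_left _ _) (le_max_right _ _)).1 s hs
    rw [huw, edist_self, mul_zero] at h
    exact edist_le_zero.mp h
  have hex : ∀ r y, ∃ z, r ∈ Icc 0 S.h → z 0 = y ∧ S.IsJumpSolution ω ζ l r z := by
    intro r y
    by_cases hr : r ∈ Icc 0 S.h
    · obtain ⟨z, -, hz⟩ := hc.exists_jumpSolution h1 h2 hregp hr y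
      exact ⟨z, fun _ => hz⟩
    · exact ⟨0, fun h => absurd h hr⟩
  choose Z hZ using hex
  have hstep := hc.isStep hC0 hf hg h1 h2 hregp (fun r hr y => (hZ r y hr).1)
    (fun r hr y => (hZ r y hr).2)
  have hmem : ∀ t ∈ Ioc (((l : ℝ) - 1) * S.h) (l * S.h), t - ((l : ℝ) - 1) * S.h ∈ Icc 0 S.h :=
    fun t ht => Ioc_subset_Icc_self (sub_start_mem_Ioc.mpr ht)
  have hstart : ζ l 0 1 = ζ' l 0 1 :=
    huniq 0 hr0 _ _ (hζ.jump 0 hr0) (hjump' 0 hr0) (by rw [hζ.init, hζ'.init, hinit]) hone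
  -- Regularity concerns the values after jumps; those before jumps differ from them only at atoms
  -- of ν, which are countably many.
  have hmeas : ∀ u : ℤ → ℝ → ℝ → EuclideanSpace ℝ (Fin n), S.IsRegular u l →
      (∀ r ∈ Icc 0 S.h, S.IsJumpSolution ω ζ l r (u l r)) →
      Measurable ((Ioo (((l : ℝ) - 1) * S.h) (l * S.h)).indicator
        fun t => u l (t - (l - 1) * S.h) 0) := by
    intro u hu hju
    have h3 := hu.measurable_end.comp (measurable_id.sub_const (((l : ℝ) - 1) * S.h))
    refine h3.measurable_of_countable_ne
      ((summable_measureReal_singleton ν).countable_support.mono fun t ht => ?_)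
    simp only [mem_ofPred_eq, ne_eq, Function.comp, id] at ht
    by_cases hI : t ∈ Ioo (((l : ℝ) - 1) * S.h) (l * S.h)
    · rw [indicator_of_mem hI, indicator_of_mem (sub_start_mem_Ioo.mpr hI)] at ht
      intro h0
      simp only at h0
      have hI' := hmem t (Ioo_subset_Ioc_self hI)
      have h4 := hc.attachedMass_le hI' h1 h2
      rw [time_sub_start, h0] at h4
      have h5 := (hju _ hI').norm_sub_le hc hC0 hg hI' hone
      rw [le_antisymm h4 (attachedMass_nonneg _ _ _), mul_zero] at h5
      exact ht (sub_eq_zero.mp (norm_le_zero_iff.mp h5))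
    · rw [indicator_of_notMem hI, indicator_of_notMem (fun h => hI (sub_start_mem_Ioo.mp h))] at ht
      exact absurd rfl ht
  obtain ⟨B, hB⟩ := (hreg l (by omega) le_rfl).bdd
  obtain ⟨B', hB'⟩ := hreg'.bdd
  have hflow : ∀ u : ℤ → ℝ → ℝ → EuclideanSpace ℝ (Fin n),
      (∀ r ∈ Icc 0 S.h, ∀ s ∈ Icc (0 : ℝ) 1, S.pastStates u l r s = S.pastStates ζ l r s) →
      (∀ r ∈ Icc 0 S.h, S.IsJumpSolution ω ζ l r (u l r)) → S.IsFlowStep μ ω u l →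
      ∀ t ∈ Ioc (((l : ℝ) - 1) * S.h) (l * S.h), u l (t - (l - 1) * S.h) 0 = u l 0 1 +
        stepDrive (fun j => coordMeasure (contPart μ) j)
          (fun t x => S.f (S.stateArg t x (S.pastStates ζ l (t - (l - 1) * S.h) 1)))
          (fun j t x => S.g j (S.stateArg t x (S.pastStates ζ l (t - (l - 1) * S.h) 1)))
          (fun t y => Z (t - (l - 1) * S.h) y 1) (fun t => u l (t - (l - 1) * S.h) 0)
          (Ioo ((l - 1) * S.h) t) := by
    intro u hup hju hu t ht
    have hI : ∀ t' ∈ Ioo (((l : ℝ) - 1) * S.h) t, t' - ((l : ℝ) - 1) * S.h ∈ Icc 0 S.h :=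
      fun t' ht' => hmem t' ⟨ht'.1, ht'.2.le.trans ht.2⟩
    rw [hu.flow t ht]
    congr 1
    refine flowDrive_eq_stepDrive measurableSet_Ioo (fun t' ht' => hup _ (hI t' ht') 1 hone)
      (fun _ _ => rfl) (fun t' ht' => ?_)
    exact huniq _ (hI t' ht') _ _ (hju _ (hI t' ht')) (hZ _ _ (hI t' ht')).2
      (hZ _ _ (hI t' ht')).1.symm hone
  have heq := hstep.unique (R := max B B') (hmeas ζ (hreg l (by omega) le_rfl) hζ.jump)
    (hmeas ζ' hreg' hjump')
    (fun t ht => (hB _ (hmem t ht) 0 hzero).trans (le_max_left _ _))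
    (fun t ht => (hB' _ (hmem t ht) 0 hzero).trans (le_max_right _ _))
    (hflow ζ (fun _ _ _ _ => rfl) hζ.jump hζ)
    (by rw [hstart]; exact hflow ζ' hps hjump' hζ')
  intro r hr
  refine huniq r hr _ _ (hζ.jump r hr) (hjump' r hr) ?_
  rcases hr.1.eq_or_lt with rfl | h0
  · rw [hζ.init, hζ'.init, hinit]
  · have ht : r + ((l : ℝ) - 1) * S.h ∈ Ioc (((l : ℝ) - 1) * S.h) (l * S.h) := by
      rw [← sub_start_mem_Ioc, add_sub_cancel_right]
      exact ⟨h0, hr.2⟩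
    have := heq ht
    simp only [add_sub_cancel_right] at this
    exact this

end DelayImpulseSystem

/-! ### The jump functions of all indices -/

namespace DelayImpulseSystem

variable {n m : ℕ} (S : DelayImpulseSystem n m)

/-- The prescribed jump functions of index `≤ 0`. -/
structure IsPast (ζ : ℤ → ℝ → ℝ → EuclideanSpace ℝ (Fin n)) : Prop where
  zero : ∀ r ∈ Icc 0 S.h, ∀ s ∈ Icc (0 : ℝ) 1, (s < 1 ∨ r < S.h) → ζ 0 r s = S.ξ₀ (r - S.h)
  zero_end : ζ 0 S.h 1 = S.x₀
  neg : ∀ a : ℕ, 1 ≤ a → a < S.M → ∀ r ∈ Icc 0 S.h, ∀ s ∈ Icc (0 : ℝ) 1,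
    ζ (-a) r s = S.ξ₀ (r - (a + 1) * S.h)

variable {S} {μ : VectorMeasure ℝ (Fin m → ℝ)} {ν : Measure ℝ} {ω : ℝ → ℤ → ℝ → (Fin m → ℝ)}
  {ζ ζ' : ℤ → ℝ → ℝ → EuclideanSpace ℝ (Fin n)}

theorem IsPast.eq (h : S.IsPast ζ) {k : ℤ} (hk : 1 - S.M ≤ k) (hk0 : k ≤ 0) {r s : ℝ}
    (hr : r ∈ Icc 0 S.h) (hs : s ∈ Icc (0 : ℝ) 1) (hrs : s < 1 ∨ r < S.h) :
    ζ k r s = S.ξ₀ (r + (k - 1) * S.h) := by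
  rcases hk0.eq_or_lt with rfl | hlt
  · rw [h.zero r hr s hs hrs]
    congr 1
    push_cast
    ring
  · obtain ⟨a, rfl⟩ : ∃ a : ℕ, k = -(a : ℤ) := ⟨k.natAbs, by omega⟩
    rw [h.neg a (by omega) (by omega) r hr s hs]
    congr 1
    push_cast
    ring

theorem past_time_mem {k : ℤ} (hk : 1 - S.M ≤ k) (hk0 : k ≤ 0) {r : ℝ} (hr : r ∈ Icc 0 S.h) :
    r + ((k : ℝ) - 1) * S.h ∈ Icc (-(S.M * S.h)) 0 := by
  have h1 : (1 : ℝ) - S.M ≤ k := by exact_mod_cast hk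
  have h2 : (k : ℝ) ≤ 0 := by exact_mod_cast hk0
  have hh := S.h_pos
  constructor
  · nlinarith [hr.1]
  · nlinarith [hr.2]

variable (S) in
theorem neg_delay_le : -(S.M * S.h) ≤ 0 := by
  have := S.h_pos
  simp only [Left.neg_nonpos_iff]
  positivity

variable (S) in
theorem exists_continuous_extension :
    ∃ ξ : ℝ → EuclideanSpace ℝ (Fin n), Continuous ξ ∧ EqOn ξ S.ξ₀ (Icc (-(S.M * S.h)) 0) := by
  refine ⟨IccExtend S.neg_delay_le ((Icc (-(S.M * S.h)) 0).domRestrict S.ξ₀),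
    (continuousOn_iff_continuous_domRestrict.mp S.ξ₀_continuousOn).Icc_extend', fun t ht => ?_⟩
  rw [IccExtend_of_mem _ _ ht]
  rfl

theorem IsPast.isRegular (h : S.IsPast ζ) {k : ℤ} (hk : 1 - S.M ≤ k) (hk0 : k ≤ 0) :
    S.IsRegular ζ k := by
  obtain ⟨B, hB⟩ := isCompact_Icc.exists_bound_of_continuousOn S.ξ₀_continuousOn
  obtain ⟨ξ, hξ, hξe⟩ := S.exists_continuous_extension
  refine ⟨⟨max B ‖S.x₀‖, fun r hr s hs => ?_⟩, fun r hr => ?_, ?_⟩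
  · by_cases hrs : s < 1 ∨ r < S.h
    · rw [h.eq hk hk0 hr hs hrs]
      exact (hB _ (past_time_mem hk hk0 hr)).trans (le_max_left _ _)
    · obtain rfl : s = 1 := le_antisymm hs.2 (not_lt.mp fun h => hrs (Or.inl h))
      obtain rfl : r = S.h := le_antisymm hr.2 (not_lt.mp fun h => hrs (Or.inr h))
      rcases hk0.eq_or_lt with rfl | hlt
      · rw [h.zero_end]
        exact le_max_right _ _
      · obtain ⟨a, rfl⟩ : ∃ a : ℕ, k = -(a : ℤ) := ⟨k.natAbs, by omega⟩
        rw [h.neg a (by omega) (by omega) S.h hr 1 hs]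
        refine le_trans (hB _ ?_) (le_max_left _ _)
        convert past_time_mem hk hk0 hr using 1
        push_cast
        ring
  -- A prescribed function is constant in s, except possibly at s = 1 when k = 0 and r = h.
  · refine (aemeasurable_const (b := S.ξ₀ (r + (k - 1) * S.h))).congr ?_
    have hae : ∀ᵐ s : ℝ, s ≠ 1 := by simp [ae_iff]
    rw [Filter.EventuallyEq, ae_restrict_iff' measurableSet_Ioc]
    filter_upwards [hae] with s hs1 hs
    exact (h.eq hk hk0 hr (Ioc_subset_Icc_self hs) (Or.inl (hs.2.lt_of_ne hs1))).symm
  · have hm : Measurable ((Ioo 0 S.h).indicator fun r => ξ (r + (k - 1) * S.h)) :=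
      (hξ.comp (by fun_prop)).measurable.indicator measurableSet_Ioo
    convert hm using 1
    refine indicator_congr fun r hr => ?_
    rw [h.eq hk hk0 (Ioo_subset_Icc_self hr) (right_mem_Icc.mpr zero_le_one) (Or.inr hr.2),
      hξe (past_time_mem hk hk0 (Ioo_subset_Icc_self hr))]

theorem IsFlowStep.congr {l : ℤ} (h : S.IsFlowStep μ ω ζ l) (heq : ∀ k ≤ l, ζ k = ζ' k) :
    S.IsFlowStep μ ω ζ' l := by
  have hp : S.pastStates ζ' l = S.pastStates ζ l := by
    funext r s k
    rw [pastStates, pastStates, heq _ (by omega)]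
  refine ⟨?_, fun r hr => ?_, fun t ht => ?_⟩
  · rw [← heq l le_rfl, ← heq (l - 1) (by omega), h.init]
  · rw [← heq l le_rfl]
    exact (h.jump r hr).congr (eqOn_refl _ _) fun s _ => by rw [hp]
  · rw [← heq l le_rfl, h.flow t ht, flowDrive, flowDrive, hp, heq l le_rfl]

theorem IsRegular.congr {l : ℤ} (h : S.IsRegular ζ l) (heq : ζ l = ζ' l) : S.IsRegular ζ' l :=
  ⟨by rw [← heq]; exact h.bdd, by rw [← heq]; exact h.aemeasurable,
    by rw [← heq]; exact h.measurable_end⟩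

/-! ### Families of jump functions solving all steps. -/

variable (S) in
/-- The jump functions encode a solution on the whole time interval. -/
structure IsFlow (μ : VectorMeasure ℝ (Fin m → ℝ)) (ω : ℝ → ℤ → ℝ → (Fin m → ℝ))
    (ζ : ℤ → ℝ → ℝ → EuclideanSpace ℝ (Fin n)) : Prop where
  past : S.IsPast ζ
  step : ∀ l : ℤ, 1 ≤ l → l ≤ S.N → S.IsFlowStep μ ω ζ l
  regular : ∀ l : ℤ, 1 ≤ l → l ≤ S.N → S.IsRegular ζ l
  last : ∀ s ∈ Icc (0 : ℝ) 1, ζ (S.N + 1) 0 s = ζ S.N S.h 1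

theorem IsFlow.isRegular (h : S.IsFlow μ ω ζ) {k : ℤ} (hk : 1 - S.M ≤ k) (hkN : k ≤ S.N) :
    S.IsRegular ζ k := by
  rcases le_or_gt k 0 with h0 | h0
  · exact h.past.isRegular hk h0
  · exact h.regular k (by omega) hkN

/-- One index is filled in at a time. A step of index l refers only to indices at most l, so
overwriting a larger index preserves the steps already solved. -/
theorem IsImpulseControl.exists_flow (hc : S.IsImpulseControl μ ν ω) :
    ∃ ζ, S.IsFlow μ ω ζ := by
  classical
  have key : ∀ L : ℕ, L ≤ S.N → ∃ ζ, S.IsPast ζ ∧ ∀ l : ℤ, 1 ≤ l → l ≤ L →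
      S.IsFlowStep μ ω ζ l ∧ S.IsRegular ζ l := by
    intro L
    induction L with
    | zero =>
      intro _
      -- Only the indices l ≤ 0 matter here; those from 1 to N + 1 are overwritten later.
      refine ⟨fun l r s => if l = 0 then (if s < 1 ∨ r < S.h then S.ξ₀ (r - S.h) else S.x₀)
        else S.ξ₀ (r + (l - 1) * S.h), ⟨?_, ?_, ?_⟩, ?_⟩
      · intro r _ s _ hrs
        simp [hrs]
      · simp
      · intro a ha _ r _ s _
        rw [if_neg (by omega)]
        congr 1
        push_cast
        ring
      · intro l h1 h2
        push_cast at h2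
        omega
    | succ L ih =>
      intro hL
      obtain ⟨ζ, hpast, hζ⟩ := ih (by omega)
      obtain ⟨d, hd, hdr⟩ := hc.exists_flowStep (ζ := ζ) (l := (L : ℤ) + 1) (by omega) (by omega)
        (fun k hk hkl => by
          rcases le_or_gt k 0 with h0 | h0
          · exact hpast.isRegular (by omega) h0
          · exact (hζ k (by omega) (by omega)).2)
      have hne : ∀ k : ℤ, k ≤ L → ζ k = Function.update ζ ((L : ℤ) + 1) d k := fun k hk =>
        (Function.update_of_ne (by omega) _ _).symm
      refine ⟨Function.update ζ ((L : ℤ) + 1) d, ⟨?_, ?_, ?_⟩, fun l h1 h2 => ?_⟩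
      · rw [← hne 0 (by omega)]
        exact hpast.zero
      · rw [← hne 0 (by omega)]
        exact hpast.zero_end
      · intro a ha
        rw [← hne (-a) (by omega)]
        exact hpast.neg a ha
      · rcases eq_or_ne l ((L : ℤ) + 1) with rfl | hl
        · exact ⟨hd, hdr⟩
        · push_cast at h2
          obtain ⟨h3, h4⟩ := hζ l h1 (by omega)
          exact ⟨h3.congr fun k hk => hne k (by omega), h4.congr (hne l (by omega))⟩
  obtain ⟨ζ, hpast, hζ⟩ := key S.N le_rfl
  -- The control of index (N + 1, 0) is zero by convention, so ζ^0_{N+1} is the constant ζ^h_N(1).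
  have hne : ∀ k : ℤ, k ≤ S.N →
      ζ k = Function.update ζ ((S.N : ℤ) + 1) (fun _ _ => ζ S.N S.h 1) k := fun k hk =>
    (Function.update_of_ne (by omega) _ _).symm
  refine ⟨Function.update ζ ((S.N : ℤ) + 1) (fun _ _ => ζ S.N S.h 1), ⟨?_, ?_, ?_⟩,
    fun l h1 h2 => ?_, fun l h1 h2 => ?_, ?_⟩
  · rw [← hne 0 (by omega)]
    exact hpast.zero
  · rw [← hne 0 (by omega)]
    exact hpast.zero_end
  · intro a ha
    rw [← hne (-a) (by omega)]
    exact hpast.neg a ha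
  · exact (hζ l h1 h2).1.congr fun k hk => hne k (by omega)
  · exact (hζ l h1 h2).2.congr (hne l h2)
  · intro s _
    rw [← hne S.N le_rfl]
    simp

theorem IsPast.eqOn (h : S.IsPast ζ) (h' : S.IsPast ζ') {k : ℤ} (hk : 1 - S.M ≤ k) (hk0 : k ≤ 0)
    {r : ℝ} (hr : r ∈ Icc 0 S.h) : EqOn (ζ k r) (ζ' k r) (Icc 0 1) := by
  intro s hs
  by_cases hrs : s < 1 ∨ r < S.h
  · rw [h.eq hk hk0 hr hs hrs, h'.eq hk hk0 hr hs hrs]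
  · obtain rfl : s = 1 := le_antisymm hs.2 (not_lt.mp fun h => hrs (Or.inl h))
    obtain rfl : r = S.h := le_antisymm hr.2 (not_lt.mp fun h => hrs (Or.inr h))
    rcases hk0.eq_or_lt with rfl | hlt
    · rw [h.zero_end, h'.zero_end]
    · obtain ⟨a, rfl⟩ : ∃ a : ℕ, k = -(a : ℤ) := ⟨k.natAbs, by omega⟩
      rw [h.neg a (by omega) (by omega) S.h hr 1 hs, h'.neg a (by omega) (by omega) S.h hr 1 hs]

theorem IsFlow.unique (hc : S.IsImpulseControl μ ν ω) (h : S.IsFlow μ ω ζ)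
    (h' : S.IsFlow μ ω ζ') {l : ℤ} (h1 : 1 ≤ l) (h2 : l ≤ S.N) :
    ∀ r ∈ Icc 0 S.h, EqOn (ζ l r) (ζ' l r) (Icc 0 1) := by
  have key : ∀ L : ℕ, L ≤ S.N → ∀ k : ℤ, 1 ≤ k → k ≤ L →
      ∀ r ∈ Icc 0 S.h, EqOn (ζ k r) (ζ' k r) (Icc 0 1) := by
    intro L
    induction L with
    | zero =>
      intro _ k h3 h4
      push_cast at h4
      omega
    | succ L ih =>
      intro hL k h3 h4
      rcases eq_or_ne k ((L : ℤ) + 1) with rfl | hk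
      · refine hc.flowStep_unique (by omega) (by omega)
          (fun k hk hkl => h.isRegular (by omega) (by omega)) (h'.regular _ (by omega) (by omega))
          (h.step _ (by omega) (by omega)) (h'.step _ (by omega) (by omega)) ?_ ?_
        -- The first step starts from the prescribed ζ^h_0(1), every later one from the end of the
        -- previous step.
        · rcases Nat.eq_zero_or_pos L with rfl | hpos
          · simp only [Nat.cast_zero, zero_add, sub_self]
            rw [h.past.zero_end, h'.past.zero_end]
          · rw [add_sub_cancel_right]
            exact ih (by omega) L (by omega) le_rfl S.h (right_mem_Icc.mpr S.h_pos.le)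
              (right_mem_Icc.mpr zero_le_one)
        · intro k hk hkl r hr
          rcases le_or_gt k 0 with h0 | h0
          · exact h.past.eqOn h'.past (by omega) h0 hr
          · exact ih (by omega) k (by omega) (by omega) r hr
      · push_cast at h4
        exact ih (by omega) k h3 (by omega)
  exact key S.N le_rfl l h1 h2

end DelayImpulseSystem

/-! ### Functions of bounded variation on an interval -/

section BoundedVariation

theorem exists_norm_sub_le_of_boundedVariationOn {E : Type*} [NormedAddCommGroup E] {f : ℝ → E}
    {a b : ℝ} (hf : BoundedVariationOn f (Icc a b)) :
    ∃ W : ℝ → ℝ, ∀ s ∈ Icc a b, ∀ t ∈ Icc a b, s ≤ t → ‖f t - f s‖ ≤ W t - W s := by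
  refine ⟨fun t => (eVariationOn f (Icc a t)).toReal, fun s hs t ht hst => ?_⟩
  have hfin : ∀ u v, a ≤ u → v ≤ b → eVariationOn f (Icc u v) ≠ ∞ := fun u v hu hv =>
    ne_top_of_le_ne_top hf (eVariationOn.mono f (Icc_subset_Icc hu hv))
  have hadd := eVariationOn.Icc_add_Icc f (s := univ) hs.1 hst (mem_univ s)
  simp only [univ_inter] at hadd
  beta_reduce
  rw [← hadd, ENNReal.toReal_add (hfin a s le_rfl hs.2) (hfin s t hs.1 ht.2), add_sub_cancel_left,
    ← dist_eq_norm]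
  have h1 := eVariationOn.edist_le f (right_mem_Icc.mpr hst) (left_mem_Icc.mpr hst)
  rw [edist_dist] at h1
  exact (ENNReal.ofReal_le_iff_le_toReal (hfin s t hs.1 ht.2)).mp h1

theorem measurable_indicator_of_boundedVariationOn {n : ℕ} {f : ℝ → EuclideanSpace ℝ (Fin n)}
    {a b : ℝ} (hab : a ≤ b) (hf : BoundedVariationOn f (Icc a b)) :
    Measurable ((Icc a b).indicator f) := by
  obtain ⟨W, hW⟩ := exists_norm_sub_le_of_boundedVariationOn hf
  have hm : Measurable fun t => f (projIcc a b hab t) :=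
    measurable_of_norm_sub_le (W := fun t => W (projIcc a b hab t)) fun s t hst =>
      hW _ (Subtype.coe_prop _) _ (Subtype.coe_prop _) (monotone_projIcc hab hst)
  convert hm.indicator (measurableSet_Icc (a := a) (b := b)) using 1
  refine indicator_congr fun t ht => ?_
  rw [projIcc_of_mem hab ht]

theorem exists_norm_le_of_boundedVariationOn {E : Type*} [NormedAddCommGroup E] {f : ℝ → E}
    {a b : ℝ} (hf : BoundedVariationOn f (Icc a b)) : ∃ R, ∀ t ∈ Icc a b, ‖f t‖ ≤ R := by
  refine ⟨‖f a‖ + (eVariationOn f (Icc a b)).toReal, fun t ht => ?_⟩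
  have h := hf.dist_le ht (left_mem_Icc.mpr (ht.1.trans ht.2))
  rw [dist_eq_norm] at h
  calc ‖f t‖ = ‖f a + (f t - f a)‖ := by rw [add_sub_cancel]
    _ ≤ ‖f a‖ + ‖f t - f a‖ := norm_add_le _ _
    _ ≤ _ := add_le_add_right h _

/-- The endpoints may carry arbitrary jumps. Extending W by -(B + 2R) at a and B + 2R at b gives it
jumps of at least 2R there, which dominate any increment of f. -/
theorem boundedVariationOn_Icc_of_Ioo {E : Type*} [NormedAddCommGroup E] {f : ℝ → E} {W : ℝ → ℝ}
    {a b B R : ℝ} (hW : ∀ t ∈ Ioo a b, |W t| ≤ B) (hR : ∀ t ∈ Icc a b, ‖f t‖ ≤ R)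
    (h : ∀ s ∈ Ioo a b, ∀ t ∈ Ioo a b, s ≤ t → ‖f t - f s‖ ≤ W t - W s) :
    BoundedVariationOn f (Icc a b) := by
  rcases le_or_gt b a with hba | hab
  · exact BoundedVariationOn.of_subsingleton (subsingleton_Icc_of_ge hba)
  have hB : 0 ≤ B := by
    obtain ⟨t, ht⟩ := nonempty_Ioo.mpr hab
    exact (abs_nonneg _).trans (hW t ht)
  have hR0 : 0 ≤ R := (norm_nonneg _).trans (hR a (left_mem_Icc.mpr hab.le))
  have h2 : ∀ s ∈ Icc a b, ∀ t ∈ Icc a b, ‖f t - f s‖ ≤ 2 * R := fun s hs t ht => by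
    have h3 := (norm_sub_le (f t) (f s)).trans (add_le_add (hR t ht) (hR s hs))
    linarith
  refine boundedVariationOn_of_norm_sub_le (W := fun t => if t ≤ a then -(B + 2 * R)
    else if b ≤ t then B + 2 * R else W t) fun s hs t ht hst => ?_
  rcases hst.eq_or_lt with rfl | hlt
  · simp
  have hta : ¬ t ≤ a := not_le.mpr (hs.1.trans_lt hlt)
  have hsb : ¬ b ≤ s := not_le.mpr (hlt.trans_le ht.2)
  simp only [hta, hsb, if_false]
  have h3 := h2 s hs t ht
  split_ifs with h4 h5 h5
  · linarith
  · have := (abs_le.mp (hW s ⟨not_le.mp h5, not_le.mp hsb⟩)).2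
    linarith
  · have := (abs_le.mp (hW t ⟨not_le.mp hta, not_le.mp h4⟩)).1
    linarith
  · exact h s ⟨not_le.mp h5, not_le.mp hsb⟩ t ⟨not_le.mp hta, not_le.mp h4⟩ hst

/-- Bounded variation survives a change of value at b. This is needed at time 0, where x takes the
initial point instead of ξ₀(0). -/
theorem boundedVariationOn_congr_Ico {E : Type*} [NormedAddCommGroup E] {f g : ℝ → E} {a b : ℝ}
    (hf : BoundedVariationOn f (Icc a b)) (hfg : EqOn f g (Ico a b)) :
    BoundedVariationOn g (Icc a b) := by
  obtain ⟨W, hW⟩ := exists_norm_sub_le_of_boundedVariationOn hf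
  obtain ⟨R, hR⟩ := exists_norm_le_of_boundedVariationOn hf
  have hmono : ∀ s ∈ Icc a b, ∀ t ∈ Icc a b, s ≤ t → W s ≤ W t := fun s hs t ht hst => by
    have := (norm_nonneg _).trans (hW s hs t ht hst)
    linarith
  refine boundedVariationOn_Icc_of_Ioo (W := W) (B := |W a| + |W b|) (R := max R ‖g b‖)
    (fun t ht => ?_) (fun t ht => ?_) fun s hs t ht hst => ?_
  · have ht' := Ioo_subset_Icc_self ht
    have hab := ht'.1.trans ht'.2
    have h1 := hmono a (left_mem_Icc.mpr hab) t ht' ht'.1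
    have h2 := hmono t ht' b (right_mem_Icc.mpr hab) ht'.2
    have h3 := neg_abs_le (W a)
    have h4 := le_abs_self (W b)
    rw [abs_le]
    constructor <;> linarith [abs_nonneg (W a), abs_nonneg (W b)]
  · rcases ht.2.eq_or_lt with rfl | hlt
    · exact le_max_right _ _
    · rw [← hfg ⟨ht.1, hlt⟩]
      exact (hR t ht).trans (le_max_left _ _)
  · rw [← hfg (Ioo_subset_Ico_self hs), ← hfg (Ioo_subset_Ico_self ht)]
    exact hW s (Ioo_subset_Icc_self hs) t (Ioo_subset_Icc_self ht) hst

end BoundedVariation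

/-! ### Sums over the atoms in an interval -/

section Atoms

theorem indicator_Ioc_shift {F : Type*} [Zero F] (u : ℝ → F) (a t : ℝ) :
    (fun r => (Ioc 0 (t - a)).indicator (fun r => u (r + a)) r) =
      (Ioc a t).indicator u ∘ (Equiv.addRight a) := by
  funext r
  simp only [indicator_apply, mem_Ioc, Function.comp, Equiv.coe_addRight]
  refine if_congr ?_ rfl rfl
  constructor <;> rintro ⟨h1, h2⟩ <;> constructor <;> linarith

theorem tsum_Ioc_shift {F : Type*} [AddCommMonoid F] [TopologicalSpace F] (u : ℝ → F) (a t : ℝ) :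
    ∑' r : Ioc 0 (t - a), u (r + a) = ∑' s, (Ioc a t).indicator u s := by
  rw [tsum_subtype (Ioc 0 (t - a)) fun r => u (r + a), indicator_Ioc_shift u a t]
  exact (Equiv.addRight a).tsum_eq _

theorem summable_Ioc_shift {F : Type*} [AddCommMonoid F] [TopologicalSpace F] (u : ℝ → F)
    (a t : ℝ) : (Summable fun r : Ioc 0 (t - a) => u (r + a)) ↔ Summable ((Ioc a t).indicator u) := by
  rw [← (Equiv.addRight a).summable_iff, ← indicator_Ioc_shift u a t]
  exact summable_subtype_iff_indicator (f := fun r => u (r + a)) (s := Ioc 0 (t - a))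

/-- A finite measure has countably many atoms, so its mass on them is the sum of the masses of
singletons; what remains is the continuous part by definition. -/
theorem measureReal_eq_contPart_add_tsum (ν : Measure ℝ) [IsFiniteMeasure ν] {A : Set ℝ}
    (hA : MeasurableSet A) : ν.real A =
      (measureContPart ν).real A + ∑' s, A.indicator (fun s => ν.real {s}) s := by
  set D : Set ℝ := {t | ν {t} = 0} with hD
  have hDm : MeasurableSet D := measurableSet_not_atom_measure ν
  have hc : (A \ D).Countable := by
    refine (summable_measureReal_singleton ν).countable_support.mono fun t ht => ?_
    simpa [measureReal_def, hD, ENNReal.toReal_eq_zero_iff] using ht.2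
  have h1 : ν.real A = ν.real (A ∩ D) + ν.real (A \ D) := (measureReal_inter_add_sdiff hDm).symm
  rw [h1, measureContPart, measureReal_restrict_apply hA]
  congr 1
  have h2 : ν (A \ D) = ∑' p : ↥(A \ D), ν {(p : ℝ)} := by
    conv_lhs => rw [← biUnion_of_singleton (A \ D)]
    exact measure_biUnion hc (fun a _ b _ hab => by simpa [Function.onFun] using hab)
      fun _ _ => measurableSet_singleton _
  rw [measureReal_def, h2, ENNReal.tsum_toReal_eq fun _ => measure_ne_top ν _,
    tsum_subtype (A \ D) fun s => (ν {s}).toReal]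
  refine tsum_congr fun s => ?_
  by_cases hs : s ∈ A
  · by_cases hsD : s ∈ D
    · rw [indicator_of_notMem (fun h => h.2 hsD), indicator_of_mem hs, measureReal_def,
        show ν {s} = 0 from hsD, ENNReal.toReal_zero]
    · rw [indicator_of_mem (show s ∈ A \ D from ⟨hs, hsD⟩), indicator_of_mem hs, measureReal_def]
  · rw [indicator_of_notMem hs, indicator_of_notMem fun h => hs h.1]

theorem measureContPart_singleton (ν : Measure ℝ) [IsFiniteMeasure ν] (t : ℝ) :
    measureContPart ν {t} = 0 := by
  rw [measureContPart, Measure.restrict_apply (measurableSet_singleton t)]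
  by_cases h : ν {t} = 0
  · exact measure_mono_null inter_subset_left h
  · rw [singleton_inter_eq_empty.mpr (show t ∉ {t | ν {t} = 0} from h), measure_empty]

theorem measureContPart_Icc (ν : Measure ℝ) [IsFiniteMeasure ν] (a t : ℝ) :
    (measureContPart ν).real (Icc a t) = (measureContPart ν).real (Ioc a t) := by
  rw [measureReal_def, measureReal_def, ← Icc_sdiff_left,
    measure_sdiff_null (measureContPart_singleton ν a)]

theorem measureReal_Iic_sub (ν : Measure ℝ) [IsFiniteMeasure ν] {a t : ℝ} (h : a ≤ t) :
    ν.real (Iic t) = ν.real (Iic a) + ν.real (Ioc a t) := by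
  have hd : Disjoint (Iic a) (Ioc a t) := Set.disjoint_left.mpr fun x hx hx' => hx'.1.not_ge hx
  rw [← measureReal_union hd measurableSet_Ioc, Iic_union_Ioc_eq_Iic h]

theorem measureReal_Iic_eq (ν : Measure ℝ) [IsFiniteMeasure ν] (t : ℝ) :
    ν.real (Iic t) = ν.real (Iio t) + ν.real {t} := by
  rw [← measureReal_union (by simp) (measurableSet_singleton t), Iio_union_right]

end Atoms

/-! ### The variation component of an impulse solution -/

namespace DelayImpulseSystem

variable {n m : ℕ} {S : DelayImpulseSystem n m} {μ : VectorMeasure ℝ (Fin m → ℝ)} {ν : Measure ℝ}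
  {ω : ℝ → ℤ → ℝ → (Fin m → ℝ)}

theorem IsImpulseControl.measureReal_Iio_zero (hc : S.IsImpulseControl μ ν ω) {t : ℝ}
    (ht : t ≤ 0) : ν.real (Iio t) = 0 := by
  rw [measureReal_def, measure_mono_null (fun x hx => ?_) hc.memVc.concentrated,
    ENNReal.toReal_zero]
  exact fun h => absurd h.1 (not_le.mpr (lt_of_lt_of_le hx ht))

/-- The jumps of v inside a step are exactly the atoms of ν, so together with ν^c they reconstitute
ν. Only the size of the jumps is assumed, so that the formula serves both the explicit solution and
an arbitrary one. -/
theorem IsImpulseControl.tsum_attachedMass (hc : S.IsImpulseControl μ ν ω) {l : ℤ} (h1 : 1 ≤ l)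
    (h2 : l ≤ S.N) {θ : ℤ → ℝ → ℝ → ℝ} {v : ℝ → ℝ}
    (h : ∀ r ∈ Ioo 0 S.h, θ l r 1 - Function.leftLim v (S.time l r) = S.attachedMass ω r l) {t : ℝ}
    (ht : t ∈ Ioo (((l : ℝ) - 1) * S.h) (l * S.h)) :
    (Summable fun r : Ioc 0 (t - ((l : ℝ) - 1) * S.h) =>
      θ l r 1 - Function.leftLim v (S.time l r)) ∧
    (measureContPart ν).real (Icc (((l : ℝ) - 1) * S.h) t) +
      ∑' r : Ioc 0 (t - ((l : ℝ) - 1) * S.h), (θ l r 1 - Function.leftLim v (S.time l r)) =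
      ν.real (Ioc (((l : ℝ) - 1) * S.h) t) := by
  have := hc.memVc.finite
  have heq : (fun r : Ioc 0 (t - ((l : ℝ) - 1) * S.h) =>
      θ l r 1 - Function.leftLim v (S.time l r)) =
      fun r : Ioc 0 (t - ((l : ℝ) - 1) * S.h) => ν.real {(r : ℝ) + ((l : ℝ) - 1) * S.h} := by
    funext r
    have hr : (r : ℝ) ∈ Ioo 0 S.h :=
      ⟨r.2.1, r.2.2.trans_lt (sub_start_mem_Ioo.mpr ht).2⟩
    rw [h r hr, hc.attachedMass_interior hr h1 h2, time]
  rw [heq]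
  refine ⟨?_, ?_⟩
  · rw [summable_Ioc_shift fun s => ν.real {s}]
    exact (summable_measureReal_singleton ν).indicator _
  · rw [tsum_Ioc_shift fun s => ν.real {s}, measureContPart_Icc,
      ← measureReal_eq_contPart_add_tsum ν measurableSet_Ioc]

theorem leftLim_eq_measureReal_Iio {ν : Measure ℝ} [IsFiniteMeasure ν] {v : ℝ → ℝ} {a t : ℝ}
    (hat : a < t) (h : ∀ s ∈ Ioo a t, v s = ν.real (Iic s)) :
    Function.leftLim v t = ν.real (Iio t) := by
  refine leftLim_eq_of_norm_sub_le ν hat fun s hs => ?_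
  have hd : Disjoint (Iic s) (Ioo s t) := Set.disjoint_left.mpr fun x hx hx' => hx'.1.not_ge hx
  rw [h s hs, Real.norm_eq_abs, abs_sub_comm, ← Iic_union_Ioo_eq_Iio hs.2,
    measureReal_union hd measurableSet_Ioo,
    add_sub_cancel_left, abs_of_nonneg measureReal_nonneg]

/-- The variation component of the impulse solution. -/
noncomputable def variationPath (ν : Measure ℝ) (t : ℝ) : ℝ := if t = 0 then 0 else ν.real (Iic t)

/-- The jump functions of the variation component. -/
noncomputable def variationJump (S : DelayImpulseSystem n m) (ν : Measure ℝ)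
    (ω : ℝ → ℤ → ℝ → (Fin m → ℝ)) (l : ℤ) (r s : ℝ) : ℝ :=
  if l ≤ 0 then 0 else
    ν.real (Iio (S.time l r)) + (if r = 0 then S.attachedMass ω S.h (l - 1) else 0) +
      ∫ s' in (0 : ℝ)..s, l1Norm (S.attached ω r l s')

theorem variationJump_eq {l : ℤ} (h : 1 ≤ l) (r s : ℝ) : S.variationJump ν ω l r s =
    S.variationJump ν ω l r 0 + ∫ s' in (0 : ℝ)..s, l1Norm (S.attached ω r l s') := by
  simp [variationJump, show ¬ l ≤ 0 by omega]

theorem variationJump_pos {l : ℤ} (h : 1 ≤ l) {r : ℝ} (hr : 0 < r) :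
    S.variationJump ν ω l r 0 = ν.real (Iio (S.time l r)) := by
  rw [variationJump, if_neg (by omega), if_neg hr.ne']
  simp

theorem one_le_of_isJumpIndex {l : ℤ} {r : ℝ} (h : S.IsJumpIndex l r) : 1 ≤ l ∧ l ≤ S.N + 1 := by
  rcases h with ⟨h1, h2, -⟩ | ⟨h1, -⟩ <;> omega

theorem time_pos {l : ℤ} (h : 1 ≤ l) {r : ℝ} (hr : 0 < r) : 0 < S.time l r := by
  have h3 : (1 : ℝ) ≤ l := by exact_mod_cast h
  have := mul_nonneg (sub_nonneg.mpr h3) S.h_pos.le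
  rw [time]
  linarith

/-- Three portions add up: the mass before (l-1)h and the shares of the atom there carried by
ω^h_{l-1} and ω^0_l. For l = 1 the result is ν({0}), whereas v(0) = 0. -/
theorem IsImpulseControl.variationJump_start (hc : S.IsImpulseControl μ ν ω) {l : ℤ}
    (h1 : 1 ≤ l) (h2 : l ≤ S.N + 1) :
    S.variationJump ν ω l 0 1 = ν.real (Iic (((l : ℝ) - 1) * S.h)) := by
  have := hc.memVc.finite
  have h3 := hc.attachedMass_endpoint (l := l - 1) (by omega) (by omega)
  rw [sub_add_cancel] at h3
  push_cast at h3
  rw [variationJump, if_neg (by omega), if_pos rfl, measureReal_Iic_eq, ← h3, time, zero_add,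
    ← add_assoc]
  rfl

theorem IsImpulseControl.leftLim_variationPath (hc : S.IsImpulseControl μ ν ω) {t : ℝ}
    (ht : 0 < t) : Function.leftLim (variationPath ν) t = ν.real (Iio t) := by
  have := hc.memVc.finite
  exact leftLim_eq_measureReal_Iio ht fun s hs => if_neg hs.1.ne'

theorem IsImpulseControl.isVariationJump (hc : S.IsImpulseControl μ ν ω) :
    S.IsVariationJump ω (variationPath ν) (S.variationJump ν ω) where
  nonneg l r h s hs := by
    rw [variationJump, if_neg (by have := (one_le_of_isJumpIndex h).1; omega)]
    have h1 : 0 ≤ ∫ s' in (0 : ℝ)..s, l1Norm (S.attached ω r l s') :=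
      intervalIntegral.integral_nonneg hs.1 fun _ _ => l1Norm_nonneg _
    have h2 := S.attachedMass_nonneg ω S.h (l - 1)
    have h3 : 0 ≤ ν.real (Iio (S.time l r)) := measureReal_nonneg
    split_ifs <;> linarith
  past r _ s _ := by simp [variationJump]
  initial_pos l r h hr := by
    rw [variationJump_pos (one_le_of_isJumpIndex h).1 hr,
      hc.leftLim_variationPath (time_pos (one_le_of_isJumpIndex h).1 hr)]
  initial_zero l h := by
    obtain ⟨h1, h2⟩ := one_le_of_isJumpIndex h
    have htime : S.time (l - 1) S.h = S.time l 0 := by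
      rw [time, time]
      push_cast
      ring
    rcases h1.eq_or_lt with rfl | hlt
    -- Nothing precedes the first step: ν does not charge ]-∞,0[, and ω^h_0 is zero by convention.
    · rw [variationJump, if_neg (by omega), if_pos rfl, variationJump, if_pos (by omega), time]
      rw [hc.measureReal_Iio_zero (by simp), attachedMass, attached_of_not (by omega)]
      simp [l1Norm]
    · rw [variationJump_eq (l := l - 1) (by omega), variationJump_pos (by omega) S.h_pos, htime,
        variationJump, if_neg (by omega), if_pos rfl]
      simp [attachedMass]
  equation l r h s _ := variationJump_eq (one_le_of_isJumpIndex h).1 r s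

theorem IsImpulseControl.variationPath_start (hc : S.IsImpulseControl μ ν ω) {l : ℤ}
    (h1 : 2 ≤ l) (h2 : l ≤ S.N + 1) :
    variationPath ν (((l : ℝ) - 1) * S.h) = S.variationJump ν ω l 0 1 := by
  have h3 : (2 : ℝ) ≤ l := by exact_mod_cast h1
  rw [hc.variationJump_start (by omega) h2, variationPath,
    if_neg (mul_pos (by linarith) S.h_pos).ne']

theorem start_nonneg {l : ℤ} (h1 : 1 ≤ l) : 0 ≤ ((l : ℝ) - 1) * S.h := by
  have h3 : (1 : ℝ) ≤ l := by exact_mod_cast h1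
  exact mul_nonneg (sub_nonneg.mpr h3) S.h_pos.le

theorem IsImpulseControl.variationPath_interior (hc : S.IsImpulseControl μ ν ω) {l : ℤ}
    (h1 : 1 ≤ l) (h2 : l ≤ S.N) {t : ℝ} (ht : t ∈ Ioo (((l : ℝ) - 1) * S.h) (l * S.h)) :
    (Summable fun r : Ioc 0 (t - ((l : ℝ) - 1) * S.h) =>
      S.variationJump ν ω l r 1 - Function.leftLim (variationPath ν) (S.time l r)) ∧
    variationPath ν t = S.variationJump ν ω l 0 1
      + (measureContPart ν).real (Icc (((l : ℝ) - 1) * S.h) t)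
      + (∑' r : Ioc 0 (t - ((l : ℝ) - 1) * S.h),
        (S.variationJump ν ω l r 1 - Function.leftLim (variationPath ν) (S.time l r))) := by
  have := hc.memVc.finite
  obtain ⟨h3, h4⟩ := hc.tsum_attachedMass h1 h2 (θ := S.variationJump ν ω) (v := variationPath ν)
    (fun r hr => by
      rw [variationJump_eq h1, variationJump_pos h1 hr.1,
        hc.leftLim_variationPath (time_pos h1 hr.1), add_sub_cancel_left]
      rfl) ht
  refine ⟨h3, ?_⟩
  rw [add_assoc, h4, hc.variationJump_start h1 (by omega), ← measureReal_Iic_sub ν ht.1.le,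
    variationPath, if_neg ((S.start_nonneg h1).trans_lt ht.1).ne']

theorem boundedVariationOn_variationPath [IsFiniteMeasure ν] (T : ℝ) :
    BoundedVariationOn (variationPath ν) (Icc 0 T) := by
  refine boundedVariationOn_of_norm_sub_le (W := variationPath ν) fun s hs t ht hst => ?_
  rw [Real.norm_eq_abs, abs_of_nonneg (sub_nonneg.mpr ?_)]
  rw [variationPath, variationPath]
  split_ifs with h1 h2 h2
  · exact le_rfl
  · exact measureReal_nonneg
  · exact absurd (le_antisymm (hst.trans h2.le) hs.1) h1
  · exact measureReal_mono (Iic_subset_Iic.mpr hst)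

/-- The values are forced in turn: θ^0_l(1) gives v inside step l, hence its left limit at lh;
adding the masses of ω^h_l and ω^0_{l+1} gives θ^0_{l+1}(1). -/
theorem IsImpulseControl.variation_unique (hc : S.IsImpulseControl μ ν ω)
    {v : ℝ → ℝ} {θ : ℤ → ℝ → ℝ → ℝ} (hθ : S.IsVariationJump ω v θ)
    (hint : ∀ l : ℤ, 1 ≤ l → l ≤ S.N → ∀ t ∈ Ioo (((l : ℝ) - 1) * S.h) (l * S.h),
      v t = θ l 0 1 + (measureContPart ν).real (Icc (((l : ℝ) - 1) * S.h) t)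
        + (∑' r : Ioc 0 (t - ((l : ℝ) - 1) * S.h),
          (θ l r 1 - Function.leftLim v (S.time l r)))) :
    (∀ l : ℤ, 1 ≤ l → l ≤ S.N + 1 → θ l 0 1 = ν.real (Iic (((l : ℝ) - 1) * S.h))) ∧
    ∀ l : ℤ, 1 ≤ l → l ≤ S.N → ∀ t ∈ Ioo (((l : ℝ) - 1) * S.h) (l * S.h), v t = ν.real (Iic t) := by
  have := hc.memVc.finite
  have hone : (1 : ℝ) ∈ Icc (0 : ℝ) 1 := right_mem_Icc.mpr zero_le_one
  have hstep : ∀ l : ℤ, 1 ≤ l → l ≤ S.N → θ l 0 1 = ν.real (Iic (((l : ℝ) - 1) * S.h)) →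
      ∀ t ∈ Ioo (((l : ℝ) - 1) * S.h) (l * S.h), v t = ν.real (Iic t) := by
    intro l h1 h2 hl t ht
    have hidx : ∀ r ∈ Ioo 0 S.h, S.IsJumpIndex l r := fun r hr =>
      Or.inl ⟨h1, h2, Ioo_subset_Icc_self hr⟩
    obtain ⟨-, h4⟩ := hc.tsum_attachedMass h1 h2 (θ := θ) (v := v)
      (fun r hr => by
        rw [hθ.equation l r (hidx r hr) 1 hone, hθ.initial_pos l r (hidx r hr) hr.1,
          add_sub_cancel_left]
        rfl) ht
    rw [hint l h1 h2 t ht, add_assoc, h4, hl, ← measureReal_Iic_sub ν ht.1.le]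
  have hall : ∀ L : ℕ, L ≤ S.N →
      θ (L + 1) 0 1 = ν.real (Iic ((((L : ℤ) + 1 : ℤ) - 1 : ℝ) * S.h)) := by
    intro L
    induction L with
    | zero =>
      intro _
      have hidx : S.IsJumpIndex (((0 : ℕ) : ℤ) + 1) 0 :=
        Or.inl ⟨by omega, by have := S.one_le_N; omega, left_mem_Icc.mpr S.h_pos.le⟩
      have h3 := hc.attachedMass_endpoint (l := 0) le_rfl (by omega)
      rw [hθ.equation _ 0 hidx 1 hone, hθ.initial_zero _ hidx, measureReal_Iic_eq]
      simp only [Nat.cast_zero, zero_add, sub_self, Int.cast_one, zero_mul, Int.cast_zero] at h3 ⊢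
      rw [hθ.past S.h (right_mem_Icc.mpr S.h_pos.le) 1 hone, hc.measureReal_Iio_zero le_rfl, ← h3]
      have h4 : S.attachedMass ω S.h 0 = 0 := by
        rw [attachedMass, attached_of_not (by omega)]
        simp [l1Norm]
      rw [h4, zero_add, zero_add, zero_add]
      rfl
    | succ L ih =>
      intro hL
      have hl := ih (by omega)
      set l : ℤ := (L : ℤ) + 1 with hldef
      have h1 : 1 ≤ l := by omega
      have h2 : l ≤ S.N := by omega
      have hcast : (((L + 1 : ℕ) : ℤ) + 1) = l + 1 := by omega
      rw [hcast]
      have hidx : S.IsJumpIndex (l + 1) 0 := by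
        rcases h2.eq_or_lt with h | h
        · exact Or.inr ⟨by omega, rfl⟩
        · exact Or.inl ⟨by omega, by omega, left_mem_Icc.mpr S.h_pos.le⟩
      have hidx' : S.IsJumpIndex l S.h := Or.inl ⟨h1, h2, right_mem_Icc.mpr S.h_pos.le⟩
      have hlim : Function.leftLim v (S.time l S.h) = ν.real (Iio (S.time l S.h)) := by
        have htime : S.time l S.h = l * S.h := by rw [time]; ring
        rw [htime]
        exact leftLim_eq_measureReal_Iio (a := ((l : ℝ) - 1) * S.h)
          (by have := S.h_pos; linarith) (hstep l h1 h2 hl)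
      have h3 := hc.attachedMass_endpoint (l := l) (by omega) h2
      have htime : S.time l S.h = ((l + 1 : ℤ) - 1 : ℝ) * S.h := by
        rw [time]
        push_cast
        ring
      have htime' : (l : ℝ) * S.h = ((l + 1 : ℤ) - 1 : ℝ) * S.h := by
        push_cast
        ring
      rw [htime'] at h3
      rw [hθ.equation _ 0 hidx 1 hone, hθ.initial_zero _ hidx, add_sub_cancel_right,
        hθ.equation l S.h hidx' 1 hone, hθ.initial_pos l S.h hidx' S.h_pos, hlim, htime,
        measureReal_Iic_eq, ← h3, add_assoc]
      rfl
  have hθall : ∀ l : ℤ, 1 ≤ l → l ≤ S.N + 1 → θ l 0 1 = ν.real (Iic (((l : ℝ) - 1) * S.h)) := by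
    intro l h1 h2
    obtain ⟨L, rfl⟩ : ∃ L : ℕ, l = (L : ℤ) + 1 := ⟨(l - 1).natAbs, by omega⟩
    exact hall L (by omega)
  exact ⟨hθall, fun l h1 h2 => hstep l h1 h2 (hθall l h1 (by omega))⟩

end DelayImpulseSystem

/-! ### Curves with prescribed increments -/

section Curve

set_option linter.unusedSectionVars false

variable {m : ℕ} {E : Type*} [NormedAddCommGroup E] [NormedSpace ℝ E] [CompleteSpace E]
  {σ : Fin m → SignedMeasure ℝ} {ν : Measure ℝ} {T a b C : ℝ}
  {F : ℝ → E} {G : Fin m → ℝ → E} {J x : ℝ → E} {c : E}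

theorem drive_singleton (hσ : ∀ j t, σ j {t} = 0) (s : ℝ) : drive σ F G J {s} = J s := by
  have h : drive σ F G J {s} = drive σ 0 0 J {s} :=
    drive_congr hσ (measurableSet_singleton s) (countable_singleton s)
      (fun t ht htD => absurd ht htD) (fun j t ht htD => absurd ht htD) (fun _ _ => rfl)
  have h1 : ∀ j, ∫ᵛ t in {s}, (0 : E) ∂<•(σ j) = 0 := fun j => VectorMeasure.integral_zero
  rw [h, drive]
  simp only [Pi.zero_apply, integral_zero, h1, Finset.sum_const_zero, zero_add]
  rw [tsum_eq_single s fun t ht => indicator_of_notMem (by simpa using ht) _]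
  exact indicator_of_mem (mem_singleton s) J

theorem drive_Ioc (hσ : ∀ j t, σ j {t} = 0) (h : IsDriver σ (Ioo a b) F G J) {t : ℝ}
    (ht : t ∈ Ioo a b) : drive σ F G J (Ioc a t) = drive σ F G J (Ioo a t) + J t := by
  rw [← Ioo_union_right ht.1, drive_union h measurableSet_Ioo (measurableSet_singleton t)
    (Ioo_subset_Ioo_right ht.2.le) (singleton_subset_iff.mpr ht) (by simp), drive_singleton hσ]

/-- Links `drive` with the formula of the impulse dynamics. Closing the interval at a does not
change the integrals against the atomless σ; the jump at a is not in the sum, being already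
contained in the starting value. -/
theorem drive_Ioc_eq (hσ : ∀ j t, σ j {t} = 0) {t : ℝ} (hat : a ≤ t) :
    drive σ F G J (Ioc a t) = (∫ t' in a..t, F t') + (∑ j, ∫ᵛ t' in Icc a t, G j t' ∂<•(σ j))
      + ∑' r : Ioc 0 (t - a), J (r + a) := by
  rw [drive, intervalIntegral.integral_of_le hat, tsum_Ioc_shift]
  congr 2
  refine Finset.sum_congr rfl fun j _ => VectorMeasure.setIntegral_congr_set measurableSet_Ioc
    measurableSet_Icc ?_
  have hae : ∀ᵐ s ∂(σ j).variation, s ≠ a := by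
    rw [ae_iff]
    simpa using variation_singleton_eq_zero (hσ j a)
  filter_upwards [hae] with s hs
  refine propext ⟨fun h => Ioc_subset_Icc_self h, fun h => ⟨lt_of_le_of_ne h.1 (Ne.symm hs), h.2⟩⟩

/-- A curve on `]a, b[` whose increments are given by `drive`. -/
structure IsDrivenCurve (σ : Fin m → SignedMeasure ℝ) (ν : Measure ℝ) (T a b C : ℝ)
    (F : ℝ → E) (G : Fin m → ℝ → E) (J : ℝ → E) (c : E) (x : ℝ → E) : Prop where
  isDriver : IsDriver σ (Ioo a b) F G J
  nonneg : 0 ≤ C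
  subset : Ioo a b ⊆ Icc 0 T
  F_bdd : ∀ t ∈ Ioo a b, ‖F t‖ ≤ C
  G_bdd : ∀ j, ∀ t ∈ Ioo a b, ‖G j t‖ ≤ C
  J_bdd : ∀ t ∈ Ioo a b, ‖J t‖ ≤ C * ν.real {t}
  eq : ∀ t ∈ Ioo a b, x t = c + drive σ F G J (Ioc a t)

theorem IsDrivenCurve.summable (h : IsDrivenCurve σ ν T a b C F G J c x) {t : ℝ}
    (ht : t ∈ Ioo a b) : Summable fun r : Ioc 0 (t - a) => J (r + a) := by
  rw [summable_Ioc_shift]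
  exact (h.isDriver.mono fun u hu => ⟨hu.1, hu.2.trans_lt ht.2⟩).right

variable [IsFiniteMeasure ν]

theorem IsDrivenCurve.norm_sub_le (h : IsDrivenCurve σ ν T a b C F G J c x) {A B : Set ℝ}
    (hA : MeasurableSet A) (hB : MeasurableSet B) (hAB : A ⊆ B) (hBI : B ⊆ Ioo a b) :
    ‖drive σ F G J B - drive σ F G J A‖ ≤ C * (driveMeasure σ ν T).real (B \ A) :=
  norm_drive_sub_le h.isDriver h.nonneg h.subset h.F_bdd h.G_bdd h.J_bdd hA hB hAB hBI

theorem IsDrivenCurve.norm_increment_le (h : IsDrivenCurve σ ν T a b C F G J c x) {s t : ℝ}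
    (hs : s ∈ Ioo a b) (ht : t ∈ Ioo a b) (hst : s ≤ t) :
    ‖x t - x s‖ ≤ C * (driveMeasure σ ν T).real (Iic t) -
      C * (driveMeasure σ ν T).real (Iic s) := by
  have hsub : Ioc a t ⊆ Ioo a b := fun u hu => ⟨hu.1, hu.2.trans_lt ht.2⟩
  rw [h.eq t ht, h.eq s hs, add_sub_add_left_eq_sub, ← mul_sub, measureReal_Iic_sub _ hst,
    add_sub_cancel_left]
  refine (h.norm_sub_le measurableSet_Ioc measurableSet_Ioc (Ioc_subset_Ioc_right hst)
    hsub).trans (mul_le_mul_of_nonneg_left (measureReal_mono ?_) h.nonneg)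
  exact fun u hu => ⟨not_le.mp fun hus => hu.2 ⟨hu.1.1, hus⟩, hu.1.2⟩

/-- The two sides differ by the contribution of ]s,t[, whose mass vanishes as s increases to t. -/
theorem IsDrivenCurve.leftLim_eq (h : IsDrivenCurve σ ν T a b C F G J c x) {t : ℝ}
    (ht : t ∈ Ioc a b) : Function.leftLim x t = c + drive σ F G J (Ioo a t) := by
  refine leftLim_eq_of_norm_sub_le (C.toNNReal • driveMeasure σ ν T) ht.1 fun s hs => ?_
  have hs' : s ∈ Ioo a b := ⟨hs.1, hs.2.trans_le ht.2⟩
  rw [h.eq s hs', add_sub_add_left_eq_sub, norm_sub_rev, measureReal_nnreal_smul_apply,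
    Real.coe_toNNReal _ h.nonneg]
  refine (h.norm_sub_le measurableSet_Ioc measurableSet_Ioo
    (fun u hu => ⟨hu.1, hu.2.trans_lt hs.2⟩) (Ioo_subset_Ioo_right ht.2)).trans
    (mul_le_mul_of_nonneg_left (measureReal_mono ?_) h.nonneg)
  exact fun u hu => ⟨not_le.mp fun hus => hu.2 ⟨hu.1.1, hus⟩, hu.1.2⟩

theorem IsDrivenCurve.norm_leftLim_le (h : IsDrivenCurve σ ν T a b C F G J c x) {t : ℝ}
    (ht : t ∈ Ioc a b) :
    ‖Function.leftLim x t‖ ≤ ‖c‖ + C * (driveMeasure σ ν T).real univ := by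
  have hsub : Ioo a t ⊆ Ioo a b := Ioo_subset_Ioo_right ht.2
  rw [h.leftLim_eq ht]
  refine (norm_add_le _ _).trans (add_le_add_right ((norm_drive_le h.nonneg measurableSet_Ioo
    (hsub.trans h.subset) (fun u hu => h.F_bdd u (hsub hu)) (fun j u hu => h.G_bdd j u (hsub hu))
    fun u hu => h.J_bdd u (hsub hu)).trans
    (mul_le_mul_of_nonneg_left (measureReal_mono (subset_univ _)) h.nonneg)) _)

/-- Passing from ]a,t[ to ]a,t] adds only the jump at t. In the uniqueness proof this identifies
x(t) with the end value of its jump function. -/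
theorem IsDrivenCurve.sub_leftLim (hσ : ∀ j t, σ j {t} = 0)
    (h : IsDrivenCurve σ ν T a b C F G J c x) {t : ℝ} (ht : t ∈ Ioo a b) :
    x t - Function.leftLim x t = J t := by
  rw [h.leftLim_eq (Ioo_subset_Ioc_self ht), h.eq t ht, drive_Ioc hσ h.isDriver ht]
  abel

end Curve

theorem boundedVariationOn_Icc_union {E : Type*} [PseudoEMetricSpace E] {f : ℝ → E} {a b c : ℝ}
    (hab : a ≤ b) (hbc : b ≤ c) (h1 : BoundedVariationOn f (Icc a b))
    (h2 : BoundedVariationOn f (Icc b c)) : BoundedVariationOn f (Icc a c) := by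
  have h := eVariationOn.Icc_add_Icc f (s := univ) hab hbc (mem_univ b)
  simp only [univ_inter] at h
  rw [BoundedVariationOn, ← h]
  exact ENNReal.add_ne_top.mpr ⟨h1, h2⟩

/-! ### The path encoded by the jump functions -/

namespace DelayImpulseSystem

variable {n m : ℕ} (S : DelayImpulseSystem n m)

/-- `x` is the path encoded by the jump functions `ζ`. -/
structure IsPath (ζ : ℤ → ℝ → ℝ → EuclideanSpace ℝ (Fin n)) (x : ℝ → EuclideanSpace ℝ (Fin n)) :
    Prop where
  past : ∀ t ∈ Ico (-(S.M * S.h)) 0, x t = S.ξ₀ t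
  zero : x 0 = S.x₀
  interior : ∀ l : ℤ, 1 ≤ l → l ≤ S.N → ∀ t ∈ Ioo (((l : ℝ) - 1) * S.h) (l * S.h),
    x t = ζ l (t - ((l : ℝ) - 1) * S.h) 1
  start : ∀ l : ℤ, 2 ≤ l → l ≤ S.N + 1 → x (((l : ℝ) - 1) * S.h) = ζ l 0 1

/-- The path encoded by the jump functions. -/
noncomputable def path (ζ : ℤ → ℝ → ℝ → EuclideanSpace ℝ (Fin n)) (t : ℝ) :
    EuclideanSpace ℝ (Fin n) :=
  if t < 0 then S.ξ₀ t else if t = 0 then S.x₀ else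
    ζ (⌊t / S.h⌋ + 1) (t - ⌊t / S.h⌋ * S.h) 1

theorem floor_eq {l : ℤ} {t : ℝ} (ht : t ∈ Ico (((l : ℝ) - 1) * S.h) (l * S.h)) :
    ⌊t / S.h⌋ = l - 1 := by
  rw [Int.floor_eq_iff, le_div_iff₀ S.h_pos, div_lt_iff₀ S.h_pos]
  push_cast
  rw [sub_add_cancel]
  exact ht

theorem path_eq (ζ : ℤ → ℝ → ℝ → EuclideanSpace ℝ (Fin n)) {l : ℤ} {t : ℝ} (h0 : 0 < t)
    (ht : t ∈ Ico (((l : ℝ) - 1) * S.h) (l * S.h)) :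
    S.path ζ t = ζ l (t - ((l : ℝ) - 1) * S.h) 1 := by
  rw [path, if_neg h0.not_gt, if_neg h0.ne', S.floor_eq ht, sub_add_cancel]
  push_cast
  rfl

theorem isPath_path (ζ : ℤ → ℝ → ℝ → EuclideanSpace ℝ (Fin n)) : S.IsPath ζ (S.path ζ) where
  past t ht := if_pos ht.2
  zero := by simp [path]
  interior l h1 _ t ht := S.path_eq ζ ((start_nonneg h1).trans_lt ht.1) (Ioo_subset_Ico_self ht)
  start l h1 _ := by
    have h3 : (2 : ℝ) ≤ l := by exact_mod_cast h1
    have hh := S.h_pos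
    rw [S.path_eq (l := l) ζ (mul_pos (by linarith) hh) ⟨le_rfl, by nlinarith⟩, sub_self]

variable {S} {μ : VectorMeasure ℝ (Fin m → ℝ)} {ν : Measure ℝ} {ω : ℝ → ℤ → ℝ → (Fin m → ℝ)}
  {ζ ζ' : ℤ → ℝ → ℝ → EuclideanSpace ℝ (Fin n)} {x x' : ℝ → EuclideanSpace ℝ (Fin n)}

theorem mem_Icc_cases {t : ℝ} (ht : t ∈ Icc 0 S.T) : t = 0 ∨
    (∃ l : ℤ, 1 ≤ l ∧ l ≤ S.N ∧ t ∈ Ioo (((l : ℝ) - 1) * S.h) (l * S.h)) ∨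
    ∃ l : ℤ, 2 ≤ l ∧ l ≤ S.N + 1 ∧ t = ((l : ℝ) - 1) * S.h := by
  have hh := S.h_pos
  have h1 := Int.floor_le (t / S.h)
  have h2 := Int.lt_floor_add_one (t / S.h)
  have h3 : 0 ≤ ⌊t / S.h⌋ := Int.floor_nonneg.mpr (div_nonneg ht.1 hh.le)
  have h4 : ⌊t / S.h⌋ ≤ S.N := by
    have : t / S.h ≤ S.N := (div_le_iff₀ hh).mpr ht.2
    exact_mod_cast Int.floor_le_iff.mpr (lt_of_le_of_lt this (by simp))
  set k := ⌊t / S.h⌋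
  rw [le_div_iff₀ hh] at h1
  rw [div_lt_iff₀ hh] at h2
  rcases h1.eq_or_lt with h5 | h5
  · rcases h3.eq_or_lt with h6 | h6
    · left
      rw [← h5, ← h6]
      simp
    · refine Or.inr (Or.inr ⟨k + 1, by omega, by omega, ?_⟩)
      push_cast
      rw [add_sub_cancel_right, h5]
  · refine Or.inr (Or.inl ⟨k + 1, by omega, ?_, ?_⟩)
    · by_contra hlt
      have h6 : k = S.N := by omega
      rw [h6] at h5
      exact absurd ht.2 (not_le.mpr (by simpa [T] using h5))
    · push_cast
      rw [add_sub_cancel_right]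
      exact ⟨h5, h2⟩

theorem IsPath.eqOn (h : S.IsPath ζ x) (h' : S.IsPath ζ' x')
    (heq : ∀ l : ℤ, 1 ≤ l → l ≤ S.N → ∀ r ∈ Icc 0 S.h, ζ l r 1 = ζ' l r 1)
    (hlast : ζ (S.N + 1) 0 1 = ζ' (S.N + 1) 0 1) : EqOn x x' (Icc (-(S.M * S.h)) S.T) := by
  intro t ht
  rcases lt_or_ge t 0 with h0 | h0
  · rw [h.past t ⟨ht.1, h0⟩, h'.past t ⟨ht.1, h0⟩]
  rcases mem_Icc_cases ⟨h0, ht.2⟩ with rfl | ⟨l, h1, h2, h3⟩ | ⟨l, h1, h2, rfl⟩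
  · rw [h.zero, h'.zero]
  · rw [h.interior l h1 h2 t h3, h'.interior l h1 h2 t h3,
      heq l h1 h2 _ (Ioo_subset_Icc_self (sub_start_mem_Ioo.mpr h3))]
  · rw [h.start l h1 h2, h'.start l h1 h2]
    rcases h2.eq_or_lt with rfl | hlt
    · exact hlast
    · exact heq l (by omega) (by omega) 0 (left_mem_Icc.mpr S.h_pos.le)

/-- The instant t - kh has the same offset r in step l - k as t in step l, so x(t - kh) =
ζ^r_{l-k}(1). For an index l - k ≤ 0 both are values of ξ₀, because 0 < r < h avoids the exceptional
value at r = h. -/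
theorem IsPath.delayed_eq (hx : S.IsPath ζ x) (h : S.IsPast ζ) {l : ℤ} (h1 : 1 ≤ l) (h2 : l ≤ S.N)
    {t : ℝ} (ht : t ∈ Ioo (((l : ℝ) - 1) * S.h) (l * S.h)) :
    S.delayed x t = S.stateArg t (ζ l (t - ((l : ℝ) - 1) * S.h) 1)
      (S.pastStates ζ l (t - ((l : ℝ) - 1) * S.h) 1) := by
  have hh := S.h_pos
  rw [← stateArg_pastStates, delayed]
  congr 1
  funext k
  have hr := sub_start_mem_Ioo.mpr ht
  have hk : ((k : ℕ) : ℤ) ≤ S.M := by have := k.2; omega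
  have htime : t - (k : ℕ) * S.h - (((l - (k : ℕ) : ℤ) : ℝ) - 1) * S.h =
      t - ((l : ℝ) - 1) * S.h := by
    push_cast
    ring
  rcases le_or_gt (l - (k : ℕ)) 0 with h0 | h0
  · have htime' : t - ((l : ℝ) - 1) * S.h + (((l - (k : ℕ) : ℤ) : ℝ) - 1) * S.h =
        t - (k : ℕ) * S.h := by linarith
    rw [h.eq (by omega) h0 (Ioo_subset_Icc_self hr) (right_mem_Icc.mpr zero_le_one) (Or.inr hr.2),
      htime']
    refine hx.past _ ⟨?_, ?_⟩
    · have h3 := start_nonneg (S := S) h1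
      have h4 : ((k : ℕ) : ℝ) ≤ S.M := by exact_mod_cast hk
      have := mul_le_mul_of_nonneg_right h4 hh.le
      linarith [ht.1]
    · have h4 : (l : ℝ) ≤ (k : ℕ) := by exact_mod_cast (by omega : l ≤ ((k : ℕ) : ℤ))
      have := mul_le_mul_of_nonneg_right h4 hh.le
      linarith [ht.2]
  · rw [← htime]
    refine hx.interior _ (by omega) (by omega) _ (sub_start_mem_Ioo.mp ?_)
    rw [htime]
    exact hr

end DelayImpulseSystem

/-! ### The state component of an impulse solution -/

namespace DelayImpulseSystem

variable {n m : ℕ} {S : DelayImpulseSystem n m} {μ : VectorMeasure ℝ (Fin m → ℝ)} {ν : Measure ℝ}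
  {ω : ℝ → ℤ → ℝ → (Fin m → ℝ)} {ζ : ℤ → ℝ → ℝ → EuclideanSpace ℝ (Fin n)}
  {x : ℝ → EuclideanSpace ℝ (Fin n)} {C : ℝ}

variable (S) in
/-- The curve `x` is driven on `](l-1)h, lh[` by the dynamics along `x` and the jumps of `ζ`. -/
def IsDrivenStep (μ : VectorMeasure ℝ (Fin m → ℝ)) (ν : Measure ℝ) (C : ℝ)
    (ζ : ℤ → ℝ → ℝ → EuclideanSpace ℝ (Fin n)) (x : ℝ → EuclideanSpace ℝ (Fin n)) (l : ℤ) : Prop :=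
  IsDrivenCurve (fun j => coordMeasure (contPart μ) j) ν S.T (((l : ℝ) - 1) * S.h) (l * S.h) C
    (fun t => S.f (S.delayed x t)) (fun j t => S.g j (S.delayed x t))
    (fun t => ζ l (t - ((l : ℝ) - 1) * S.h) 1 - ζ l (t - ((l : ℝ) - 1) * S.h) 0) (ζ l 0 1) x

/-- The integral equation `heq` may assume integrability, because splitting off the jump at t
requires it; integrability itself follows from boundedness and measurability. -/
theorem IsImpulseControl.isDrivenStep (hc : S.IsImpulseControl μ ν ω) (hC0 : 0 ≤ C)
    (hf : ∀ p, ‖S.f p‖ ≤ C) (hg : ∀ j p, ‖S.g j p‖ ≤ C) {l : ℤ} (h1 : 1 ≤ l) (h2 : l ≤ S.N)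
    (hjump : ∀ r ∈ Icc 0 S.h, S.IsJumpSolution ω ζ l r (ζ l r))
    (hmeas : ∀ H : ℝ × (Fin (S.M + 1) → EuclideanSpace ℝ (Fin n)) → EuclideanSpace ℝ (Fin n),
      Continuous H → Measurable ((Ioo (((l : ℝ) - 1) * S.h) (l * S.h)).indicator
        fun t => H (S.delayed x t)))
    (heq : IsDriver (fun j => coordMeasure (contPart μ) j)
      (Ioo (((l : ℝ) - 1) * S.h) (l * S.h)) (fun t => S.f (S.delayed x t))
      (fun j t => S.g j (S.delayed x t))
      (fun t => ζ l (t - ((l : ℝ) - 1) * S.h) 1 - ζ l (t - ((l : ℝ) - 1) * S.h) 0) →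
      ∀ t ∈ Ioo (((l : ℝ) - 1) * S.h) (l * S.h), x t = ζ l 0 1 +
        drive (fun j => coordMeasure (contPart μ) j) (fun t => S.f (S.delayed x t))
          (fun j t => S.g j (S.delayed x t))
          (fun t => ζ l (t - ((l : ℝ) - 1) * S.h) 1 - ζ l (t - ((l : ℝ) - 1) * S.h) 0)
          (Ioc (((l : ℝ) - 1) * S.h) t)) :
    S.IsDrivenStep μ ν C ζ x l := by
  have := hc.memVc.finite
  have hsub : Ioo (((l : ℝ) - 1) * S.h) (l * S.h) ⊆ Icc 0 S.T :=
    (Ioo_subset_Ioc_self.trans (Ioc_step_subset h1 h2)).trans Ioc_subset_Icc_self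
  have hJ : ∀ t ∈ Ioo (((l : ℝ) - 1) * S.h) (l * S.h),
      ‖ζ l (t - ((l : ℝ) - 1) * S.h) 1 - ζ l (t - ((l : ℝ) - 1) * S.h) 0‖ ≤ C * ν.real {t} := by
    intro t ht
    have hr := Ioo_subset_Icc_self (sub_start_mem_Ioo.mpr ht)
    have h3 := hc.attachedMass_le hr h1 h2
    rw [time_sub_start] at h3
    exact ((hjump _ hr).norm_sub_le hc hC0 hg hr (right_mem_Icc.mpr zero_le_one)).trans
      (mul_le_mul_of_nonneg_left h3 hC0)
  have hd := isDriver_of_bdd (σ := fun j => coordMeasure (contPart μ) j) measurableSet_Ioo hsub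
    (hmeas S.f S.f_contDiff.continuous) (fun j => hmeas (S.g j) (S.g_contDiff j).continuous)
    (fun t _ => hf _) (fun j t _ => hg j _) hJ
  exact ⟨hd, hC0, hsub, fun t _ => hf _, fun j t _ => hg j _, hJ, heq hd⟩

theorem flowDrive_eq_drive (hx : S.IsPath ζ x) (h : S.IsPast ζ) {l : ℤ} (h1 : 1 ≤ l)
    (h2 : l ≤ S.N) {t : ℝ} (ht : t ≤ l * S.h) :
    S.flowDrive μ ζ l (Ioo (((l : ℝ) - 1) * S.h) t) =
      drive (fun j => coordMeasure (contPart μ) j) (fun t => S.f (S.delayed x t))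
        (fun j t => S.g j (S.delayed x t))
        (fun t => ζ l (t - ((l : ℝ) - 1) * S.h) 1 - ζ l (t - ((l : ℝ) - 1) * S.h) 0)
        (Ioo (((l : ℝ) - 1) * S.h) t) := by
  have heq : ∀ s ∈ Ioo (((l : ℝ) - 1) * S.h) t, _ := fun s hs =>
    hx.delayed_eq h h1 h2 (Ioo_subset_Ioo_right ht hs)
  refine drive_congr (coordMeasure_contPart_singleton μ) measurableSet_Ioo countable_empty
    (fun s hs _ => ?_) (fun j s hs _ => ?_) (fun s _ => rfl)
  · rw [heq s hs]
  · rw [heq s hs]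

theorem IsFlow.isDrivenStep (hc : S.IsImpulseControl μ ν ω) (h : S.IsFlow μ ω ζ)
    (hx : S.IsPath ζ x) (hC0 : 0 ≤ C) (hf : ∀ p, ‖S.f p‖ ≤ C) (hg : ∀ j p, ‖S.g j p‖ ≤ C)
    {l : ℤ} (h1 : 1 ≤ l) (h2 : l ≤ S.N) : S.IsDrivenStep μ ν C ζ x l := by
  refine hc.isDrivenStep hC0 hf hg h1 h2 (h.step l h1 h2).jump (fun H hH => ?_)
    fun hd t ht => ?_
  · have hy := (h.regular l h1 h2).measurable_end.comp
      (measurable_id.sub_const (((l : ℝ) - 1) * S.h))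
    convert measurable_indicator_comp_stateArg (ζ := ζ) (l := l)
      (fun k hk hkl => (h.isRegular (k := k) (by omega) (by omega)).measurable_end) hH hy using 1
    refine indicator_congr fun t ht => ?_
    rw [hx.delayed_eq h.past h1 h2 ht]
    congr 2
    exact (indicator_of_mem (sub_start_mem_Ioo.mpr ht) (fun r => ζ l r 1)).symm
  -- The flow equation gives ζ(0) as the integral over the open interval; adding the jump ζ(1) -
  -- ζ(0) at t gives ζ(1), which is x(t).
  · rw [drive_Ioc (coordMeasure_contPart_singleton μ) hd ht,
      ← flowDrive_eq_drive hx h.past h1 h2 ht.2.le, ← add_assoc,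
      ← (h.step l h1 h2).flow t (Ioo_subset_Ioc_self ht), add_sub_cancel,
      hx.interior l h1 h2 t ht]

theorem IsFlow.leftLim_eq (hc : S.IsImpulseControl μ ν ω) (h : S.IsFlow μ ω ζ)
    (hx : S.IsPath ζ x) {l : ℤ} (h1 : 1 ≤ l) (h2 : l ≤ S.N) {t : ℝ}
    (ht : t ∈ Ioc (((l : ℝ) - 1) * S.h) (l * S.h)) :
    Function.leftLim x t = ζ l (t - ((l : ℝ) - 1) * S.h) 0 := by
  have := hc.memVc.finite
  obtain ⟨C, hC0, hf, hg⟩ := S.exists_field_bound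
  rw [(h.isDrivenStep hc hx hC0 hf hg h1 h2).leftLim_eq ht, (h.step l h1 h2).flow t ht,
    flowDrive_eq_drive hx h.past h1 h2 ht.2]

theorem time_mem_Ioc {l : ℤ} {r : ℝ} (hr : r ∈ Ioc 0 S.h) :
    S.time l r ∈ Ioc (((l : ℝ) - 1) * S.h) (l * S.h) := by
  rw [← sub_start_mem_Ioc, time, add_sub_cancel_right]
  exact hr

theorem jumpField_last : S.jumpField ω ζ (S.N + 1) 0 = 0 := by
  funext s
  rw [jumpField, attached_of_not (by omega)]
  simp

theorem IsFlow.isStateJump (hc : S.IsImpulseControl μ ν ω) (h : S.IsFlow μ ω ζ)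
    (hx : S.IsPath ζ x) : S.IsStateJump ω x ζ where
  past_zero := h.past.zero
  past_zero_end := h.past.zero_end
  past_neg := h.past.neg
  initial_pos l r hl hr := by
    rcases hl with ⟨h1, h2, h3⟩ | ⟨-, rfl⟩
    · rw [h.leftLim_eq hc hx h1 h2 (time_mem_Ioc ⟨hr, h3.2⟩), time, add_sub_cancel_right]
    · exact absurd hr (lt_irrefl 0)
  initial_zero l hl := by
    rcases hl with ⟨h1, h2, -⟩ | ⟨rfl, -⟩
    · exact (h.step l h1 h2).init
    · rw [add_sub_cancel_right]
      exact h.last 0 (left_mem_Icc.mpr zero_le_one)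
  integrable l r hl := by
    rcases hl with ⟨h1, h2, h3⟩ | ⟨rfl, rfl⟩
    · rw [jumpField_eq]
      exact ((h.step l h1 h2).jump r h3).integrable
    · rw [jumpField_last]
      exact intervalIntegrable_const
  equation l r hl s hs := by
    rcases hl with ⟨h1, h2, h3⟩ | ⟨rfl, rfl⟩
    · rw [jumpField_eq]
      exact ((h.step l h1 h2).jump r h3).equation s hs
    · rw [jumpField_last, h.last s hs, h.last 0 (left_mem_Icc.mpr zero_le_one)]
      simp

theorem IsDrivenStep.dynamics {l : ℤ} (h : S.IsDrivenStep μ ν C ζ x l)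
    (hl : ∀ t ∈ Ioc (((l : ℝ) - 1) * S.h) (l * S.h),
      Function.leftLim x t = ζ l (t - ((l : ℝ) - 1) * S.h) 0) {t : ℝ}
    (ht : t ∈ Ioo (((l : ℝ) - 1) * S.h) (l * S.h)) :
    (Summable fun r : Ioc 0 (t - ((l : ℝ) - 1) * S.h) =>
      ζ l r 1 - Function.leftLim x (S.time l r)) ∧
    x t = ζ l 0 1
      + (∫ t' in (((l : ℝ) - 1) * S.h)..t, S.f (S.delayed x t'))
      + (∑ j, ∫ᵛ t' in Icc (((l : ℝ) - 1) * S.h) t,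
          S.g j (S.delayed x t') ∂<•(coordMeasure (contPart μ) j))
      + (∑' r : Ioc 0 (t - ((l : ℝ) - 1) * S.h),
          (ζ l r 1 - Function.leftLim x (S.time l r))) := by
  have heq : (fun r : Ioc 0 (t - ((l : ℝ) - 1) * S.h) =>
      ζ l r 1 - Function.leftLim x (S.time l r)) = fun r : Ioc 0 (t - ((l : ℝ) - 1) * S.h) =>
      ζ l ((r : ℝ) + ((l : ℝ) - 1) * S.h - ((l : ℝ) - 1) * S.h) 1 -
        ζ l ((r : ℝ) + ((l : ℝ) - 1) * S.h - ((l : ℝ) - 1) * S.h) 0 := by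
    funext r
    have hr : (r : ℝ) ∈ Ioc 0 S.h := ⟨r.2.1, r.2.2.trans (sub_start_mem_Ioo.mpr ht).2.le⟩
    rw [hl _ (time_mem_Ioc hr), time, add_sub_cancel_right]
  rw [heq]
  refine ⟨IsDrivenCurve.summable h ht, ?_⟩
  rw [IsDrivenCurve.eq h t ht, drive_Ioc_eq (coordMeasure_contPart_singleton μ) ht.1.le]
  abel

theorem IsFlow.boundedVariationOn (hc : S.IsImpulseControl μ ν ω) (h : S.IsFlow μ ω ζ)
    (hx : S.IsPath ζ x) : BoundedVariationOn x (Icc 0 S.T) := by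
  have := hc.memVc.finite
  have hh := S.h_pos
  obtain ⟨C, hC0, hf, hg⟩ := S.exists_field_bound
  have hstep : ∀ l : ℤ, 1 ≤ l → l ≤ S.N →
      BoundedVariationOn x (Icc (((l : ℝ) - 1) * S.h) (l * S.h)) := by
    intro l h1 h2
    have hd := h.isDrivenStep hc hx hC0 hf hg h1 h2
    obtain ⟨B, hB⟩ := (h.regular l h1 h2).bdd
    set a : ℝ := ((l : ℝ) - 1) * S.h
    refine boundedVariationOn_Icc_of_Ioo
      (W := fun t => C * (driveMeasure (fun j => coordMeasure (contPart μ) j) ν S.T).real (Iic t))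
      (B := C * (driveMeasure (fun j => coordMeasure (contPart μ) j) ν S.T).real univ)
      (R := max B (max ‖x a‖ ‖x (l * S.h)‖)) (fun t _ => ?_) (fun t ht => ?_)
      fun s hs t ht hst => hd.norm_increment_le hs ht hst
    · rw [abs_of_nonneg (mul_nonneg hC0 measureReal_nonneg)]
      exact mul_le_mul_of_nonneg_left (measureReal_mono (subset_univ _)) hC0
    · rcases ht.1.eq_or_lt with rfl | h3
      · exact (le_max_left _ _).trans (le_max_right _ _)
      rcases ht.2.eq_or_lt with rfl | h4
      · exact (le_max_right _ _).trans (le_max_right _ _)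
      · rw [hx.interior l h1 h2 t ⟨h3, h4⟩]
        exact (hB _ (Ioo_subset_Icc_self (sub_start_mem_Ioo.mpr ⟨h3, h4⟩)) 1
          (right_mem_Icc.mpr zero_le_one)).trans (le_max_left _ _)
  have key : ∀ L : ℕ, L ≤ S.N → BoundedVariationOn x (Icc 0 (L * S.h)) := by
    intro L
    induction L with
    | zero =>
      intro _
      exact BoundedVariationOn.of_subsingleton (subsingleton_Icc_of_ge (by simp))
    | succ L ih =>
      intro hL
      have h3 := hstep (L + 1) (by omega) (by omega)
      push_cast at h3
      rw [add_sub_cancel_right] at h3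
      push_cast
      exact boundedVariationOn_Icc_union (by positivity) (by nlinarith) (ih (by omega)) h3
  exact key S.N le_rfl

theorem IsFlow.boundedVariationOn_of_past (hc : S.IsImpulseControl μ ν ω) (h : S.IsFlow μ ω ζ)
    (hx : S.IsPath ζ x) (hξ : BoundedVariationOn S.ξ₀ (Icc (-(S.M * S.h)) 0)) :
    BoundedVariationOn x (Icc (-(S.M * S.h)) S.T) := by
  have hT : 0 ≤ S.T := mul_nonneg (Nat.cast_nonneg _) S.h_pos.le
  exact boundedVariationOn_Icc_union S.neg_delay_le hT
    (boundedVariationOn_congr_Ico hξ fun t ht => (hx.past t ht).symm) (h.boundedVariationOn hc hx)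

theorem IsFlow.isImpulseSolution (hc : S.IsImpulseControl μ ν ω) (h : S.IsFlow μ ω ζ)
    (hx : S.IsPath ζ x) : S.IsImpulseSolution μ ν ω x (variationPath ν) where
  boundedVariation_x := h.boundedVariationOn hc hx
  boundedVariation_v := by
    have := hc.memVc.finite
    exact boundedVariationOn_variationPath S.T
  past := hx.past
  initial_x := hx.zero
  initial_v := if_pos rfl
  dynamics := by
    obtain ⟨C, hC0, hf, hg⟩ := S.exists_field_bound
    refine ⟨ζ, S.variationJump ν ω, h.isStateJump hc hx, hc.isVariationJump,
      fun l h1 h2 => ⟨hx.start l h1 h2, hc.variationPath_start h1 h2⟩, fun l h1 h2 t ht => ?_⟩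
    obtain ⟨h3, h4⟩ := (h.isDrivenStep hc hx hC0 hf hg h1 h2).dynamics
      (fun t ht => h.leftLim_eq hc hx h1 h2 ht) ht
    obtain ⟨h5, h6⟩ := hc.variationPath_interior h1 h2 ht
    exact ⟨h3, h4, h5, h6⟩

/-! ### Uniqueness -/

/-- Bounded variation makes an arbitrary solution measurable on [0,T], and the continuous datum
takes care of negative times. Without this the integrals of the fields along x could not be split.
-/
theorem exists_measurable_eqOn (hbv : BoundedVariationOn x (Icc 0 S.T))
    (hpast : ∀ t ∈ Ico (-(S.M * S.h)) 0, x t = S.ξ₀ t) :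
    ∃ y : ℝ → EuclideanSpace ℝ (Fin n), Measurable y ∧ EqOn x y (Icc (-(S.M * S.h)) S.T) := by
  classical
  have hT : 0 ≤ S.T := mul_nonneg (Nat.cast_nonneg _) S.h_pos.le
  obtain ⟨ξ, hξ, hξe⟩ := S.exists_continuous_extension
  refine ⟨(Iio 0).piecewise ξ ((Icc 0 S.T).indicator x), hξ.measurable.piecewise measurableSet_Iio
    (measurable_indicator_of_boundedVariationOn hT hbv), fun t ht => ?_⟩
  rcases lt_or_ge t 0 with h0 | h0
  · rw [piecewise_eq_of_mem _ _ _ (mem_Iio.mpr h0), hpast t ⟨ht.1, h0⟩, hξe ⟨ht.1, h0.le⟩]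
  · rw [piecewise_eq_of_notMem _ _ _ (fun h => (mem_Iio.mp h).not_ge h0), indicator_of_mem (show t ∈ Icc 0 S.T from ⟨h0, ht.2⟩)]

theorem measurable_indicator_comp_delayed {y : ℝ → EuclideanSpace ℝ (Fin n)} (hy : Measurable y)
    (hxy : EqOn x y (Icc (-(S.M * S.h)) S.T)) {l : ℤ} (h1 : 1 ≤ l) (h2 : l ≤ S.N)
    {H : ℝ × (Fin (S.M + 1) → EuclideanSpace ℝ (Fin n)) → EuclideanSpace ℝ (Fin n)}
    (hH : Continuous H) :
    Measurable ((Ioo (((l : ℝ) - 1) * S.h) (l * S.h)).indicator fun t => H (S.delayed x t)) := by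
  have hm : Measurable fun t => H (S.delayed y t) := by
    refine hH.measurable.comp (Measurable.prodMk measurable_id (measurable_pi_lambda _ fun k => ?_))
    exact hy.comp (measurable_id.sub_const _)
  convert hm.indicator (measurableSet_Ioo (a := ((l : ℝ) - 1) * S.h) (b := l * S.h)) using 1
  refine indicator_congr fun t ht => ?_
  have ht' := Ioc_step_subset h1 h2 (Ioo_subset_Ioc_self ht)
  rw [delayed, delayed]
  congr 2
  funext k
  have hk : ((k : ℕ) : ℝ) ≤ S.M := by exact_mod_cast (by have := k.2; omega : (k : ℕ) ≤ S.M)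
  have h3 := mul_le_mul_of_nonneg_right hk S.h_pos.le
  have h4 : 0 ≤ ((k : ℕ) : ℝ) * S.h := mul_nonneg (Nat.cast_nonneg _) S.h_pos.le
  exact hxy ⟨by linarith [ht'.1], by linarith [ht'.2]⟩

theorem IsStateJump.isJumpSolution (h : S.IsStateJump ω x ζ) {l : ℤ} (h1 : 1 ≤ l) (h2 : l ≤ S.N)
    {r : ℝ} (hr : r ∈ Icc 0 S.h) : S.IsJumpSolution ω ζ l r (ζ l r) := by
  refine ⟨?_, fun s hs => ?_⟩
  · rw [← jumpField_eq]
    exact h.integrable l r (Or.inl ⟨h1, h2, hr⟩)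
  · rw [← jumpField_eq]
    exact h.equation l r (Or.inl ⟨h1, h2, hr⟩) s hs

theorem IsStateJump.isPast (h : S.IsStateJump ω x ζ) : S.IsPast ζ :=
  ⟨h.past_zero, h.past_zero_end, h.past_neg⟩

theorem IsJumpSolution.aemeasurable {l : ℤ} {r : ℝ} {z : ℝ → EuclideanSpace ℝ (Fin n)}
    (h : S.IsJumpSolution ω ζ l r z) : AEMeasurable z (volume.restrict (Ioc 0 1)) := by
  have h1 := intervalIntegral.continuousOn_primitive_interval' h.integrable
    (left_mem_uIcc (a := (0 : ℝ)) (b := 1))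
  rw [uIcc_of_le zero_le_one] at h1
  have h2 : ContinuousOn z (Icc 0 1) := (continuousOn_const.add h1).congr h.equation
  exact (h2.mono Ioc_subset_Icc_self).aemeasurable measurableSet_Ioc

/-- The converse of `IsFlow.isImpulseSolution`: the left limits required in the definition of a
solution are the initial values of its jump functions, so its dynamics become the flow equation and
uniqueness reduces to that of flows. -/
theorem IsImpulseControl.isFlow_of_isStateJump (hc : S.IsImpulseControl μ ν ω)
    (hbv : BoundedVariationOn x (Icc 0 S.T)) (hpast : ∀ t ∈ Ico (-(S.M * S.h)) 0, x t = S.ξ₀ t)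
    (hx0 : x 0 = S.x₀) (hζ : S.IsStateJump ω x ζ)
    (hstart : ∀ l : ℤ, 2 ≤ l → l ≤ S.N + 1 → x (((l : ℝ) - 1) * S.h) = ζ l 0 1)
    (hint : ∀ l : ℤ, 1 ≤ l → l ≤ S.N → ∀ t ∈ Ioo (((l : ℝ) - 1) * S.h) (l * S.h), x t = ζ l 0 1
      + (∫ t' in (((l : ℝ) - 1) * S.h)..t, S.f (S.delayed x t'))
      + (∑ j, ∫ᵛ t' in Icc (((l : ℝ) - 1) * S.h) t,
          S.g j (S.delayed x t') ∂<•(coordMeasure (contPart μ) j))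
      + (∑' r : Ioc 0 (t - ((l : ℝ) - 1) * S.h),
          (ζ l r 1 - Function.leftLim x (S.time l r)))) :
    S.IsFlow μ ω ζ ∧ S.IsPath ζ x := by
  have := hc.memVc.finite
  have hσ := coordMeasure_contPart_singleton μ
  have hone : (1 : ℝ) ∈ Icc (0 : ℝ) 1 := right_mem_Icc.mpr zero_le_one
  obtain ⟨C, hC0, hf, hg⟩ := S.exists_field_bound
  obtain ⟨y, hy, hxy⟩ := exists_measurable_eqOn hbv hpast
  have hzero : ∀ l : ℤ, 1 ≤ l → l ≤ S.N → ∀ r ∈ Ioc 0 S.h,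
      Function.leftLim x (S.time l r) = ζ l r 0 := fun l h1 h2 r hr =>
    (hζ.initial_pos l r (Or.inl ⟨h1, h2, Ioc_subset_Icc_self hr⟩) hr.1).symm
  have hstep : ∀ l : ℤ, 1 ≤ l → l ≤ S.N → S.IsDrivenStep μ ν C ζ x l := by
    intro l h1 h2
    refine hc.isDrivenStep hC0 hf hg h1 h2 (fun r hr => hζ.isJumpSolution h1 h2 hr)
      (fun H hH => measurable_indicator_comp_delayed hy hxy h1 h2 hH) fun _ t ht => ?_
    rw [drive_Ioc_eq hσ ht.1.le, hint l h1 h2 t ht, add_assoc, add_assoc, add_assoc]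
    congr 3
    refine tsum_congr fun r => ?_
    have hr : (r : ℝ) ∈ Ioc 0 S.h := ⟨r.2.1, r.2.2.trans (sub_start_mem_Ioo.mpr ht).2.le⟩
    rw [hzero l h1 h2 r hr, add_sub_cancel_right]
  have hlim : ∀ l : ℤ, 1 ≤ l → l ≤ S.N → ∀ t ∈ Ioc (((l : ℝ) - 1) * S.h) (l * S.h),
      Function.leftLim x t = ζ l (t - ((l : ℝ) - 1) * S.h) 0 := by
    intro l h1 h2 t ht
    rw [← hzero l h1 h2 _ (sub_start_mem_Ioc.mpr ht), time_sub_start]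
  have hpath : S.IsPath ζ x := by
    refine ⟨hpast, hx0, fun l h1 h2 t ht => ?_, hstart⟩
    have h3 := IsDrivenCurve.sub_leftLim hσ (hstep l h1 h2) ht
    rw [hlim l h1 h2 t (Ioo_subset_Ioc_self ht)] at h3
    exact sub_left_inj.mp h3
  refine ⟨⟨hζ.isPast, fun l h1 h2 => ⟨?_, fun r hr => hζ.isJumpSolution h1 h2 hr,
    fun t ht => ?_⟩, fun l h1 h2 => ⟨?_, fun r hr => ?_, ?_⟩, fun s hs => ?_⟩, hpath⟩
  · exact hζ.initial_zero l (Or.inl ⟨h1, h2, left_mem_Icc.mpr S.h_pos.le⟩)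
  · rw [← hlim l h1 h2 t ht, IsDrivenCurve.leftLim_eq (hstep l h1 h2) ht,
      flowDrive_eq_drive hpath hζ.isPast h1 h2 ht.2]
  -- The initial value is ζ^0_l(0) for r = 0 and a left limit of x for r > 0, bounded by
  -- `norm_leftLim_le`; the jump function then moves by at most C ν(ℝ).
  · refine ⟨max ‖ζ l 0 0‖ (‖ζ l 0 1‖ +
      C * (driveMeasure (fun j => coordMeasure (contPart μ) j) ν S.T).real univ) +
      C * ν.real univ, fun r hr s hs => ?_⟩
    have h3 := (hζ.isJumpSolution h1 h2 hr).norm_sub_le hc hC0 hg hr hs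
    have h4 : S.attachedMass ω r l ≤ ν.real univ := (hc.attachedMass_le hr h1 h2).trans
      (measureReal_mono (subset_univ _))
    have h5 : ‖ζ l r 0‖ ≤ max ‖ζ l 0 0‖ (‖ζ l 0 1‖ +
        C * (driveMeasure (fun j => coordMeasure (contPart μ) j) ν S.T).real univ) := by
      rcases hr.1.eq_or_lt with rfl | h0
      · exact le_max_left _ _
      · rw [← hzero l h1 h2 r ⟨h0, hr.2⟩]
        exact (IsDrivenCurve.norm_leftLim_le (hstep l h1 h2) (time_mem_Ioc ⟨h0, hr.2⟩)).trans
          (le_max_right _ _)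
    calc ‖ζ l r s‖ = ‖ζ l r 0 + (ζ l r s - ζ l r 0)‖ := by rw [add_sub_cancel]
      _ ≤ ‖ζ l r 0‖ + ‖ζ l r s - ζ l r 0‖ := norm_add_le _ _
      _ ≤ _ := add_le_add h5 (h3.trans (mul_le_mul_of_nonneg_left h4 hC0))
  · exact (hζ.isJumpSolution h1 h2 hr).aemeasurable
  -- Inside the step ζ^r_l(1) is the value of x, which agrees there with the measurable function y.
  · convert (hy.comp (measurable_id.add_const (((l : ℝ) - 1) * S.h))).indicator
      (measurableSet_Ioo (a := (0 : ℝ)) (b := S.h)) using 1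
    refine indicator_congr fun r hr => ?_
    have ht : r + ((l : ℝ) - 1) * S.h ∈ Ioo (((l : ℝ) - 1) * S.h) (l * S.h) := by
      rw [← sub_start_mem_Ioo, add_sub_cancel_right]
      exact hr
    have h3 := Ioc_step_subset h1 h2 (Ioo_subset_Ioc_self ht)
    have h4 := hpath.interior l h1 h2 _ ht
    rw [add_sub_cancel_right] at h4
    rw [← h4]
    exact hxy ⟨S.neg_delay_le.trans h3.1.le, h3.2⟩
  · have hidx : S.IsJumpIndex (S.N + 1) 0 := Or.inr ⟨rfl, rfl⟩
    rw [hζ.equation _ _ hidx s hs, jumpField_last, hζ.initial_zero _ hidx, add_sub_cancel_right]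
    simp

theorem IsImpulseSolution.eqOn (hc : S.IsImpulseControl μ ν ω) (hflow : S.IsFlow μ ω ζ)
    (hpath : S.IsPath ζ x) {x' : ℝ → EuclideanSpace ℝ (Fin n)} {v' : ℝ → ℝ}
    (h : S.IsImpulseSolution μ ν ω x' v') :
    EqOn x' x (Icc (-(S.M * S.h)) S.T) ∧ EqOn v' (variationPath ν) (Icc 0 S.T) := by
  have hone : (1 : ℝ) ∈ Icc (0 : ℝ) 1 := right_mem_Icc.mpr zero_le_one
  obtain ⟨ζ', θ, hζ, hθ, hstart, hint⟩ := h.dynamics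
  constructor
  · obtain ⟨hflow', hpath'⟩ := hc.isFlow_of_isStateJump h.boundedVariation_x h.past h.initial_x hζ
      (fun l h1 h2 => (hstart l h1 h2).1) (fun l h1 h2 t ht => (hint l h1 h2 t ht).2.1)
    have huniq : ∀ l : ℤ, 1 ≤ l → l ≤ S.N → ∀ r ∈ Icc 0 S.h, ζ' l r 1 = ζ l r 1 :=
      fun l h1 h2 r hr => hflow'.unique hc hflow h1 h2 r hr hone
    refine hpath'.eqOn hpath huniq ?_
    rw [hflow'.last 1 hone, hflow.last 1 hone]
    exact huniq S.N (by exact_mod_cast S.one_le_N) le_rfl S.h (right_mem_Icc.mpr S.h_pos.le)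
  · obtain ⟨h3, h4⟩ := hc.variation_unique hθ fun l h1 h2 t ht => (hint l h1 h2 t ht).2.2.2
    intro t ht
    rcases mem_Icc_cases ht with rfl | ⟨l, h1, h2, h5⟩ | ⟨l, h1, h2, rfl⟩
    · rw [h.initial_v, variationPath, if_pos rfl]
    · rw [h4 l h1 h2 t h5, variationPath, if_neg ((start_nonneg h1).trans_lt h5.1).ne']
    · rw [(hstart l h1 h2).2, h3 l (by omega) h2, variationPath, if_neg]
      have h6 : (2 : ℝ) ≤ l := by exact_mod_cast h1
      exact (mul_pos (by linarith) S.h_pos).ne'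

end DelayImpulseSystem

/-- Every impulse control has an impulse solution `(x, v)`, and it is unique on `[-Mh,T] × [0,T]`;
`x` has bounded variation on all of `[-Mh, T]` as soon as the initial datum has. -/
theorem mainTheorem5 {n m : ℕ} (S : DelayImpulseSystem n m)
    (μ : MeasureTheory.VectorMeasure ℝ (Fin m → ℝ)) (ν : MeasureTheory.Measure ℝ)
    (ω : ℝ → ℤ → ℝ → (Fin m → ℝ)) (hcontrol : S.IsImpulseControl μ ν ω) :
    ∃ (x : ℝ → EuclideanSpace ℝ (Fin n)) (v : ℝ → ℝ),
      S.IsImpulseSolution μ ν ω x v ∧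
      (BoundedVariationOn S.ξ₀ (Set.Icc (-(S.M * S.h)) 0) →
        BoundedVariationOn x (Set.Icc (-(S.M * S.h)) S.T)) ∧
      ∀ (x' : ℝ → EuclideanSpace ℝ (Fin n)) (v' : ℝ → ℝ),
        S.IsImpulseSolution μ ν ω x' v' →
          Set.EqOn x' x (Set.Icc (-(S.M * S.h)) S.T) ∧ Set.EqOn v' v (Set.Icc 0 S.T) := by
  obtain ⟨ζ, hζ⟩ := hcontrol.exists_flow
  have hx := S.isPath_path ζ
  exact ⟨S.path ζ, DelayImpulseSystem.variationPath ν, hζ.isImpulseSolution hcontrol hx,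
    hζ.boundedVariationOn_of_past hcontrol hx, fun x' v' h' => h'.eqOn hcontrol hζ hx⟩
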